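/- **Model.** Let $0<\pi\le 1$, let $g_\mu,g_\sigma$ be probability distributions on $\mathbb R$ with $g_\mu(\{0\})=0$, and let $(\mu_i,\sigma_i,X_i)$, $i\ge 1$, be independent triples with $\sigma_i>0$ such that $\mu_i\sim(1-\pi)\delta_0+\pi g_\mu$ and $\sigma_i^2\sim g_\sigma$ are independent and $X_i\mid\mu_i,\sigma_i^2\sim N(\mu_i,\sigma_i^2)$. Write $\phi_h(z)=\frac1{\sqrt{2\pi}\,h}e^{-z^2/(2h^2)}$ (in this formula $\pi$ is the circle constant), $f_{0,\sigma}(x)=\phi_\sigma(x)$, $f_{1,\sigma}(x)=\int\phi_\sigma(x-u)\,g_\mu(du)$, $f_\sigma=(1-\pi)f_{0,\sigma}+\pi f_{1,\sigma}$, and $T_i=(1-\pi)f_{0,\sigma_i}(X_i)/f_{\sigma_i}(X_i)$. **Estimators.** Given bandwidths $h_x=h_x(m)>0$, $h_\sigma=h_\sigma(m)>0$ and an estimator $\hat\pi=\hat\pi_m$ with values in $[0,1]$, put, for weights $w=(w_j)_{j\le m}$, $$\hat f^{\,w}_{\sigma}(x)=\sum_{j=1}^m\frac{w_j\,\phi_{h_\sigma}(\sigma-\sigma_j)}{\sum_{k=1}^m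 w_k\,\phi_{h_\sigma}(\sigma-\sigma_k)}\,\phi_{h_x\sigma_j}(x-X_j),$$ and let $\hat f^*_\sigma$ be $\hat f^{\,w}_\sigma$ with $w\equiv1$. Define $\hat T^{(0)}_j=\min\{(1-\hat\pi)f_{0,\sigma_j}(X_j)/\hat f^*_{\sigma_j}(X_j),\,1\}$; for $l=0,1$ let $\hat f^{(l)}_{1,\sigma}=\hat f^{\,w}_\sigma$ with $w_j=1-\hat T^{(l)}_j$, and $$\hat T^{(l+1)}_j=\frac{(1-\hat\pi)f_{0,\sigma_j}(X_j)}{(1-\hat\pi)f_{0,\sigma_j}(X_j)+\hat\pi\,\hat f^{(l)}_{1,\sigma_j}(X_j)}.$$ Finally let $\hat f_\sigma=(1-\hat\pi)f_{0,\sigma}+\hat\pi\,\hat f^{(1)}_{1,\sigma}$ and $\hat T_i=\hat T^{(2)}_i$ (quotients with denominator $0$ are read as $0$). **Assumptions.** (C1) $\operatorname{supp}g_\sigma\subset(M_1,M_2)$ and $\operatorname{supp}g_\mu\subset(-M,M)$ for some $M_1>0$, $M_2<\infty$, $M<\infty$. (C2) The kernel is the Gaussian kernel $\phi$ used above. (The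 required regularity of $f_\sigma$, namely a bounded continuous second derivative and square integrability, then holds automatically.) (C3) As $m\to\infty$: $h_\sigma\to0$, $h_x=o((\log m)^{-1})$, $m h_xh_\sigma^2\to\infty$, and for some $\delta>0$, $m^{1-\delta}h_\sigma h_x^2\to\infty$ and $m^{-\delta/2}h_\sigma^2h_x^{-1}\to0$. (C4) $\hat\pi\to\pi$ in probability. **Conclusion.** For every $\sigma>0$ at which $g_\sigma$ has positive lower density, i.e. $g_\sigma([\sigma^2-r,\sigma^2+r])\ge cr$ for some $c>0$ and all sufficiently small $r>0$, and in particular for every $\sigma=\sqrt v$ with $v$ outside a $g_\sigma$-null set, $$\mathbb E\int\{\hat f_\sigma(x)-f_\sigma(x)\}^2\,dx\longrightarrow0\qquad(m\to\infty).$$ Moreover $\hat T_i\to T_i$ in probability for each $i$, and uniformly in $i$: for every $\varepsilon>0$, $\max_{1\le i\le m}\mathbb P(|\hat T_i-T_i|\ge\varepsilon)\to0$. -/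

import Mathlib

open MeasureTheory ProbabilityTheory Filter Topology Asymptotics

namespace HART

/-- The Gaussian kernel `φ_h(z) = exp (-z² / (2 h²)) / (√(2π) h)`. -/
noncomputable def phi (h z : ℝ) : ℝ :=
  (√(2 * Real.pi) * h)⁻¹ * Real.exp (-z ^ 2 / (2 * h ^ 2))

/-! ### The model -/

/-- The null density `f_{0,σ}`. -/
noncomputable def f0 (σ x : ℝ) : ℝ := phi σ x

/-- The alternative density `f_{1,σ}(x) = ∫ φ_σ(x - u) g_μ(du)`. -/
noncomputable def f1 (gμ : Measure ℝ) (σ x : ℝ) : ℝ := ∫ u, phi σ (x - u) ∂gμ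

/-- The mixture density `f_σ`; `p` is the proportion of non-nulls. -/
noncomputable def fMix (p : ℝ) (gμ : Measure ℝ) (σ x : ℝ) : ℝ :=
  (1 - p) * f0 σ x + p * f1 gμ σ x

/-- The oracle statistic `T(x, σ)`. -/
noncomputable def oracleT (p : ℝ) (gμ : Measure ℝ) (x σ : ℝ) : ℝ :=
  (1 - p) * f0 σ x / fMix p gμ σ x

/-- The prior `(1 - p) δ₀ + p g_μ` of the means. -/
noncomputable def meanPrior (p : ℝ) (gμ : Measure ℝ) : Measure ℝ :=
  ENNReal.ofReal (1 - p) • Measure.dirac 0 + ENNReal.ofReal p • gμ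

/-- The hierarchical model: the triples `(μ_i, σ_i, X_i)` are independent over `i`, the mean
`μ_i ~ (1 - p) δ₀ + p g_μ` and the variance `σ_i² ~ g_σ` are independent of each other, and
`X_i` given `(μ_i, σ_i²)` is normal with mean `μ_i` and variance `σ_i²`. The distribution `g_μ`
of the non-null means has no mass at `0`, so that `μ_i ≠ 0` identifies the non-nulls. -/
structure Model {Ω : Type*} [MeasurableSpace Ω] (P : Measure Ω) [IsProbabilityMeasure P]
    (p : ℝ) (gμ gσ : Measure ℝ) (μ σ X : ℕ → Ω → ℝ) : Prop where
  p_pos : 0 < p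
  p_le_one : p ≤ 1
  gμ_zero : gμ {0} = 0
  measurable_μ : ∀ i, Measurable (μ i)
  measurable_σ : ∀ i, Measurable (σ i)
  measurable_X : ∀ i, Measurable (X i)
  σ_pos : ∀ i, ∀ᵐ ω ∂P, 0 < σ i ω
  indep : iIndepFun (fun i ω => (μ i ω, σ i ω, X i ω)) P
  prior : ∀ i, P.map (fun ω => (μ i ω, σ i ω ^ 2)) = (meanPrior p gμ).prod gσ
  normal : ∀ i, ∀ᵐ q ∂P.map (fun ω => (μ i ω, σ i ω ^ 2)),
    condDistrib (X i) (fun ω => (μ i ω, σ i ω ^ 2)) P q = gaussianReal q.1 q.2.toNNReal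

/-- The supports of `g_σ` and `g_μ` lie in `(M₁, M₂)` with `M₁ > 0`, and in `(-M, M)`. -/
def SupportCondition (gμ gσ : Measure ℝ) : Prop :=
  ∃ M₁ M₂ M : ℝ, 0 < M₁ ∧ gσ.support ⊆ Set.Ioo M₁ M₂ ∧ gμ.support ⊆ Set.Ioo (-M) M

/-- The conditions on the bandwidths `h_x` and `h_σ`. -/
structure BandwidthCondition (hx hσ : ℕ → ℝ) : Prop where
  hx_pos : ∀ m, 0 < hx m
  hσ_pos : ∀ m, 0 < hσ m
  hσ_zero : Tendsto hσ atTop (𝓝 0)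
  hx_log : hx =o[atTop] fun m : ℕ => (Real.log m)⁻¹
  lim₁ : Tendsto (fun m : ℕ => (m : ℝ) * hx m * hσ m ^ 2) atTop atTop
  exists_δ : ∃ δ : ℝ, 0 < δ ∧
    Tendsto (fun m : ℕ => (m : ℝ) ^ (1 - δ) * hσ m * hx m ^ 2) atTop atTop ∧
    Tendsto (fun m : ℕ => (m : ℝ) ^ (-δ / 2) * hσ m ^ 2 * (hx m)⁻¹) atTop (𝓝 0)

/-- `ν` has positive lower density at `v`: `ν [v - r, v + r] ≥ c r` for all small `r > 0`. -/
def PosLowerDensity (ν : Measure ℝ) (v : ℝ) : Prop :=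
  ∃ c : ℝ, 0 < c ∧ ∀ᶠ r in 𝓝[>] (0 : ℝ), ENNReal.ofReal (c * r) ≤ ν (Metric.closedBall v r)

/-! ### The estimators, computed from data `(x_j, s_j)`, `j < m` -/

/-- The bivariate kernel estimator with weights `w_j`, evaluated at `(σ, t)`. -/
noncomputable def weightedKDE (hx hσ : ℝ) (m : ℕ) (w x s : ℕ → ℝ) (σ t : ℝ) : ℝ :=
  ∑ j ∈ Finset.range m,
    w j * phi hσ (σ - s j) / (∑ k ∈ Finset.range m, w k * phi hσ (σ - s k)) *
      phi (hx * s j) (t - x j)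

/-- The initial estimator `f*_σ(t)` of the mixture density (all weights equal). -/
noncomputable def fStar (hx hσ : ℝ) (m : ℕ) (x s : ℕ → ℝ) (σ t : ℝ) : ℝ :=
  weightedKDE hx hσ m (fun _ => 1) x s σ t

/-- The estimate of `T(t, σ)` obtained from estimates `q` of the non-null proportion and
`a` of `f_{1,σ}(t)`. -/
noncomputable def plugInT (q σ t a : ℝ) : ℝ :=
  (1 - q) * f0 σ t / ((1 - q) * f0 σ t + q * a)

/-- The initial estimate of `T_j`. -/
noncomputable def T0 (hx hσ q : ℝ) (m : ℕ) (x s : ℕ → ℝ) (j : ℕ) : ℝ :=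
  min ((1 - q) * f0 (s j) (x j) / fStar hx hσ m x s (s j) (x j)) 1

/-- The first-step estimator of `f_{1,σ}(t)`. -/
noncomputable def f1Hat0 (hx hσ q : ℝ) (m : ℕ) (x s : ℕ → ℝ) (σ t : ℝ) : ℝ :=
  weightedKDE hx hσ m (fun j => 1 - T0 hx hσ q m x s j) x s σ t

/-- The updated estimate of `T_j`. -/
noncomputable def T1 (hx hσ q : ℝ) (m : ℕ) (x s : ℕ → ℝ) (j : ℕ) : ℝ :=
  plugInT q (s j) (x j) (f1Hat0 hx hσ q m x s (s j) (x j))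

/-- The second-step estimator of `f_{1,σ}(t)`. -/
noncomputable def f1Hat1 (hx hσ q : ℝ) (m : ℕ) (x s : ℕ → ℝ) (σ t : ℝ) : ℝ :=
  weightedKDE hx hσ m (fun j => 1 - T1 hx hσ q m x s j) x s σ t

/-- The two-step estimator of the mixture density `f_σ(t)`. -/
noncomputable def fHat (hx hσ q : ℝ) (m : ℕ) (x s : ℕ → ℝ) (σ t : ℝ) : ℝ :=
  (1 - q) * f0 σ t + q * f1Hat1 hx hσ q m x s σ t

/-- The final estimate of `T_i`. -/
noncomputable def THat (hx hσ q : ℝ) (m : ℕ) (x s : ℕ → ℝ) (i : ℕ) : ℝ :=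
  plugInT q (s i) (x i) (f1Hat1 hx hσ q m x s (s i) (x i))

/-- The integrated mean squared error `E ∫ (f̂_σ(t) - f_σ(t))² dt` at the point `σ₀`, for sample
size `m`, bandwidths `hx`, `hσ` and estimated proportion `pHat`; a value in `[0, ∞]`. -/
noncomputable def mise {Ω : Type*} [MeasurableSpace Ω] (P : Measure Ω) (p : ℝ) (gμ : Measure ℝ)
    (σ X : ℕ → Ω → ℝ) (hx hσ : ℝ) (pHat : Ω → ℝ) (m : ℕ) (σ₀ : ℝ) : ENNReal :=
  ∫⁻ ω, (∫⁻ t : ℝ, ENNReal.ofReal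
    ((fHat hx hσ (pHat ω) m (fun j => X j ω) (fun j => σ j ω) σ₀ t - fMix p gμ σ₀ t) ^ 2)) ∂P

end HART

set_option linter.unusedSectionVars false

namespace HART

/-! ### The Gaussian kernel -/

lemma measurable_phi : Measurable fun z : ℝ × ℝ => phi z.1 z.2 := by
  unfold phi; fun_prop

@[fun_prop]
lemma Measurable.phi {α : Type*} [MeasurableSpace α] {f g : α → ℝ} (hf : Measurable f)
    (hg : Measurable g) : Measurable fun a => phi (f a) (g a) :=
  measurable_phi.comp (hf.prodMk hg)

lemma phi_pos {h : ℝ} (hh : 0 < h) (z : ℝ) : 0 < phi h z := by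
  unfold phi; positivity

lemma phi_nonneg {h : ℝ} (hh : 0 ≤ h) (z : ℝ) : 0 ≤ phi h z := by
  unfold phi; positivity

lemma one_le_sqrt_two_pi : 1 ≤ √(2 * Real.pi) := by
  rw [Real.one_le_sqrt]; linarith [Real.pi_gt_three]

lemma inv_sqrt_two_pi_mul_le {h : ℝ} (hh : 0 < h) : (√(2 * Real.pi) * h)⁻¹ ≤ h⁻¹ := by
  apply inv_anti₀ hh
  nlinarith [one_le_sqrt_two_pi]

lemma phi_le_mul_exp {h : ℝ} (hh : 0 < h) (z : ℝ) :
    phi h z ≤ h⁻¹ * Real.exp (-z ^ 2 / (2 * h ^ 2)) := by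
  exact mul_le_mul_of_nonneg_right (inv_sqrt_two_pi_mul_le hh) (Real.exp_pos _).le

lemma phi_le {h : ℝ} (hh : 0 < h) (z : ℝ) : phi h z ≤ h⁻¹ := by
  refine (phi_le_mul_exp hh z).trans ?_
  have : Real.exp (-z ^ 2 / (2 * h ^ 2)) ≤ 1 := by
    rw [Real.exp_le_one_iff]
    exact div_nonpos_of_nonpos_of_nonneg (by nlinarith [sq_nonneg z]) (by positivity)
  have h1 : 0 < h⁻¹ := by positivity
  nlinarith

lemma phi_neg (h z : ℝ) : phi h (-z) = phi h z := by simp [phi]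

lemma phi_anti {h : ℝ} (hh : 0 ≤ h) {y z : ℝ} (hyz : |y| ≤ |z|) : phi h z ≤ phi h y := by
  unfold phi
  have : y ^ 2 ≤ z ^ 2 := sq_le_sq.mpr hyz
  gcongr

lemma phi_eq_gaussianPDFReal {h : ℝ} (hh : 0 < h) (u x : ℝ) :
    phi h (x - u) = gaussianPDFReal u ((h ^ 2).toNNReal) x := by
  rw [gaussianPDFReal, phi, Real.coe_toNNReal _ (sq_nonneg h),
    Real.sqrt_mul (by positivity) (h ^ 2), Real.sqrt_sq hh.le]

lemma integrable_phi_sub {h : ℝ} (hh : 0 < h) (u : ℝ) : Integrable fun x => phi h (x - u) := by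
  simp_rw [phi_eq_gaussianPDFReal hh]
  exact integrable_gaussianPDFReal _ _

lemma integral_phi_sub {h : ℝ} (hh : 0 < h) (u : ℝ) : ∫ x, phi h (x - u) = 1 := by
  simp_rw [phi_eq_gaussianPDFReal hh]
  exact integral_gaussianPDFReal_eq_one _ (by simpa using hh.ne')

lemma phi_sub_comm (h x u : ℝ) : phi h (x - u) = phi h (u - x) := by
  rw [← phi_neg, neg_sub]

lemma integrable_phi_sub' {h : ℝ} (hh : 0 < h) (x : ℝ) : Integrable fun u => phi h (x - u) := by
  simp_rw [phi_sub_comm h x]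
  exact integrable_phi_sub hh x

lemma integral_phi_sub' {h : ℝ} (hh : 0 < h) (x : ℝ) : ∫ u, phi h (x - u) = 1 := by
  simp_rw [phi_sub_comm h x]
  exact integral_phi_sub hh x

lemma lintegral_phi_sub {h : ℝ} (hh : 0 < h) (u : ℝ) :
    ∫⁻ x, ENNReal.ofReal (phi h (x - u)) = 1 := by
  rw [← ofReal_integral_eq_lintegral_ofReal (integrable_phi_sub hh u)
    (ae_of_all _ fun x => phi_nonneg hh.le _), integral_phi_sub hh, ENNReal.ofReal_one]

lemma lintegral_phi_sub' {h : ℝ} (hh : 0 < h) (u : ℝ) :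
    ∫⁻ x, ENNReal.ofReal (phi h (u - x)) = 1 := by
  simp_rw [phi_sub_comm h u]
  exact lintegral_phi_sub hh u

/-- The first absolute moment is controlled by a wider kernel. -/
lemma phi_mul_abs_le {h : ℝ} (hh : 0 < h) (z : ℝ) : phi h z * |z| ≤ 2 * h * phi (2 * h) z := by
  unfold phi
  have key : |z| ≤ h * Real.exp (3 * z ^ 2 / (8 * h ^ 2)) := by
    have h1 := Real.add_one_le_exp (3 * z ^ 2 / (8 * h ^ 2))
    have h2 : |z| ≤ h * (3 * z ^ 2 / (8 * h ^ 2) + 1) := by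
      have : h * (3 * z ^ 2 / (8 * h ^ 2) + 1) = (3 * z ^ 2 + 8 * h ^ 2) / (8 * h) := by
        field_simp
      rw [this, le_div_iff₀ (by positivity), ← sq_abs z]
      nlinarith [sq_nonneg (3 * |z| - 4 * h), sq_nonneg h]
    exact h2.trans (by gcongr)
  have e1 : Real.exp (-z ^ 2 / (2 * (2 * h) ^ 2)) =
      Real.exp (-z ^ 2 / (2 * h ^ 2)) * Real.exp (3 * z ^ 2 / (8 * h ^ 2)) := by
    rw [← Real.exp_add]; congr 1; field_simp; ring
  have e2 : 2 * h * ((√(2 * Real.pi) * (2 * h))⁻¹ * Real.exp (-z ^ 2 / (2 * (2 * h) ^ 2))) =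
      (√(2 * Real.pi) * h)⁻¹ * Real.exp (-z ^ 2 / (2 * h ^ 2)) *
        (h * Real.exp (3 * z ^ 2 / (8 * h ^ 2))) := by
    rw [e1]
    have : √(2 * Real.pi) ≠ 0 := by positivity
    field_simp
  rw [e2]
  gcongr

lemma sq_mul_phi_le {h : ℝ} (hh : 0 < h) (z : ℝ) : z ^ 2 * phi h z ≤ 2 * h := by
  have h1 := phi_le_mul_exp hh z
  have h2 := Real.add_one_le_exp (z ^ 2 / (2 * h ^ 2))
  have h3 : Real.exp (-z ^ 2 / (2 * h ^ 2)) * Real.exp (z ^ 2 / (2 * h ^ 2)) = 1 := by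
    rw [← Real.exp_add]; simp [neg_div]
  have h4 : z ^ 2 ≤ 2 * h ^ 2 * Real.exp (z ^ 2 / (2 * h ^ 2)) := by
    have : z ^ 2 = 2 * h ^ 2 * (z ^ 2 / (2 * h ^ 2)) := by field_simp
    calc z ^ 2 = 2 * h ^ 2 * (z ^ 2 / (2 * h ^ 2)) := this
      _ ≤ _ := by gcongr; linarith
  calc z ^ 2 * phi h z
      ≤ (2 * h ^ 2 * Real.exp (z ^ 2 / (2 * h ^ 2))) *
        (h⁻¹ * Real.exp (-z ^ 2 / (2 * h ^ 2))) := by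
        have := phi_nonneg hh.le z
        gcongr
    _ = 2 * h ^ 2 * h⁻¹ * (Real.exp (-z ^ 2 / (2 * h ^ 2)) * Real.exp (z ^ 2 / (2 * h ^ 2))) := by
        ring
    _ = 2 * h := by rw [h3]; field_simp

lemma hasDerivAt_phi_right {h : ℝ} (hh : 0 < h) (z : ℝ) :
    HasDerivAt (phi h) (-(z / h ^ 2) * phi h z) z := by
  have h1 : HasDerivAt (fun z : ℝ => -z ^ 2 / (2 * h ^ 2)) (-(z / h ^ 2)) z := by
    refine (((hasDerivAt_pow 2 z).neg).div_const (2 * h ^ 2)).congr_deriv ?_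
    simp; field_simp
  exact ((h1.exp).const_mul ((√(2 * Real.pi) * h)⁻¹)).congr_deriv (by unfold phi; ring)

lemma hasDerivAt_phi_left {h : ℝ} (hh : 0 < h) (z : ℝ) :
    HasDerivAt (fun h => phi h z) ((z ^ 2 / h ^ 3 - h⁻¹) * phi h z) h := by
  have h1 : HasDerivAt (fun h : ℝ => -z ^ 2 / (2 * h ^ 2)) (z ^ 2 / h ^ 3) h := by
    refine ((hasDerivAt_const h (-z ^ 2)).div ((hasDerivAt_pow 2 h).const_mul 2)
      (by positivity)).congr_deriv ?_
    simp; field_simp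
  have h2 : HasDerivAt (fun h : ℝ => (√(2 * Real.pi) * h)⁻¹) (-(√(2 * Real.pi) * h)⁻¹ * h⁻¹) h := by
    have h0 : √(2 * Real.pi) ≠ 0 := by positivity
    refine (((hasDerivAt_id h).const_mul (√(2 * Real.pi))).inv
      (mul_ne_zero h0 hh.ne')).congr_deriv ?_
    simp only [id, mul_one]; field_simp
  exact (h2.mul h1.exp).congr_deriv (by unfold phi; ring)

lemma abs_phi_sub_phi_right_le {lo s : ℝ} (hlo : 0 < lo) (hs : lo ≤ s) (y z : ℝ) :
    |phi s y - phi s z| ≤ 3 / lo ^ 2 * |y - z| := by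
  have hs0 : 0 < s := hlo.trans_le hs
  have := Convex.norm_image_sub_le_of_norm_hasDerivWithin_le (f := phi s)
    (f' := fun z => -(z / s ^ 2) * phi s z) (C := 3 / lo ^ 2) (s := Set.univ)
    (fun z _ => (hasDerivAt_phi_right hs0 z).hasDerivWithinAt) (fun z _ => ?_) convex_univ
    (Set.mem_univ z) (Set.mem_univ y)
  · simpa using this
  · have h1 := phi_mul_abs_le hs0 z
    have h2 := phi_le (h := 2 * s) (by positivity) z
    have h3 : phi s z * |z| ≤ 1 := by
      calc phi s z * |z| ≤ 2 * s * phi (2 * s) z := h1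
        _ ≤ 2 * s * (2 * s)⁻¹ := by gcongr
        _ = 1 := by field_simp
    rw [Real.norm_eq_abs, abs_mul, abs_neg, abs_div, abs_of_pos (phi_pos hs0 z),
      abs_of_pos (by positivity : 0 < s ^ 2)]
    calc |z| / s ^ 2 * phi s z = phi s z * |z| / s ^ 2 := by ring
      _ ≤ 1 / lo ^ 2 := by gcongr
      _ ≤ 3 / lo ^ 2 := by gcongr; norm_num

lemma abs_phi_sub_phi_left_le {lo s t : ℝ} (hlo : 0 < lo) (hs : lo ≤ s) (ht : lo ≤ t) (z : ℝ) :
    |phi s z - phi t z| ≤ 3 / lo ^ 2 * |s - t| := by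
  have := Convex.norm_image_sub_le_of_norm_hasDerivWithin_le (f := fun s => phi s z)
    (f' := fun s => (z ^ 2 / s ^ 3 - s⁻¹) * phi s z) (C := 3 / lo ^ 2) (s := Set.Ici lo)
    (fun s hs => (hasDerivAt_phi_left (hlo.trans_le hs) z).hasDerivWithinAt) (fun s hs => ?_)
    (convex_Ici lo) (Set.mem_Ici.2 ht) (Set.mem_Ici.2 hs)
  · simpa using this
  · have hs' : lo ≤ s := hs
    have hs0 : 0 < s := hlo.trans_le hs
    have h1 := sq_mul_phi_le hs0 z
    have h2 := phi_le hs0 z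
    have h0 := phi_nonneg hs0.le z
    rw [Real.norm_eq_abs]
    have e : (z ^ 2 / s ^ 3 - s⁻¹) * phi s z = z ^ 2 * phi s z / s ^ 3 - s⁻¹ * phi s z := by ring
    have h3 : z ^ 2 * phi s z / s ^ 3 ≤ 2 / s ^ 2 := by
      calc z ^ 2 * phi s z / s ^ 3 ≤ 2 * s / s ^ 3 := by gcongr
        _ = 2 / s ^ 2 := by field_simp
    have h4 : s⁻¹ * phi s z ≤ 1 / s ^ 2 := by
      calc s⁻¹ * phi s z ≤ s⁻¹ * s⁻¹ := by gcongr
        _ = 1 / s ^ 2 := by field_simp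
    have h5 : 0 ≤ z ^ 2 * phi s z / s ^ 3 := by positivity
    have h6 : 0 ≤ s⁻¹ * phi s z := by positivity
    have h7 : 3 / s ^ 2 ≤ 3 / lo ^ 2 := by gcongr
    have h8 : 2 / s ^ 2 + 1 / s ^ 2 = 3 / s ^ 2 := by ring
    have h9 : 0 < 1 / s ^ 2 := by positivity
    have h10 : 0 < 2 / s ^ 2 := by positivity
    rw [e, abs_le]
    constructor <;> linarith

lemma abs_phi_sub_phi_le {lo s t : ℝ} (hlo : 0 < lo) (hs : lo ≤ s) (ht : lo ≤ t) (y z : ℝ) :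
    |phi s y - phi t z| ≤ 3 / lo ^ 2 * (|s - t| + |y - z|) := by
  have h1 := abs_phi_sub_phi_left_le hlo hs ht y
  have h2 := abs_phi_sub_phi_right_le hlo ht y z
  have := abs_sub_le (phi s y) (phi t y) (phi t z)
  linarith

/-- The constant of the envelope `C / (1 + x²)` of the mixture densities. -/
noncomputable def envC (lo hi M : ℝ) : ℝ := 2 * hi * (2 + (1 + 2 * M ^ 2) / (2 * lo ^ 2))

lemma envC_pos {lo hi : ℝ} (hlo : 0 < lo) (hle : lo ≤ hi) (M : ℝ) : 0 < envC lo hi M := by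
  have : 0 < hi := hlo.trans_le hle
  unfold envC; positivity

lemma phi_sub_le_env {lo hi M s u : ℝ} (hlo : 0 < lo) (hs : s ∈ Set.Icc lo hi) (hu : |u| ≤ M)
    (x : ℝ) : phi s (x - u) ≤ envC lo hi M * (1 + x ^ 2)⁻¹ := by
  have hs0 : 0 < s := hlo.trans_le hs.1
  have hhi : 0 < hi := hs0.trans_le hs.2
  set y := x - u with hy
  have h1 : phi s y ≤ 2 * s / (2 * s ^ 2 + y ^ 2) := by
    rw [le_div_iff₀ (by positivity)]
    have a1 := phi_le_mul_exp hs0 y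
    have a2 := Real.add_one_le_exp (y ^ 2 / (2 * s ^ 2))
    have a3 : Real.exp (-y ^ 2 / (2 * s ^ 2)) * Real.exp (y ^ 2 / (2 * s ^ 2)) = 1 := by
      rw [← Real.exp_add]; simp [neg_div]
    have a4 : 2 * s ^ 2 + y ^ 2 ≤ 2 * s ^ 2 * Real.exp (y ^ 2 / (2 * s ^ 2)) := by
      calc 2 * s ^ 2 + y ^ 2 = 2 * s ^ 2 * (y ^ 2 / (2 * s ^ 2) + 1) := by field_simp; ring
        _ ≤ _ := by gcongr
    calc phi s y * (2 * s ^ 2 + y ^ 2)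
        ≤ (s⁻¹ * Real.exp (-y ^ 2 / (2 * s ^ 2))) *
          (2 * s ^ 2 * Real.exp (y ^ 2 / (2 * s ^ 2))) := by gcongr
      _ = s⁻¹ * (2 * s ^ 2) * (Real.exp (-y ^ 2 / (2 * s ^ 2)) *
          Real.exp (y ^ 2 / (2 * s ^ 2))) := by ring
      _ = 2 * s := by rw [a3]; field_simp
  have h2 : 2 * s / (2 * s ^ 2 + y ^ 2) ≤ 2 * hi / (2 * lo ^ 2 + y ^ 2) := by
    have := hs.1
    have := hs.2
    gcongr
  refine h1.trans (h2.trans ?_)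
  have hu2 : u ^ 2 ≤ M ^ 2 := by rw [← sq_abs u]; gcongr
  have h3 : 1 + x ^ 2 ≤ (2 + (1 + 2 * M ^ 2) / (2 * lo ^ 2)) * (2 * lo ^ 2 + y ^ 2) := by
    have e : (1 + 2 * M ^ 2) / (2 * lo ^ 2) * (2 * lo ^ 2) = 1 + 2 * M ^ 2 := by field_simp
    have e' : 0 ≤ (1 + 2 * M ^ 2) / (2 * lo ^ 2) * y ^ 2 := by positivity
    have : x = y + u := by simp [hy]
    rw [this]
    nlinarith [sq_nonneg (y - u), sq_nonneg lo]
  rw [div_le_iff₀ (by positivity), envC, mul_assoc, mul_assoc]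
  have : 1 ≤ (2 + (1 + 2 * M ^ 2) / (2 * lo ^ 2)) * ((1 + x ^ 2)⁻¹ * (2 * lo ^ 2 + y ^ 2)) := by
    have h4 : (2 + (1 + 2 * M ^ 2) / (2 * lo ^ 2)) * ((1 + x ^ 2)⁻¹ * (2 * lo ^ 2 + y ^ 2)) =
      (2 + (1 + 2 * M ^ 2) / (2 * lo ^ 2)) * (2 * lo ^ 2 + y ^ 2) / (1 + x ^ 2) := by
        field_simp
    rw [h4, one_le_div (by positivity)]; exact h3
  nlinarith

/-- The lower bound of the mixture densities on `|x| ≤ R`. -/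
noncomputable def lowC (lo hi M R : ℝ) : ℝ :=
  (√(2 * Real.pi) * hi)⁻¹ * Real.exp (-(R + M) ^ 2 / (2 * lo ^ 2))

lemma lowC_pos {lo hi : ℝ} (hlo : 0 < lo) (hle : lo ≤ hi) (M R : ℝ) : 0 < lowC lo hi M R := by
  have : 0 < hi := hlo.trans_le hle
  unfold lowC; positivity

lemma lowC_le_phi_sub {lo hi M R s u x : ℝ} (hlo : 0 < lo) (hs : s ∈ Set.Icc lo hi)
    (hu : |u| ≤ M) (hx : |x| ≤ R) : lowC lo hi M R ≤ phi s (x - u) := by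
  have hs0 : 0 < s := hlo.trans_le hs.1
  unfold lowC phi
  have h1 : |x - u| ≤ |R + M| := by
    have := abs_sub x u
    have := le_abs_self (R + M)
    linarith
  have h2 : (x - u) ^ 2 ≤ (R + M) ^ 2 := sq_le_sq.mpr h1
  have h3 : (x - u) ^ 2 / (2 * s ^ 2) ≤ (R + M) ^ 2 / (2 * lo ^ 2) := by
    have := hs.1
    gcongr
  have := hs.2
  gcongr ?_ * Real.exp ?_
  · gcongr
  · rw [neg_div, neg_div]; linarith

/-! ### The normal mixtures -/

section mixture

variable {G : Measure ℝ} [IsProbabilityMeasure G] {lo hi M : ℝ}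

lemma measurable_f1 (G : Measure ℝ) [SFinite G] : Measurable fun z : ℝ × ℝ => f1 G z.1 z.2 := by
  unfold f1
  have : StronglyMeasurable fun q : (ℝ × ℝ) × ℝ => phi q.1.1 (q.1.2 - q.2) :=
    (by fun_prop : Measurable fun q : (ℝ × ℝ) × ℝ => phi q.1.1 (q.1.2 - q.2)).stronglyMeasurable
  exact (this.integral_prod_right (ν := G)).measurable

lemma integrable_phi_measure {s : ℝ} (hs : 0 < s) (x : ℝ) (G : Measure ℝ) [IsFiniteMeasure G] :
    Integrable (fun u => phi s (x - u)) G := by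
  refine Integrable.of_bound (C := s⁻¹) ?_ (ae_of_all _ fun u => ?_)
  · exact (by fun_prop : Measurable fun u => phi s (x - u)).aestronglyMeasurable
  · rw [Real.norm_eq_abs, abs_of_nonneg (phi_nonneg hs.le _)]
    exact phi_le hs _

lemma f1_nonneg {s : ℝ} (hs : 0 ≤ s) (x : ℝ) (G : Measure ℝ) : 0 ≤ f1 G s x :=
  integral_nonneg fun _ => phi_nonneg hs _

lemma f1_le {s : ℝ} (hs : 0 < s) (x : ℝ) : f1 G s x ≤ s⁻¹ := by
  have := integral_mono (integrable_phi_measure hs x G) (integrable_const s⁻¹)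
    (fun u => phi_le hs (x - u))
  simpa [f1] using this

lemma f1_le_of_le {s : ℝ} (hlo : 0 < lo) (hs : lo ≤ s) (x : ℝ) : f1 G s x ≤ lo⁻¹ :=
  (f1_le (hlo.trans_le hs) x).trans (inv_anti₀ hlo hs)

lemma f1_le_env {s : ℝ} (hlo : 0 < lo) (hs : s ∈ Set.Icc lo hi) (hG : ∀ᵐ u ∂G, |u| ≤ M) (x : ℝ) :
    f1 G s x ≤ envC lo hi M * (1 + x ^ 2)⁻¹ := by
  have := integral_mono_ae (integrable_phi_measure (hlo.trans_le hs.1) x G)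
    (integrable_const (envC lo hi M * (1 + x ^ 2)⁻¹))
    (hG.mono fun u hu => phi_sub_le_env hlo hs hu x)
  simpa [f1] using this

lemma lowC_le_f1 {s x R : ℝ} (hlo : 0 < lo) (hs : s ∈ Set.Icc lo hi) (hG : ∀ᵐ u ∂G, |u| ≤ M)
    (hx : |x| ≤ R) : lowC lo hi M R ≤ f1 G s x := by
  have := integral_mono_ae (integrable_const (lowC lo hi M R))
    (integrable_phi_measure (hlo.trans_le hs.1) x G)
    (hG.mono fun u hu => lowC_le_phi_sub hlo hs hu hx)
  simpa [f1] using this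

lemma abs_f1_sub_f1_le {s t : ℝ} (hlo : 0 < lo) (hs : lo ≤ s) (ht : lo ≤ t) (x y : ℝ) :
    |f1 G s x - f1 G t y| ≤ 3 / lo ^ 2 * (|s - t| + |x - y|) := by
  unfold f1
  rw [← integral_sub (integrable_phi_measure (hlo.trans_le hs) x G)
    (integrable_phi_measure (hlo.trans_le ht) y G)]
  have := norm_integral_le_of_norm_le_const (μ := G)
    (f := fun u => phi s (x - u) - phi t (y - u)) (C := 3 / lo ^ 2 * (|s - t| + |x - y|))
    (ae_of_all _ fun u => by
      have := abs_phi_sub_phi_le hlo hs ht (x - u) (y - u)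
      simpa using this)
  simpa using this

lemma lintegral_f1 {s : ℝ} (hs : 0 < s) : ∫⁻ x, ENNReal.ofReal (f1 G s x) = 1 := by
  have : ∀ x, ENNReal.ofReal (f1 G s x) = ∫⁻ u, ENNReal.ofReal (phi s (x - u)) ∂G := fun x =>
    ofReal_integral_eq_lintegral_ofReal (integrable_phi_measure hs x G)
      (ae_of_all _ fun u => phi_nonneg hs.le _)
  simp_rw [this]
  rw [lintegral_lintegral_swap
    (by exact (by fun_prop : Measurable fun q : ℝ × ℝ =>
      ENNReal.ofReal (phi s (q.1 - q.2))).aemeasurable)]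
  simp_rw [lintegral_phi_sub hs]
  simp

lemma integrable_f1 {s : ℝ} (hs : 0 < s) : Integrable (f1 G s) := by
  refine ⟨((measurable_f1 G).comp measurable_prodMk_left).aestronglyMeasurable, ?_⟩
  rw [hasFiniteIntegral_iff_ofReal (ae_of_all _ fun x => f1_nonneg hs.le x G), lintegral_f1 hs]
  exact ENNReal.one_lt_top

lemma integral_f1 {s : ℝ} (hs : 0 < s) : ∫ x, f1 G s x = 1 := by
  rw [integral_eq_lintegral_of_nonneg_ae (ae_of_all _ fun x => f1_nonneg hs.le x G)
    (integrable_f1 hs).aestronglyMeasurable, lintegral_f1 hs, ENNReal.toReal_one]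

end mixture

section prior

variable {p : ℝ} {gμ : Measure ℝ} [IsProbabilityMeasure gμ]

lemma isProbabilityMeasure_meanPrior (hp : 0 ≤ p) (hp1 : p ≤ 1) (gμ : Measure ℝ)
    [IsProbabilityMeasure gμ] : IsProbabilityMeasure (meanPrior p gμ) := by
  constructor
  rw [meanPrior]
  simp only [Measure.add_apply, Measure.smul_apply, smul_eq_mul, measure_univ, mul_one]
  rw [← ENNReal.ofReal_add (by linarith) hp]
  simp

lemma fMix_eq_f1 (hp : 0 ≤ p) (hp1 : p ≤ 1) {s : ℝ} (hs : 0 < s) (x : ℝ) :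
    fMix p gμ s x = f1 (meanPrior p gμ) s x := by
  unfold fMix f0 f1 meanPrior
  rw [integral_add_measure, integral_smul_measure, integral_smul_measure, integral_dirac]
  · simp [ENNReal.toReal_ofReal, hp, hp1]
  · exact (integrable_phi_measure hs x _).smul_measure ENNReal.ofReal_ne_top
  · exact (integrable_phi_measure hs x _).smul_measure ENNReal.ofReal_ne_top

lemma ae_abs_le_meanPrior {M : ℝ} (hM : 0 ≤ M) (hG : ∀ᵐ u ∂gμ, |u| ≤ M) :
    ∀ᵐ u ∂meanPrior p gμ, |u| ≤ M := by
  unfold meanPrior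
  rw [ae_add_measure_iff]
  constructor
  · refine Measure.ae_smul_measure ?_ _
    simpa using hM
  · exact Measure.ae_smul_measure hG _

lemma measurable_fMix : Measurable fun z : ℝ × ℝ => fMix p gμ z.1 z.2 := by
  unfold fMix f0
  have := measurable_f1 gμ
  fun_prop

end prior

/-! ### The law of one observation -/

/-- The law of `(σ_i, X_i)` when `σ_i` has law `ρ`. -/
noncomputable def dataLaw (p : ℝ) (gμ ρ : Measure ℝ) : Measure (ℝ × ℝ) :=
  (ρ.prod volume).withDensity fun z => ENNReal.ofReal (fMix p gμ z.1 z.2)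

lemma lintegral_dataLaw {p : ℝ} {gμ ρ : Measure ℝ} [IsProbabilityMeasure gμ] [SFinite ρ]
    {g : ℝ × ℝ → ENNReal} (hg : Measurable g) :
    ∫⁻ z, g z ∂dataLaw p gμ ρ =
      ∫⁻ s, ∫⁻ x, ENNReal.ofReal (fMix p gμ s x) * g (s, x) ∂volume ∂ρ := by
  have hf : Measurable fun z : ℝ × ℝ => ENNReal.ofReal (fMix p gμ z.1 z.2) :=
    measurable_fMix.ennreal_ofReal
  rw [dataLaw, lintegral_withDensity_eq_lintegral_mul _ hf hg,
    lintegral_prod _ (hf.mul hg).aemeasurable]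
  rfl

/-- The observations `(σ_i, X_i)` are independent with law `dataLaw p gμ ρ`, with `σ_i` in
`[lo, hi]` and the means in `[-M, M]`. -/
structure IIDData {Ω : Type*} [MeasurableSpace Ω] (P : Measure Ω) (p : ℝ) (gμ ρ : Measure ℝ)
    (lo hi M : ℝ) (σ X : ℕ → Ω → ℝ) : Prop where
  p_pos : 0 < p
  p_le_one : p ≤ 1
  lo_pos : 0 < lo
  lo_le_hi : lo ≤ hi
  M_nonneg : 0 ≤ M
  gμ_ae : ∀ᵐ u ∂gμ, |u| ≤ M
  ρ_ae : ∀ᵐ s ∂ρ, s ∈ Set.Icc lo hi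
  measurable_σ : ∀ i, Measurable (σ i)
  measurable_X : ∀ i, Measurable (X i)
  indep : iIndepFun (fun i ω => (σ i ω, X i ω)) P
  law : ∀ i, P.map (fun ω => (σ i ω, X i ω)) = dataLaw p gμ ρ

lemma lintegral_prior_gaussian {p : ℝ} {gμ : Measure ℝ} [IsProbabilityMeasure gμ] (hp : 0 ≤ p)
    (hp1 : p ≤ 1) {v : ℝ} (hv : 0 < v) {g : ℝ → ENNReal} (hg : Measurable g) :
    ∫⁻ u, ∫⁻ x, g x ∂gaussianReal u v.toNNReal ∂meanPrior p gμ =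
      ∫⁻ x, ENNReal.ofReal (fMix p gμ √v x) * g x := by
  have := isProbabilityMeasure_meanPrior hp hp1 gμ
  have hs : 0 < √v := Real.sqrt_pos.2 hv
  have h1 : ∀ u, ∫⁻ x, g x ∂gaussianReal u v.toNNReal =
      ∫⁻ x, ENNReal.ofReal (phi √v (x - u)) * g x := by
    intro u
    rw [gaussianReal_of_var_ne_zero _ (by simpa using hv),
      lintegral_withDensity_eq_lintegral_mul _ (measurable_gaussianPDF _ _) hg]
    refine lintegral_congr fun x => ?_
    rw [Pi.mul_apply, gaussianPDF, phi_eq_gaussianPDFReal hs, Real.sq_sqrt hv.le]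
  simp_rw [h1]
  rw [lintegral_lintegral_swap]
  · refine lintegral_congr fun x => ?_
    rw [lintegral_mul_const _ (by fun_prop), fMix_eq_f1 hp hp1 hs, f1,
      ofReal_integral_eq_lintegral_ofReal (integrable_phi_measure hs x _)
      (ae_of_all _ fun u => phi_nonneg hs.le _)]
  · exact Measurable.aemeasurable (by fun_prop)

lemma Model.law_eq_dataLaw {Ω : Type*} [MeasurableSpace Ω] {P : Measure Ω}
    [IsProbabilityMeasure P] {p : ℝ} {gμ gσ : Measure ℝ} [IsProbabilityMeasure gμ]
    [IsProbabilityMeasure gσ] {μ σ X : ℕ → Ω → ℝ} (h : Model P p gμ gσ μ σ X)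
    (hpos : ∀ᵐ v ∂gσ, 0 < v) (i : ℕ) :
    P.map (fun ω => (σ i ω, X i ω)) = dataLaw p gμ (gσ.map Real.sqrt) := by
  have := isProbabilityMeasure_meanPrior h.p_pos.le h.p_le_one gμ
  have hmσ := h.measurable_σ i
  have hmX := h.measurable_X i
  have hmμ := h.measurable_μ i
  have hsq : Measurable Real.sqrt := Real.continuous_sqrt.measurable
  have : IsProbabilityMeasure (gσ.map Real.sqrt) := Measure.isProbabilityMeasure_map hsq.aemeasurable
  refine Measure.ext_of_lintegral _ fun g hg => ?_
  rw [lintegral_map hg (by fun_prop), lintegral_dataLaw hg, lintegral_map _ hsq]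
  swap
  · have h1 : Measurable fun z : ℝ × ℝ => ENNReal.ofReal (fMix p gμ z.1 z.2) * g z :=
      measurable_fMix.ennreal_ofReal.mul hg
    exact h1.lintegral_prod_right'
  have e1 : ∫⁻ ω, g (σ i ω, X i ω) ∂P =
      ∫⁻ q : (ℝ × ℝ) × ℝ, g (√q.1.2, q.2) ∂P.map (fun ω => ((μ i ω, σ i ω ^ 2), X i ω)) := by
    rw [lintegral_map (by fun_prop) (by fun_prop)]
    refine lintegral_congr_ae ?_
    filter_upwards [h.σ_pos i] with ω hω
    rw [Real.sqrt_sq hω.le]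
  rw [e1, ← compProd_map_condDistrib hmX.aemeasurable, Measure.lintegral_compProd (by fun_prop)]
  have e2 : ∀ᵐ q ∂P.map (fun ω => (μ i ω, σ i ω ^ 2)),
      ∫⁻ x, g (√q.2, x) ∂condDistrib (X i) (fun ω => (μ i ω, σ i ω ^ 2)) P q =
      ∫⁻ x, g (√q.2, x) ∂gaussianReal q.1 q.2.toNNReal := by
    filter_upwards [h.normal i] with q hq
    rw [hq]
  have e3 : Measurable fun q : ℝ × ℝ =>
      ∫⁻ x, g (√q.2, x) ∂condDistrib (X i) (fun ω => (μ i ω, σ i ω ^ 2)) P q := by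
    exact Measurable.lintegral_kernel_prod_right' (f := fun z : (ℝ × ℝ) × ℝ => g (√z.1.2, z.2))
      (by fun_prop)
  have e4 : AEMeasurable (fun q : ℝ × ℝ => ∫⁻ x, g (√q.2, x) ∂gaussianReal q.1 q.2.toNNReal)
      ((meanPrior p gμ).prod gσ) := by
    rw [← h.prior i]
    exact e3.aemeasurable.congr e2
  rw [lintegral_congr_ae e2, h.prior i, lintegral_prod_symm _ e4]
  refine lintegral_congr_ae ?_
  filter_upwards [hpos] with v hv
  exact lintegral_prior_gaussian h.p_pos.le h.p_le_one hv (g := fun x => g (√v, x)) (by fun_prop)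

lemma Model.iidData {Ω : Type*} [MeasurableSpace Ω] {P : Measure Ω}
    [IsProbabilityMeasure P] {p : ℝ} {gμ gσ : Measure ℝ} [IsProbabilityMeasure gμ]
    [IsProbabilityMeasure gσ] {μ σ X : ℕ → Ω → ℝ} (h : Model P p gμ gσ μ σ X)
    {lo hi M : ℝ} (hlo : 0 < lo) (hle : lo ≤ hi) (hM : 0 ≤ M) (hgμ : ∀ᵐ u ∂gμ, |u| ≤ M)
    (hgσ : ∀ᵐ v ∂gσ, v ∈ Set.Icc (lo ^ 2) (hi ^ 2)) :
    IIDData P p gμ (gσ.map Real.sqrt) lo hi M σ X where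
  p_pos := h.p_pos
  p_le_one := h.p_le_one
  lo_pos := hlo
  lo_le_hi := hle
  M_nonneg := hM
  gμ_ae := hgμ
  ρ_ae := by
    refine (ae_map_iff Real.continuous_sqrt.measurable.aemeasurable measurableSet_Icc).2 ?_
    filter_upwards [hgσ] with v hv
    exact ⟨Real.le_sqrt_of_sq_le hv.1, Real.sqrt_le_iff.2 ⟨hlo.le.trans hle, hv.2⟩⟩
  measurable_σ := h.measurable_σ
  measurable_X := h.measurable_X
  indep := h.indep.comp (fun _ q => (q.2.1, q.2.2)) (fun _ => by fun_prop)
  law := h.law_eq_dataLaw (hgσ.mono fun v hv => (by positivity : 0 < lo ^ 2).trans_le hv.1)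

section law

variable {Ω : Type*} [MeasurableSpace Ω] {P : Measure Ω} {p : ℝ} {gμ ρ : Measure ℝ}
  [IsProbabilityMeasure gμ] [IsProbabilityMeasure ρ] {lo hi M : ℝ} {σ X : ℕ → Ω → ℝ}

lemma IIDData.hi_pos (D : IIDData P p gμ ρ lo hi M σ X) : 0 < hi := D.lo_pos.trans_le D.lo_le_hi

lemma IIDData.fMix_eq (D : IIDData P p gμ ρ lo hi M σ X) {s : ℝ} (hs : lo ≤ s) (x : ℝ) :
    fMix p gμ s x = f1 (meanPrior p gμ) s x :=
  fMix_eq_f1 D.p_pos.le D.p_le_one (D.lo_pos.trans_le hs) x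

lemma IIDData.isProb (D : IIDData P p gμ ρ lo hi M σ X) :
    IsProbabilityMeasure (meanPrior p gμ) :=
  isProbabilityMeasure_meanPrior D.p_pos.le D.p_le_one gμ

lemma IIDData.measurable_data (D : IIDData P p gμ ρ lo hi M σ X) (i : ℕ) :
    Measurable fun ω => (σ i ω, X i ω) := (D.measurable_σ i).prodMk (D.measurable_X i)

lemma IIDData.isProbabilityMeasure_dataLaw [IsProbabilityMeasure P]
    (D : IIDData P p gμ ρ lo hi M σ X) : IsProbabilityMeasure (dataLaw p gμ ρ) := by
  rw [← D.law 0]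
  exact Measure.isProbabilityMeasure_map (D.measurable_data 0).aemeasurable

lemma IIDData.ae_dataLaw (D : IIDData P p gμ ρ lo hi M σ X) :
    ∀ᵐ z ∂dataLaw p gμ ρ, z.1 ∈ Set.Icc lo hi := by
  refine (withDensity_absolutelyContinuous _ _).ae_le ?_
  exact Measure.quasiMeasurePreserving_fst.ae D.ρ_ae

lemma IIDData.ae_mem (D : IIDData P p gμ ρ lo hi M σ X) (i : ℕ) :
    ∀ᵐ ω ∂P, σ i ω ∈ Set.Icc lo hi := by
  have := D.ae_dataLaw
  rw [← D.law i] at this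
  exact ae_of_ae_map (D.measurable_data i).aemeasurable this

lemma IIDData.ae_all_mem (D : IIDData P p gμ ρ lo hi M σ X) :
    ∀ᵐ ω ∂P, ∀ i, σ i ω ∈ Set.Icc lo hi := ae_all_iff.2 D.ae_mem

lemma IIDData.fMix_nonneg (D : IIDData P p gμ ρ lo hi M σ X) {s : ℝ} (hs : lo ≤ s) (x : ℝ) :
    0 ≤ fMix p gμ s x := by
  rw [D.fMix_eq hs]; exact f1_nonneg (D.lo_pos.le.trans hs) _ _

lemma IIDData.integral_dataLaw (D : IIDData P p gμ ρ lo hi M σ X) [IsProbabilityMeasure P]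
    {g : ℝ × ℝ → ℝ} (hg : Integrable g (dataLaw p gμ ρ)) :
    ∫ z, g z ∂dataLaw p gμ ρ = ∫ s, ∫ x, fMix p gμ s x * g (s, x) ∂volume ∂ρ := by
  have hf : Measurable fun z : ℝ × ℝ => ENNReal.ofReal (fMix p gμ z.1 z.2) :=
    measurable_fMix.ennreal_ofReal
  have hae : ∀ᵐ z : ℝ × ℝ ∂ρ.prod volume, z.1 ∈ Set.Icc lo hi :=
    Measure.quasiMeasurePreserving_fst.ae D.ρ_ae
  have e : (fun z : ℝ × ℝ => (ENNReal.ofReal (fMix p gμ z.1 z.2)).toReal • g z) =ᵐ[ρ.prod volume]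
      fun z => fMix p gμ z.1 z.2 * g z := by
    filter_upwards [hae] with z hz
    rw [ENNReal.toReal_ofReal (D.fMix_nonneg hz.1 _), smul_eq_mul]
  have hi := (integrable_withDensity_iff_integrable_smul' hf
    (ae_of_all _ fun z => ENNReal.ofReal_lt_top)).1 hg
  rw [dataLaw, integral_withDensity_eq_integral_toReal_smul hf
    (ae_of_all _ fun z => ENNReal.ofReal_lt_top), integral_congr_ae e,
    integral_prod _ (hi.congr e)]

end law

/-! ### Concentration of averages -/

section concentration

variable {Ω : Type*} [MeasurableSpace Ω] {P : Measure Ω} [IsProbabilityMeasure P]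

lemma mgf_le_exp_of_abs_le {W : Ω → ℝ} (hW : Measurable W) {B V l : ℝ}
    (hB : ∀ᵐ ω ∂P, |W ω| ≤ B) (h0 : ∫ ω, W ω ∂P = 0) (hV : ∫ ω, W ω ^ 2 ∂P ≤ V)
    (hl : |l| * B ≤ 1) : Integrable (fun ω => Real.exp (l * W ω)) P ∧
      mgf W P l ≤ Real.exp (l ^ 2 * V) := by
  have hlW : ∀ᵐ ω ∂P, |l * W ω| ≤ 1 := by
    filter_upwards [hB] with ω hω
    rw [abs_mul]
    exact (mul_le_mul_of_nonneg_left hω (abs_nonneg l)).trans hl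
  have h_int : Integrable (fun ω => Real.exp (l * W ω)) P := by
    refine Integrable.of_bound (C := Real.exp 1) (by fun_prop) ?_
    filter_upwards [hlW] with ω hω
    rw [Real.norm_eq_abs, Real.abs_exp]
    exact Real.exp_le_exp.2 (le_of_abs_le hω)
  have hWi : Integrable W P := Integrable.of_bound (C := B) (by fun_prop) hB
  have hW2 : Integrable (fun ω => W ω ^ 2) P := by
    refine Integrable.of_bound (C := B ^ 2) (by fun_prop) ?_
    filter_upwards [hB] with ω hω
    rw [Real.norm_eq_abs, abs_pow]
    gcongr
  refine ⟨h_int, ?_⟩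
  have hle : mgf W P l ≤ ∫ ω, (1 + l * W ω + l ^ 2 * W ω ^ 2) ∂P := by
    refine integral_mono_ae h_int (((integrable_const _).add (hWi.const_mul l)).add
      (hW2.const_mul _)) ?_
    filter_upwards [hlW] with ω hω
    have := le_of_abs_le (Real.abs_exp_sub_one_sub_id_le hω)
    rw [mul_pow] at this
    linarith
  have he : ∫ ω, (1 + l * W ω + l ^ 2 * W ω ^ 2) ∂P = 1 + l ^ 2 * ∫ ω, W ω ^ 2 ∂P := by
    have h1 : Integrable (fun ω => 1 + l * W ω) P := (integrable_const _).add (hWi.const_mul l)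
    rw [integral_add h1 (hW2.const_mul _),
      integral_add (integrable_const _) (hWi.const_mul l), integral_const_mul, integral_const_mul,
      h0]
    simp
  have h1 : l ^ 2 * ∫ ω, W ω ^ 2 ∂P ≤ l ^ 2 * V := by gcongr
  have h2 := Real.add_one_le_exp (l ^ 2 * V)
  linarith

lemma measure_sum_ge_le {W : ℕ → Ω → ℝ} (hW : ∀ k, Measurable (W k)) (hind : iIndepFun W P)
    {B V l t : ℝ} (hB : ∀ k, ∀ᵐ ω ∂P, |W k ω| ≤ B) (h0 : ∀ k, ∫ ω, W k ω ∂P = 0)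
    (hV : ∀ k, ∫ ω, W k ω ^ 2 ∂P ≤ V) (hl0 : 0 ≤ l) (hl : l * B ≤ 1) (S : Finset ℕ) :
    P.real {ω | t ≤ ∑ k ∈ S, W k ω} ≤ Real.exp (-l * t + S.card * (l ^ 2 * V)) := by
  have hk : ∀ k, _ := fun k => mgf_le_exp_of_abs_le (hW k) (hB k) (h0 k) (hV k)
    (by rwa [abs_of_nonneg hl0])
  have h1 := measure_ge_le_exp_mul_mgf (μ := P) (X := ∑ k ∈ S, W k) t hl0
    (hind.integrable_exp_mul_sum hW (fun k _ => (hk k).1))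
  rw [hind.mgf_sum hW] at h1
  simp only [Finset.sum_apply] at h1
  refine h1.trans ?_
  rw [Real.exp_add]
  gcongr
  calc ∏ k ∈ S, mgf (W k) P l ≤ ∏ k ∈ S, Real.exp (l ^ 2 * V) :=
        Finset.prod_le_prod (fun k _ => mgf_nonneg) (fun k _ => (hk k).2)
    _ = _ := by rw [Finset.prod_const, ← Real.exp_nat_mul]

lemma measure_abs_sum_ge_le {W : ℕ → Ω → ℝ} (hW : ∀ k, Measurable (W k)) (hind : iIndepFun W P)
    {B V l t : ℝ} (hB : ∀ k, ∀ᵐ ω ∂P, |W k ω| ≤ B) (h0 : ∀ k, ∫ ω, W k ω ∂P = 0)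
    (hV : ∀ k, ∫ ω, W k ω ^ 2 ∂P ≤ V) (hl0 : 0 ≤ l) (hl : l * B ≤ 1) (S : Finset ℕ) :
    P.real {ω | t ≤ |∑ k ∈ S, W k ω|} ≤ 2 * Real.exp (-l * t + S.card * (l ^ 2 * V)) := by
  have h1 := measure_sum_ge_le (t := t) hW hind hB h0 hV hl0 hl S
  have h2 := measure_sum_ge_le (t := t) (W := fun k ω => -W k ω) (V := V)
    (fun k => (hW k).neg) (hind.comp (fun _ x => -x) (fun _ => measurable_neg)) (by simpa using hB)
    (fun k => by rw [integral_neg, h0 k, neg_zero]) (by simpa using hV) hl0 hl S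
  have h3 : {ω | t ≤ |∑ k ∈ S, W k ω|} ⊆
      {ω | t ≤ ∑ k ∈ S, W k ω} ∪ {ω | t ≤ ∑ k ∈ S, -W k ω} := by
    intro ω hω
    simp only [Set.mem_union, Set.mem_ofPred_eq, Finset.sum_neg_distrib] at hω ⊢
    exact le_abs.1 hω
  have := (measureReal_mono (μ := P) h3).trans (measureReal_union_le _ _)
  linarith

variable {E : Type*} [MeasurableSpace E] {Q : Measure E} {Z : ℕ → Ω → E}

/-- The rate in the exponential deviation bounds. -/
noncomputable def devRate (ε V : ℝ) : ℝ := min 1 (ε / (4 * V)) * ε / 4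

lemma devRate_pos {ε V : ℝ} (hε : 0 < ε) (hV : 0 < V) : 0 < devRate ε V := by
  unfold devRate; positivity

lemma measure_abs_sum_sub_integral_ge_le [IsProbabilityMeasure Q] (hZ : ∀ k, Measurable (Z k))
    (hind : iIndepFun Z P) (hlaw : ∀ k, P.map (Z k) = Q) {g : E → ℝ} (hg : Measurable g)
    {B V ε : ℝ} (hB : 0 < B) (hV : 0 < V) (hε : 0 < ε) (hgB : ∀ᵐ b ∂Q, 0 ≤ g b ∧ g b ≤ B)
    (hgV : ∫ b, g b ∂Q ≤ V) {m : ℕ} {S : Finset ℕ} (hS : S.card ≤ m) :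
    P.real {ω | m * (ε / 2) ≤ |∑ k ∈ S, (g (Z k ω) - ∫ b, g b ∂Q)|} ≤
      2 * Real.exp (-(devRate ε V * (m / B))) := by
  have hgi : Integrable g Q := by
    refine Integrable.of_bound (C := B) hg.aestronglyMeasurable ?_
    filter_upwards [hgB] with b hb
    rw [Real.norm_eq_abs, abs_of_nonneg hb.1]; exact hb.2
  have hg2 : Integrable (fun b => g b ^ 2) Q := by
    refine Integrable.of_bound (C := B ^ 2) (hg.pow_const 2).aestronglyMeasurable ?_
    filter_upwards [hgB] with b hb
    rw [Real.norm_eq_abs, abs_pow, abs_of_nonneg hb.1]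
    have := hb.1
    have := hb.2
    gcongr
  set ν := ∫ b, g b ∂Q with hν
  have hν0 : 0 ≤ ν := integral_nonneg_of_ae (hgB.mono fun b hb => hb.1)
  have hνB : ν ≤ B := by
    have := integral_mono_ae hgi (integrable_const B) (hgB.mono fun b hb => hb.2)
    simpa using this
  have hV2 : ∫ b, (g b - ν) ^ 2 ∂Q ≤ B * V := by
    have e : ∫ b, (g b - ν) ^ 2 ∂Q = ∫ b, g b ^ 2 ∂Q - ν ^ 2 := by
      have : ∀ b, (g b - ν) ^ 2 = g b ^ 2 - 2 * ν * g b + ν ^ 2 := fun b => by ring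
      simp_rw [this]
      have h1 : Integrable (fun b => g b ^ 2 - 2 * ν * g b) Q := hg2.sub (hgi.const_mul _)
      rw [integral_add h1 (integrable_const _),
        integral_sub hg2 (hgi.const_mul _), integral_const_mul, ← hν]
      simp; ring
    have h2 : ∫ b, g b ^ 2 ∂Q ≤ ∫ b, B * g b ∂Q := by
      refine integral_mono_ae hg2 (hgi.const_mul B) ?_
      filter_upwards [hgB] with b hb
      nlinarith [hb.1, hb.2]
    rw [integral_const_mul, ← hν] at h2
    rw [e]
    nlinarith [sq_nonneg ν]
  have tr : ∀ (k : ℕ) {F : E → ℝ}, Measurable F → ∫ ω, F (Z k ω) ∂P = ∫ b, F b ∂Q := by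
    intro k F hF
    rw [← hlaw k, integral_map (hZ k).aemeasurable hF.aestronglyMeasurable]
  set c := min 1 (ε / (4 * V)) with hc
  have hc0 : 0 < c := by positivity
  have hc1 : c ≤ 1 := min_le_left _ _
  have hcV : c * V ≤ ε / 4 := by
    have : c ≤ ε / (4 * V) := min_le_right _ _
    calc c * V ≤ ε / (4 * V) * V := by gcongr
      _ = ε / 4 := by field_simp
  have key := measure_abs_sum_ge_le (P := P) (W := fun k ω => g (Z k ω) - ν) (B := B) (V := B * V)
    (l := c / B) (t := m * (ε / 2)) (fun k => (hg.comp (hZ k)).sub_const ν)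
    (hind.comp (fun _ b => g b - ν) (fun _ => hg.sub_const ν)) ?_ ?_ ?_ (by positivity) ?_ S
  · refine key.trans ?_
    gcongr
    have hm : (S.card : ℝ) ≤ m := by exact_mod_cast hS
    have h1 : (S.card : ℝ) * ((c / B) ^ 2 * (B * V)) ≤ m * ((c / B) ^ 2 * (B * V)) := by gcongr
    have e1 : (m : ℝ) * ((c / B) ^ 2 * (B * V)) = m / B * c * (c * V) := by field_simp
    have h2 : (m : ℝ) / B * c * (c * V) ≤ m / B * c * (ε / 4) := by gcongr
    have e2 : -(c / B) * (m * (ε / 2)) = - (m / B * c * (ε / 2)) := by ring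
    rw [devRate, ← hc]
    nlinarith
  · intro k
    have := hgB
    rw [← hlaw k] at this
    filter_upwards [ae_of_ae_map (hZ k).aemeasurable this] with ω hω
    rw [abs_le]; constructor <;> linarith [hω.1, hω.2]
  · intro k
    rw [tr k (F := fun b => g b - ν) (hg.sub_const ν), integral_sub hgi (integrable_const _)]
    simp [hν]
  · intro k
    rw [tr k (F := fun b => (g b - ν) ^ 2) ((hg.sub_const ν).pow_const 2)]
    exact hV2
  · rw [div_mul_cancel₀ _ hB.ne']; exact hc1

/-- Deviation of an average of `ψ a (Z k)` from its mean, at a fixed point `a`. -/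
lemma measure_avg_dev_fixed_le [IsProbabilityMeasure Q] (hZ : ∀ k, Measurable (Z k))
    (hind : iIndepFun Z P) (hlaw : ∀ k, P.map (Z k) = Q) {g : E → ℝ} (hg : Measurable g)
    {B V ε : ℝ} (hB : 0 < B) (hV : 0 < V) (hε : 0 < ε) (hgB : ∀ᵐ b ∂Q, 0 ≤ g b ∧ g b ≤ B)
    (hgV : ∫ b, g b ∂Q ≤ V) {m : ℕ} (hm : 0 < m) :
    P {ω | ε ≤ |(m : ℝ)⁻¹ * ∑ k ∈ Finset.range m, g (Z k ω) - ∫ b, g b ∂Q|} ≤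
      ENNReal.ofReal (2 * Real.exp (-(devRate ε V * (m / B)))) := by
  have hm' : (0 : ℝ) < m := by exact_mod_cast hm
  have h := measure_abs_sum_sub_integral_ge_le hZ hind hlaw hg hB hV hε hgB hgV
    (S := Finset.range m) (m := m) (by simp)
  rw [← ofReal_measureReal]
  refine ENNReal.ofReal_le_ofReal (le_trans (measureReal_mono ?_) h)
  intro ω hω
  simp only [Set.mem_ofPred_eq] at hω ⊢
  have e : ∑ k ∈ Finset.range m, (g (Z k ω) - ∫ b, g b ∂Q) =
      m * ((m : ℝ)⁻¹ * ∑ k ∈ Finset.range m, g (Z k ω) - ∫ b, g b ∂Q) := by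
    rw [Finset.sum_sub_distrib]
    simp
    field_simp
  rw [e, abs_mul, abs_of_pos hm']
  gcongr
  linarith

/-- Deviation of an average of `ψ (Z i) (Z k)` over `k` from its conditional mean. -/
lemma measure_avg_dev_le [IsProbabilityMeasure Q] (hZ : ∀ k, Measurable (Z k))
    (hind : iIndepFun Z P) (hlaw : ∀ k, P.map (Z k) = Q) {ψ : E → E → ℝ}
    (hψ : Measurable (Function.uncurry ψ))
    {B V ε : ℝ} (hB : 0 < B) (hV : 0 < V) (hε : 0 < ε)
    (hψB : ∀ᵐ b ∂Q, ∀ a, 0 ≤ ψ a b ∧ ψ a b ≤ B)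
    (hψV : ∀ a, ∫ b, ψ a b ∂Q ≤ V) {m : ℕ} (hBm : (B + V) / m ≤ ε / 2) {i : ℕ} (hi : i < m) :
    P {ω | ε ≤ |(m : ℝ)⁻¹ * ∑ k ∈ Finset.range m, ψ (Z i ω) (Z k ω) - ∫ b, ψ (Z i ω) b ∂Q|} ≤
      ENNReal.ofReal (2 * Real.exp (-(devRate ε V * (m / B)))) := by
  have hm' : (0 : ℝ) < m := by exact_mod_cast (Nat.zero_le i).trans_lt hi
  set S := (Finset.range m).erase i with hS
  set bd := ENNReal.ofReal (2 * Real.exp (-(devRate ε V * (m / B)))) with hbd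
  set mean : E → ℝ := fun a => ∫ b, ψ a b ∂Q with hmean
  have hmm : Measurable mean :=
    (hψ.stronglyMeasurable.integral_prod_right (ν := Q)).measurable
  have hmean0 : ∀ a, 0 ≤ mean a := fun a => integral_nonneg_of_ae (hψB.mono fun b hb => (hb a).1)
  -- the other observations
  let Y : Ω → (S → E) := fun ω k => Z k ω
  have hY : Measurable Y := measurable_pi_lambda _ fun k => hZ k
  have hindY : IndepFun (Z i) Y P := by
    have := hind.indepFun_finset {i} S (by simp [hS]) hZ
    exact this.comp (φ := fun f : ({i} : Finset ℕ) → E => f ⟨i, by simp⟩) (ψ := id)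
      (measurable_pi_apply _) measurable_id
  let A : Set (E × (S → E)) := {q | m * (ε / 2) ≤ |∑ k : S, (ψ q.1 (q.2 k) - mean q.1)|}
  have hA : MeasurableSet A := by
    refine measurableSet_le measurable_const (Measurable.abs ?_)
    refine Finset.measurable_sum _ fun k _ => Measurable.sub ?_ (hmm.comp measurable_fst)
    exact hψ.comp (measurable_fst.prodMk ((measurable_pi_apply k).comp measurable_snd))
  have hPA : P ((fun ω => (Z i ω, Y ω)) ⁻¹' A) ≤ bd := by
    rw [← Measure.map_apply ((hZ i).prodMk hY) hA,
      (indepFun_iff_map_prod_eq_prod_map_map (hZ i).aemeasurable hY.aemeasurable).1 hindY,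
      Measure.prod_apply hA]
    have hpr : IsProbabilityMeasure (P.map (Z i)) :=
      Measure.isProbabilityMeasure_map (hZ i).aemeasurable
    calc ∫⁻ a, (P.map Y) (Prod.mk a ⁻¹' A) ∂(P.map (Z i)) ≤ ∫⁻ a, bd ∂(P.map (Z i)) := by
          refine lintegral_mono fun a => ?_
          rw [Measure.map_apply hY (measurable_prodMk_left hA)]
          have := measure_abs_sum_sub_integral_ge_le hZ hind hlaw
            (g := ψ a) (hψ.comp measurable_prodMk_left) hB hV hε (hψB.mono fun b hb => hb a)
            (hψV a) (S := S) (m := m) (by simp [hS, Finset.card_erase_le.trans])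
          rw [← ofReal_measureReal, hbd]
          refine ENNReal.ofReal_le_ofReal (le_trans (measureReal_mono ?_) this)
          intro ω hω
          simp only [Set.mem_preimage, Set.mem_ofPred_eq, A, Y, hmean] at hω ⊢
          rwa [← Finset.sum_coe_sort S]
      _ = bd := by simp
  refine le_trans (measure_mono_ae ?_) hPA
  have h1 := hψB
  rw [← hlaw i] at h1
  filter_upwards [ae_of_ae_map (hZ i).aemeasurable h1] with ω hω hω'
  replace hω := hω (Z i ω)
  replace hω' : ε ≤ |(m : ℝ)⁻¹ * ∑ k ∈ Finset.range m, ψ (Z i ω) (Z k ω) - mean (Z i ω)| := hω'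
  show m * (ε / 2) ≤ |∑ k : S, (ψ (Z i ω) (Z k ω) - mean (Z i ω))|
  rw [Finset.sum_coe_sort S (fun k => ψ (Z i ω) (Z k ω) - mean (Z i ω))]
  have hcard : (S.card : ℝ) = m - 1 := by
    rw [hS, Finset.card_erase_of_mem (Finset.mem_range.2 hi), Finset.card_range,
      Nat.cast_sub (by omega)]
    simp
  have hsum : ∑ k ∈ Finset.range m, ψ (Z i ω) (Z k ω) =
      ψ (Z i ω) (Z i ω) + ∑ k ∈ S, ψ (Z i ω) (Z k ω) :=
    (Finset.add_sum_erase _ _ (Finset.mem_range.2 hi)).symm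
  have e : m * ((m : ℝ)⁻¹ * ∑ k ∈ Finset.range m, ψ (Z i ω) (Z k ω) - mean (Z i ω)) =
      ∑ k ∈ S, (ψ (Z i ω) (Z k ω) - mean (Z i ω)) + (ψ (Z i ω) (Z i ω) - mean (Z i ω)) := by
    rw [Finset.sum_sub_distrib, Finset.sum_const, nsmul_eq_mul, hcard, hsum]
    field_simp
    ring
  have h2 : m * ε ≤ |∑ k ∈ S, (ψ (Z i ω) (Z k ω) - mean (Z i ω)) +
      (ψ (Z i ω) (Z i ω) - mean (Z i ω))| := by
    rw [← e, abs_mul, abs_of_pos hm']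
    gcongr
  have h3 : |ψ (Z i ω) (Z i ω) - mean (Z i ω)| ≤ B + V := by
    have a1 := hmean0 (Z i ω)
    have a2 : mean (Z i ω) ≤ V := hψV _
    rw [abs_le]; constructor <;> linarith [hω.1, hω.2]
  have h4 := abs_add_le (∑ k ∈ S, (ψ (Z i ω) (Z k ω) - mean (Z i ω)))
    (ψ (Z i ω) (Z i ω) - mean (Z i ω))
  have h5 : B + V ≤ m * (ε / 2) := by
    rwa [div_le_iff₀ hm', mul_comm] at hBm
  linarith

end concentration

/-! ### The smoothed law of the scale parameter -/

/-- The density at `s` of the law `ρ` of the scale parameter smoothed by the kernel `φ_h`. -/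
noncomputable def kap (ρ : Measure ℝ) (h s : ℝ) : ℝ := f1 ρ h s

section kap

variable {ρ : Measure ℝ} [IsProbabilityMeasure ρ] {h θ : ℝ}

lemma measurable_kap (ρ : Measure ℝ) [SFinite ρ] (h : ℝ) : Measurable (kap ρ h) :=
  (measurable_f1 ρ).comp measurable_prodMk_left

lemma measurableSet_kap_lt (ρ : Measure ℝ) [SFinite ρ] (h θ : ℝ) :
    MeasurableSet {s | kap ρ h s < θ} := measurableSet_lt (measurable_kap ρ h) measurable_const

/-- The constant in the bounds for the mass of the points where `kap` is small. -/
noncomputable def massC : ℝ := √(2 * Real.pi) * Real.exp (1 / 2)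

lemma massC_pos : 0 < massC := by unfold massC; positivity

lemma phi_self (hh : 0 < h) : phi h h = (massC * h)⁻¹ := by
  unfold phi massC
  have : -h ^ 2 / (2 * h ^ 2) = -(1 / 2) := by field_simp
  rw [this, Real.exp_neg]
  field_simp

lemma measure_kap_lt_inter_le (hh : 0 < h) (y : ℝ) :
    ρ {s | kap ρ h s < θ ∧ |y - s| ≤ h / 2} ≤ ENNReal.ofReal (massC * h * θ) := by
  set A := {s | kap ρ h s < θ ∧ |y - s| ≤ h / 2} with hA
  rcases A.eq_empty_or_nonempty with hE | ⟨t, ht⟩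
  · simp [hE]
  · have h1 : A ⊆ {s | phi h h ≤ phi h (t - s)} := by
      intro s hs
      refine phi_anti hh.le ?_
      have a1 := hs.2
      have a2 := ht.2
      rw [abs_of_pos hh]
      have : t - s = (y - s) - (y - t) := by ring
      rw [this]
      exact (abs_sub _ _).trans (by linarith)
    have h2 := mul_meas_ge_le_integral_of_nonneg (μ := ρ)
      (ae_of_all _ fun s => phi_nonneg hh.le (t - s)) (integrable_phi_measure hh t ρ) (phi h h)
    have h3 : ρ.real A ≤ massC * h * θ := by
      have h4 := measureReal_mono (μ := ρ) h1
      rw [phi_self hh] at h2 h4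
      have h5 : ∫ s, phi h (t - s) ∂ρ < θ := ht.1
      have h6 : 0 < massC * h := mul_pos massC_pos hh
      have h7 : (massC * h)⁻¹ * ρ.real A ≤ θ := by
        have : (massC * h)⁻¹ * ρ.real A ≤
            (massC * h)⁻¹ * ρ.real {s | (massC * h)⁻¹ ≤ phi h (t - s)} := by gcongr
        linarith
      rwa [inv_mul_le_iff₀ h6] at h7
    rw [← ofReal_measureReal]
    exact ENNReal.ofReal_le_ofReal h3

lemma setLIntegral_kap_lt_le (hh : 0 < h) {g G : ℝ → ENNReal} (hg : Measurable g)
    (hG : Measurable G) (hgG : ∀ s y, |y - s| ≤ h / 2 → g s ≤ G y) :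
    ∫⁻ s in {s | kap ρ h s < θ}, g s ∂ρ ≤ ENNReal.ofReal (massC * θ) * ∫⁻ y, G y := by
  set A := {s | kap ρ h s < θ} with hA
  have hAm : MeasurableSet A := measurableSet_kap_lt ρ h θ
  have hh0 : ENNReal.ofReal h ≠ 0 := by simpa using hh
  have key : ENNReal.ofReal h * ∫⁻ s in A, g s ∂ρ ≤
      ENNReal.ofReal (massC * h * θ) * ∫⁻ y, G y := by
    have hB : MeasurableSet {q : ℝ × ℝ | |q.2 - q.1| ≤ h / 2} :=
      measurableSet_le (by fun_prop) measurable_const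
    calc ENNReal.ofReal h * ∫⁻ s in A, g s ∂ρ
        = ∫⁻ s in A, ENNReal.ofReal h * g s ∂ρ := (lintegral_const_mul _ hg).symm
      _ ≤ ∫⁻ s in A, ∫⁻ y, {q : ℝ × ℝ | |q.2 - q.1| ≤ h / 2}.indicator (fun q => G q.2) (s, y)
            ∂volume ∂ρ := by
          refine lintegral_mono fun s => ?_
          have hv : volume (Metric.closedBall s (h / 2)) = ENNReal.ofReal h := by
            rw [Real.volume_closedBall]; congr 1; ring
          calc ENNReal.ofReal h * g s = ∫⁻ y in Metric.closedBall s (h / 2), g s := by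
                rw [setLIntegral_const, hv, mul_comm]
            _ = ∫⁻ y, (Metric.closedBall s (h / 2)).indicator (fun _ => g s) y :=
                (lintegral_indicator Metric.isClosed_closedBall.measurableSet _).symm
            _ ≤ _ := by
                refine lintegral_mono fun y => ?_
                by_cases hy : |y - s| ≤ h / 2
                · rw [Set.indicator_of_mem (by simpa [Real.dist_eq] using hy),
                    Set.indicator_of_mem (by exact hy)]
                  exact hgG s y hy
                · rw [Set.indicator_of_notMem (by simpa [Real.dist_eq] using hy)]
                  exact zero_le
      _ = ∫⁻ y, ∫⁻ s in A, {q : ℝ × ℝ | |q.2 - q.1| ≤ h / 2}.indicator (fun q => G q.2) (s, y)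
            ∂ρ ∂volume :=
          lintegral_lintegral_swap
            (((hG.comp measurable_snd).indicator hB).aemeasurable)
      _ ≤ ∫⁻ y, ENNReal.ofReal (massC * h * θ) * G y := by
          refine lintegral_mono fun y => ?_
          have hBy : MeasurableSet {s : ℝ | |y - s| ≤ h / 2} :=
            measurableSet_le (by fun_prop) measurable_const
          have : ∀ s, {q : ℝ × ℝ | |q.2 - q.1| ≤ h / 2}.indicator (fun q => G q.2) (s, y) =
              {s : ℝ | |y - s| ≤ h / 2}.indicator (fun _ => G y) s := fun s => rfl
          simp_rw [this]
          rw [lintegral_indicator hBy, setLIntegral_const, Measure.restrict_apply hBy, mul_comm]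
          gcongr
          refine (measure_mono ?_).trans (measure_kap_lt_inter_le (ρ := ρ) hh y)
          exact fun s hs => ⟨hs.2, hs.1⟩
      _ = _ := lintegral_const_mul _ hG
  have e : ENNReal.ofReal (massC * h * θ) = ENNReal.ofReal h * ENNReal.ofReal (massC * θ) := by
    rw [← ENNReal.ofReal_mul hh.le]; congr 1; ring
  rw [e, mul_assoc] at key
  exact (ENNReal.mul_le_mul_iff_right hh0 ENNReal.ofReal_ne_top).1 key

lemma phi_le_wide (hh : 0 < h) {s t y : ℝ} (hy : |y - t| ≤ h / 2) :
    phi h (s - t) ≤ 2 * Real.exp (1 / 4) * phi (2 * h) (s - y) := by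
  unfold phi
  have e : 2 * Real.exp (1 / 4) * ((√(2 * Real.pi) * (2 * h))⁻¹ *
      Real.exp (-(s - y) ^ 2 / (2 * (2 * h) ^ 2))) =
      (√(2 * Real.pi) * h)⁻¹ * Real.exp (1 / 4 + -(s - y) ^ 2 / (2 * (2 * h) ^ 2)) := by
    rw [Real.exp_add]
    have : √(2 * Real.pi) ≠ 0 := by positivity
    field_simp
  rw [e]
  gcongr
  have h1 : (y - t) ^ 2 ≤ (h / 2) ^ 2 := by rw [← sq_abs]; gcongr
  have h2 : (s - y) ^ 2 ≤ 2 * (s - t) ^ 2 + 2 * h ^ 2 := by nlinarith [sq_nonneg (s - t + (y - t))]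
  have h3 : (s - y) ^ 2 / (2 * (2 * h) ^ 2) ≤ (s - t) ^ 2 / (2 * h ^ 2) + 1 / 4 := by
    have : (s - t) ^ 2 / (2 * h ^ 2) + 1 / 4 = (4 * (s - t) ^ 2 + 2 * h ^ 2) / (2 * (2 * h) ^ 2) := by
      field_simp; ring
    rw [this]
    gcongr
    nlinarith [sq_nonneg (s - t), sq_nonneg (s - t + 2 * (y - t))]
  rw [neg_div, neg_div]
  linarith

/-- The mass of the bad scales near a given scale. -/
lemma setIntegral_phi_kap_lt_le (hh : 0 < h) (hθ : 0 ≤ θ) (s : ℝ) :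
    ∫ t in {t | kap ρ h t < θ}, phi h (s - t) ∂ρ ≤ massC * (2 * Real.exp (1 / 4)) * θ := by
  have h2 : 0 < 2 * h := by positivity
  have h1 := setLIntegral_kap_lt_le (ρ := ρ) (θ := θ) hh (g := fun t => ENNReal.ofReal (phi h (s - t)))
    (G := fun y => ENNReal.ofReal (2 * Real.exp (1 / 4)) * ENNReal.ofReal (phi (2 * h) (s - y)))
    (by fun_prop) (by fun_prop) (fun t y hy => by
      rw [← ENNReal.ofReal_mul (by positivity)]
      exact ENNReal.ofReal_le_ofReal (phi_le_wide hh hy))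
  rw [lintegral_const_mul _ (by fun_prop), lintegral_phi_sub' h2, mul_one,
    ← ENNReal.ofReal_mul (mul_nonneg massC_pos.le hθ)] at h1
  rw [integral_eq_lintegral_of_nonneg_ae (ae_of_all _ fun t => phi_nonneg hh.le _)
    (integrable_phi_measure hh s _).aestronglyMeasurable]
  have h0 := massC_pos
  refine ENNReal.toReal_le_of_le_ofReal (by positivity) (h1.trans (le_of_eq ?_))
  congr 1; ring

lemma measure_kap_lt_le {lo hi : ℝ} (hρ : ∀ᵐ s ∂ρ, s ∈ Set.Icc lo hi) (hh : 0 < h)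
    (hh1 : h ≤ 1) (hθ : 0 ≤ θ) :
    ρ {s | kap ρ h s < θ} ≤ ENNReal.ofReal (massC * (hi - lo + 2) * θ) := by
  have h1 := setLIntegral_kap_lt_le (ρ := ρ) (θ := θ) hh (g := (Set.Icc lo hi).indicator 1)
    (G := (Set.Icc (lo - 1) (hi + 1)).indicator 1)
    (measurable_one.indicator measurableSet_Icc) (measurable_one.indicator measurableSet_Icc)
    (fun t y hy => by
      by_cases ht : t ∈ Set.Icc lo hi
      · have := abs_le.1 hy
        have hy' : y ∈ Set.Icc (lo - 1) (hi + 1) := by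
          constructor <;> linarith [ht.1, ht.2, this.1, this.2]
        rw [Set.indicator_of_mem ht, Set.indicator_of_mem hy']
        exact le_rfl
      · rw [Set.indicator_of_notMem ht]; exact zero_le)
  rw [lintegral_indicator_one (μ := volume) measurableSet_Icc, Real.volume_Icc,
    ← ENNReal.ofReal_mul (mul_nonneg massC_pos.le hθ)] at h1
  have h2 : ∫⁻ s in {s | kap ρ h s < θ}, (Set.Icc lo hi).indicator 1 s ∂ρ =
      ρ {s | kap ρ h s < θ} := by
    rw [← setLIntegral_one]
    refine lintegral_congr_ae (ae_restrict_of_ae ?_)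
    filter_upwards [hρ] with s hs
    rw [Set.indicator_of_mem hs]; rfl
  rw [← h2]
  refine h1.trans (le_of_eq ?_)
  congr 1; ring

end kap

/-! ### Means of kernel averages -/

section means

variable {Ω : Type*} [MeasurableSpace Ω] {P : Measure Ω} [IsProbabilityMeasure P] {p : ℝ}
  {gμ ρ : Measure ℝ} [IsProbabilityMeasure gμ] [IsProbabilityMeasure ρ] {lo hi M : ℝ}
  {σ X : ℕ → Ω → ℝ}

lemma IIDData.integrable_inner (D : IIDData P p gμ ρ lo hi M σ X) {g : ℝ × ℝ → ℝ}
    (hg : Integrable g (dataLaw p gμ ρ)) :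
    Integrable (fun s => ∫ x, fMix p gμ s x * g (s, x)) ρ := by
  have hf : Measurable fun z : ℝ × ℝ => ENNReal.ofReal (fMix p gμ z.1 z.2) :=
    measurable_fMix.ennreal_ofReal
  have hae : ∀ᵐ z : ℝ × ℝ ∂ρ.prod volume, z.1 ∈ Set.Icc lo hi :=
    Measure.quasiMeasurePreserving_fst.ae D.ρ_ae
  have e : (fun z : ℝ × ℝ => (ENNReal.ofReal (fMix p gμ z.1 z.2)).toReal • g z) =ᵐ[ρ.prod volume]
      fun z => fMix p gμ z.1 z.2 * g z := by
    filter_upwards [hae] with z hz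
    rw [ENNReal.toReal_ofReal (D.fMix_nonneg hz.1 _), smul_eq_mul]
  have hi := (integrable_withDensity_iff_integrable_smul' hf
    (ae_of_all _ fun z => ENNReal.ofReal_lt_top)).1 hg
  exact (hi.congr e).integral_prod_left

lemma IIDData.integral_dataLaw_le (D : IIDData P p gμ ρ lo hi M σ X) {g : ℝ × ℝ → ℝ}
    (hg : Integrable g (dataLaw p gμ ρ)) {c : ℝ → ℝ} (hc : Integrable c ρ)
    (h : ∀ s ∈ Set.Icc lo hi, ∫ x, fMix p gμ s x * g (s, x) ≤ c s) :
    ∫ z, g z ∂dataLaw p gμ ρ ≤ ∫ s, c s ∂ρ := by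
  rw [D.integral_dataLaw hg]
  exact integral_mono_ae (D.integrable_inner hg) hc (D.ρ_ae.mono h)

lemma IIDData.le_integral_dataLaw (D : IIDData P p gμ ρ lo hi M σ X) {g : ℝ × ℝ → ℝ}
    (hg : Integrable g (dataLaw p gμ ρ)) {c : ℝ → ℝ} (hc : Integrable c ρ)
    (h : ∀ s ∈ Set.Icc lo hi, c s ≤ ∫ x, fMix p gμ s x * g (s, x)) :
    ∫ s, c s ∂ρ ≤ ∫ z, g z ∂dataLaw p gμ ρ := by
  rw [D.integral_dataLaw hg]
  exact integral_mono_ae hc (D.integrable_inner hg) (D.ρ_ae.mono h)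

/-- Summand of the kernel estimator of a density, with weight `β`. -/
noncomputable def kerA (β : ℝ × ℝ → ℝ) (h hx s x : ℝ) (z : ℝ × ℝ) : ℝ :=
  β z * phi h (s - z.1) * phi (hx * z.1) (x - z.2)

/-- Summand of the normalisation of the kernel estimator, with weight `β`. -/
noncomputable def kerS (β : ℝ × ℝ → ℝ) (h s : ℝ) (z : ℝ × ℝ) : ℝ := β z * phi h (s - z.1)

variable {β : ℝ × ℝ → ℝ} {h hx : ℝ}

lemma measurable_kerA (hβ : Measurable β) :
    Measurable fun q : (ℝ × ℝ) × (ℝ × ℝ) => kerA β h hx q.1.1 q.1.2 q.2 := by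
  unfold kerA; fun_prop

lemma measurable_kerS (hβ : Measurable β) :
    Measurable fun q : ℝ × (ℝ × ℝ) => kerS β h q.1 q.2 := by
  unfold kerS; fun_prop

lemma kerS_mem (hβ1 : ∀ z, β z ∈ Set.Icc (0 : ℝ) 1) (hh : 0 < h) (s : ℝ) (z : ℝ × ℝ) :
    0 ≤ kerS β h s z ∧ kerS β h s z ≤ h⁻¹ := by
  unfold kerS
  have h1 := phi_nonneg hh.le (s - z.1)
  have h2 := phi_le hh (s - z.1)
  obtain ⟨h3, h4⟩ := hβ1 z
  refine ⟨by positivity, ?_⟩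
  nlinarith

lemma kerA_mem (hβ1 : ∀ z, β z ∈ Set.Icc (0 : ℝ) 1) (hh : 0 < h) (hhx : 0 < hx) (hlo : 0 < lo)
    (s x : ℝ) {z : ℝ × ℝ} (hz : z.1 ∈ Set.Icc lo hi) :
    0 ≤ kerA β h hx s x z ∧ kerA β h hx s x z ≤ (h * hx * lo)⁻¹ := by
  unfold kerA
  have hz0 : 0 < hx * z.1 := mul_pos hhx (hlo.trans_le hz.1)
  have h1 := kerS_mem hβ1 hh s z
  unfold kerS at h1
  have h2 := phi_nonneg hz0.le (x - z.2)
  have h3 : phi (hx * z.1) (x - z.2) ≤ (hx * lo)⁻¹ :=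
    (phi_le hz0 _).trans (by
      have := hz.1
      gcongr)
  refine ⟨mul_nonneg h1.1 h2, ?_⟩
  have e : (h * hx * lo)⁻¹ = h⁻¹ * (hx * lo)⁻¹ := by rw [mul_assoc, mul_inv]
  rw [e]
  exact mul_le_mul h1.2 h3 h2 (by positivity)

lemma IIDData.integrable_kerS (D : IIDData P p gμ ρ lo hi M σ X) (hβ : Measurable β)
    (hβ1 : ∀ z, β z ∈ Set.Icc (0 : ℝ) 1) (hh : 0 < h) (s : ℝ) :
    Integrable (kerS β h s) (dataLaw p gμ ρ) := by
  have := D.isProbabilityMeasure_dataLaw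
  refine Integrable.of_bound (C := h⁻¹)
    ((measurable_kerS hβ).comp measurable_prodMk_left).aestronglyMeasurable (ae_of_all _ fun z => ?_)
  have := kerS_mem hβ1 hh s z
  rw [Real.norm_eq_abs, abs_of_nonneg this.1]; exact this.2

lemma IIDData.integrable_kerA (D : IIDData P p gμ ρ lo hi M σ X) (hβ : Measurable β)
    (hβ1 : ∀ z, β z ∈ Set.Icc (0 : ℝ) 1) (hh : 0 < h) (hhx : 0 < hx) (s x : ℝ) :
    Integrable (kerA β h hx s x) (dataLaw p gμ ρ) := by
  have := D.isProbabilityMeasure_dataLaw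
  refine Integrable.of_bound (C := (h * hx * lo)⁻¹)
    ((measurable_kerA hβ).comp
      (measurable_prodMk_left (x := (s, x)))).aestronglyMeasurable
    (D.ae_dataLaw.mono fun z hz => ?_)
  have := kerA_mem hβ1 hh hhx D.lo_pos s x hz
  rw [Real.norm_eq_abs, abs_of_nonneg this.1]; exact this.2

lemma IIDData.fMix_le (D : IIDData P p gμ ρ lo hi M σ X) {s : ℝ} (hs : lo ≤ s) (x : ℝ) :
    fMix p gμ s x ≤ lo⁻¹ := by
  have := D.isProb
  rw [D.fMix_eq hs]; exact f1_le_of_le D.lo_pos hs x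

lemma IIDData.fMix_le_env (D : IIDData P p gμ ρ lo hi M σ X) {s : ℝ} (hs : s ∈ Set.Icc lo hi)
    (x : ℝ) : fMix p gμ s x ≤ envC lo hi M * (1 + x ^ 2)⁻¹ := by
  have := D.isProb
  rw [D.fMix_eq hs.1]
  exact f1_le_env D.lo_pos hs (ae_abs_le_meanPrior D.M_nonneg D.gμ_ae) x

lemma IIDData.lowC_le_fMix (D : IIDData P p gμ ρ lo hi M σ X) {s x R : ℝ}
    (hs : s ∈ Set.Icc lo hi) (hx : |x| ≤ R) : lowC lo hi M R ≤ fMix p gμ s x := by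
  have := D.isProb
  rw [D.fMix_eq hs.1]
  exact lowC_le_f1 D.lo_pos hs (ae_abs_le_meanPrior D.M_nonneg D.gμ_ae) hx

lemma IIDData.fMix_pos (D : IIDData P p gμ ρ lo hi M σ X) {s : ℝ} (hs : s ∈ Set.Icc lo hi)
    (x : ℝ) : 0 < fMix p gμ s x :=
  (lowC_pos D.lo_pos D.lo_le_hi M |x|).trans_le (D.lowC_le_fMix hs le_rfl)

lemma IIDData.abs_fMix_sub_le (D : IIDData P p gμ ρ lo hi M σ X) {s t : ℝ} (hs : lo ≤ s)
    (ht : lo ≤ t) (x y : ℝ) :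
    |fMix p gμ s x - fMix p gμ t y| ≤ 3 / lo ^ 2 * (|s - t| + |x - y|) := by
  have := D.isProb
  rw [D.fMix_eq hs, D.fMix_eq ht]
  exact abs_f1_sub_f1_le D.lo_pos hs ht x y

lemma IIDData.integrable_fMix (D : IIDData P p gμ ρ lo hi M σ X) {s : ℝ} (hs : lo ≤ s) :
    Integrable (fMix p gμ s) := by
  have := D.isProb
  have e : fMix p gμ s = f1 (meanPrior p gμ) s := funext fun x => D.fMix_eq hs x
  rw [e]; exact integrable_f1 (D.lo_pos.trans_le hs)

lemma IIDData.integral_fMix (D : IIDData P p gμ ρ lo hi M σ X) {s : ℝ} (hs : lo ≤ s) :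
    ∫ x, fMix p gμ s x = 1 := by
  have := D.isProb
  have e : fMix p gμ s = f1 (meanPrior p gμ) s := funext fun x => D.fMix_eq hs x
  rw [e]; exact integral_f1 (D.lo_pos.trans_le hs)

lemma IIDData.integrable_fMix_mul (D : IIDData P p gμ ρ lo hi M σ X) (hβ : Measurable β)
    (hβ1 : ∀ z, β z ∈ Set.Icc (0 : ℝ) 1) {s : ℝ} (hs : lo ≤ s) :
    Integrable fun x => fMix p gμ s x * β (s, x) := by
  refine (D.integrable_fMix hs).mono' ?_ (ae_of_all _ fun x => ?_)
  · exact (D.integrable_fMix hs).aestronglyMeasurable.mul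
      (hβ.comp measurable_prodMk_left).aestronglyMeasurable
  · have h1 := D.fMix_nonneg hs x
    obtain ⟨h3, h4⟩ := hβ1 (s, x)
    rw [Real.norm_eq_abs, abs_of_nonneg (by positivity)]
    nlinarith

lemma IIDData.integral_kerS_le (D : IIDData P p gμ ρ lo hi M σ X) (hβ : Measurable β)
    (hβ1 : ∀ z, β z ∈ Set.Icc (0 : ℝ) 1) (hh : 0 < h) (s : ℝ) :
    ∫ z, kerS β h s z ∂dataLaw p gμ ρ ≤ kap ρ h s := by
  refine D.integral_dataLaw_le (D.integrable_kerS hβ hβ1 hh s) (integrable_phi_measure hh s ρ)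
    fun t ht => ?_
  have h1 : ∫ x, fMix p gμ t x * kerS β h s (t, x) ≤ ∫ x, fMix p gμ t x * phi h (s - t) := by
    refine integral_mono_of_nonneg (ae_of_all _ fun x =>
      mul_nonneg (D.fMix_nonneg ht.1 x) (kerS_mem hβ1 hh s _).1)
      ((D.integrable_fMix ht.1).mul_const _) (ae_of_all _ fun x => ?_)
    have h1 := D.fMix_nonneg ht.1 x
    have h2 := phi_nonneg hh.le (s - t)
    obtain ⟨h3, h4⟩ := hβ1 (t, x)
    simp only [kerS]
    gcongr
    nlinarith
  rwa [integral_mul_const, D.integral_fMix ht.1, one_mul] at h1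

/-- The mean of the normalisation when the weight has a constant conditional mean `v`. -/
lemma IIDData.integral_kerS_eq (D : IIDData P p gμ ρ lo hi M σ X) (hβ : Measurable β)
    (hβ1 : ∀ z, β z ∈ Set.Icc (0 : ℝ) 1) (hh : 0 < h) (s : ℝ) {v : ℝ}
    (hv : ∀ t ∈ Set.Icc lo hi, ∫ x, fMix p gμ t x * β (t, x) = v) :
    ∫ z, kerS β h s z ∂dataLaw p gμ ρ = kap ρ h s * v := by
  rw [D.integral_dataLaw (D.integrable_kerS hβ hβ1 hh s), kap, f1, ← integral_mul_const]
  refine integral_congr_ae (D.ρ_ae.mono fun t ht => ?_)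
  simp only [kerS]
  simp_rw [← mul_assoc]
  rw [integral_mul_const, hv t ht, mul_comm]

lemma integrable_mul_phi_of_bound {u : ℝ → ℝ} (hu : Measurable u) {C : ℝ} (hC : ∀ x, |u x| ≤ C)
    {w : ℝ} (hw : 0 < w) (x : ℝ) : Integrable fun y => u y * phi w (x - y) :=
  (integrable_phi_sub' hw x).bdd_mul hu.aestronglyMeasurable (ae_of_all _ hC)

lemma integral_phi_mul_abs_le {w : ℝ} (hw : 0 < w) (x : ℝ) :
    Integrable (fun y => phi w (x - y) * |x - y|) ∧ ∫ y, phi w (x - y) * |x - y| ≤ 2 * w := by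
  have h2 : Integrable fun y => 2 * w * phi (2 * w) (x - y) :=
    (integrable_phi_sub' (by positivity) x).const_mul _
  have h1 : Integrable (fun y => phi w (x - y) * |x - y|) := by
    refine h2.mono' (by fun_prop) (ae_of_all _ fun y => ?_)
    rw [Real.norm_eq_abs, abs_of_nonneg (mul_nonneg (phi_nonneg hw.le _) (abs_nonneg _))]
    exact phi_mul_abs_le hw _
  refine ⟨h1, ?_⟩
  have := integral_mono h1 h2 (fun y => phi_mul_abs_le hw (x - y))
  rwa [integral_const_mul, integral_phi_sub' (by positivity), mul_one] at this

lemma abs_integral_mul_phi_sub_le {u : ℝ → ℝ} (hu : Measurable u) {C : ℝ} (hC : ∀ x, |u x| ≤ C)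
    {w : ℝ} (hw : 0 < w) {x a d L : ℝ} (hL : 0 ≤ L) (hud : ∀ y, |u y - a| ≤ L * (d + |x - y|)) :
    |(∫ y, u y * phi w (x - y)) - a| ≤ L * (d + 2 * w) := by
  have i1 := integrable_mul_phi_of_bound hu hC hw x
  have i2 := integrable_phi_sub' hw x
  obtain ⟨i3, h3⟩ := integral_phi_mul_abs_le hw x
  have e : (∫ y, u y * phi w (x - y)) - a = ∫ y, (u y - a) * phi w (x - y) := by
    simp_rw [sub_mul]
    rw [integral_sub i1 (i2.const_mul a), integral_const_mul, integral_phi_sub' hw, mul_one]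
  have e' : (fun y => L * (d * phi w (x - y) + phi w (x - y) * |x - y|)) =
      fun y => L * (d + |x - y|) * phi w (x - y) := by funext y; ring
  have i4 : Integrable fun y => L * (d + |x - y|) * phi w (x - y) := by
    rw [← e']; exact ((i2.const_mul d).add i3).const_mul L
  have h4 : ∫ y, L * (d + |x - y|) * phi w (x - y) ≤ L * (d + 2 * w) := by
    rw [← e', integral_const_mul, integral_add (i2.const_mul d) i3, integral_const_mul,
      integral_phi_sub' hw, mul_one]
    gcongr
  rw [e]
  refine le_trans ?_ h4
  rw [← Real.norm_eq_abs]
  refine norm_integral_le_of_norm_le i4 (ae_of_all _ fun y => ?_)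
  rw [Real.norm_eq_abs, abs_mul, abs_of_nonneg (phi_nonneg hw.le _)]
  exact mul_le_mul_of_nonneg_right (hud y) (phi_nonneg hw.le _)

lemma phi_mul_abs_le_add {h η d K : ℝ} (hh : 0 < h) (hη : 0 ≤ η) (hd : |d| ≤ K) :
    phi h d * |d| ≤ η * phi h d + K * phi h η := by
  have h0 := phi_nonneg hh.le d
  have h1 := phi_nonneg hh.le η
  have hK := (abs_nonneg d).trans hd
  rcases le_total |d| η with h2 | h2
  · have : phi h d * |d| ≤ phi h d * η := by gcongr
    nlinarith [mul_nonneg hK h1]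
  · have h3 : phi h d ≤ phi h η := phi_anti hh.le (by rwa [abs_of_nonneg hη])
    have : phi h d * |d| ≤ phi h η * K := mul_le_mul h3 hd (abs_nonneg _) h1
    nlinarith [mul_nonneg hη h0]

/-- The bias of the kernel estimator of `u = β f`. -/
lemma IIDData.abs_integral_kerA_sub_le (D : IIDData P p gμ ρ lo hi M σ X) (hβ : Measurable β)
    (hβ1 : ∀ z, β z ∈ Set.Icc (0 : ℝ) 1) (hh : 0 < h) (hhx : 0 < hx) {L : ℝ} (hL : 0 ≤ L)
    (hLip : ∀ s ∈ Set.Icc lo hi, ∀ t ∈ Set.Icc lo hi, ∀ x y,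
      |fMix p gμ s x * β (s, x) - fMix p gμ t y * β (t, y)| ≤ L * (|s - t| + |x - y|))
    {s : ℝ} (hs : s ∈ Set.Icc lo hi) (x : ℝ) {η : ℝ} (hη : 0 ≤ η) :
    |∫ z, kerA β h hx s x z ∂dataLaw p gμ ρ - kap ρ h s * (fMix p gμ s x * β (s, x))| ≤
      L * ((η + 2 * hx * hi) * kap ρ h s + (hi - lo) * phi h η) := by
  set a := fMix p gμ s x * β (s, x) with ha
  have hi0 := D.hi_pos
  have h_int := D.integrable_inner (D.integrable_kerA hβ hβ1 hh hhx s x)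
  have iφ := integrable_phi_measure hh s ρ
  have inner : ∀ t ∈ Set.Icc lo hi,
      |(∫ y, fMix p gμ t y * kerA β h hx s x (t, y)) - phi h (s - t) * a| ≤
        L * ((η + 2 * hx * hi) * phi h (s - t) + (hi - lo) * phi h η) := by
    intro t ht
    have ht0 : 0 < t := D.lo_pos.trans_le ht.1
    have e : ∫ y, fMix p gμ t y * kerA β h hx s x (t, y) =
        phi h (s - t) * ∫ y, (fMix p gμ t y * β (t, y)) * phi (hx * t) (x - y) := by
      rw [← integral_const_mul]
      refine integral_congr_ae (ae_of_all _ fun y => ?_)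
      simp only [kerA]; ring
    have h1 := abs_integral_mul_phi_sub_le (u := fun y => fMix p gμ t y * β (t, y)) (C := lo⁻¹)
      (by
        have := measurable_fMix (p := p) (gμ := gμ)
        exact (this.comp measurable_prodMk_left).mul (hβ.comp measurable_prodMk_left))
      (fun y => by
        have a1 := D.fMix_nonneg ht.1 y
        have a2 := D.fMix_le ht.1 y
        obtain ⟨a3, a4⟩ := hβ1 (t, y)
        rw [abs_of_nonneg (by positivity)]
        nlinarith)
      (mul_pos hhx ht0) (x := x) (a := a) (d := |s - t|) hL
      (fun y => by
        rw [abs_sub_comm]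
        exact hLip s hs t ht x y)
    rw [e, ← mul_sub, abs_mul, abs_of_nonneg (phi_nonneg hh.le _)]
    have h0 := phi_nonneg hh.le (s - t)
    have hst : |s - t| ≤ hi - lo := by
      rw [abs_le]; constructor <;> linarith [hs.1, hs.2, ht.1, ht.2]
    have h2 := phi_mul_abs_le_add hh hη hst
    calc phi h (s - t) * |(∫ y, (fMix p gμ t y * β (t, y)) * phi (hx * t) (x - y)) - a|
        ≤ phi h (s - t) * (L * (|s - t| + 2 * (hx * t))) := by gcongr
      _ = L * (phi h (s - t) * |s - t| + 2 * hx * t * phi h (s - t)) := by ring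
      _ ≤ L * ((η * phi h (s - t) + (hi - lo) * phi h η) + 2 * hx * hi * phi h (s - t)) := by
          gcongr
          exact ht.2
      _ = _ := by ring
  have e : ∫ z, kerA β h hx s x z ∂dataLaw p gμ ρ - kap ρ h s * a =
      ∫ t, ((∫ y, fMix p gμ t y * kerA β h hx s x (t, y)) - phi h (s - t) * a) ∂ρ := by
    rw [integral_sub h_int (iφ.mul_const a), integral_mul_const,
      D.integral_dataLaw (D.integrable_kerA hβ hβ1 hh hhx s x)]
    rfl
  have e2 : L * ((η + 2 * hx * hi) * kap ρ h s + (hi - lo) * phi h η) =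
      ∫ t, L * ((η + 2 * hx * hi) * phi h (s - t) + (hi - lo) * phi h η) ∂ρ := by
    rw [integral_const_mul, integral_add (iφ.const_mul _) (integrable_const _),
      integral_const_mul]
    simp [kap, f1]
  rw [e, e2, ← Real.norm_eq_abs]
  refine norm_integral_le_of_norm_le
    (((iφ.const_mul _).add (integrable_const _)).const_mul L) (D.ρ_ae.mono fun t ht => ?_)
  exact inner t ht

/-! #### Rare observations -/

/-- Observations with an isolated scale or a large value. -/
def badSet (ρ : Measure ℝ) (h θ R : ℝ) : Set (ℝ × ℝ) := {z | kap ρ h z.1 < θ ∨ R < |z.2|}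

/-- The indicator of `badSet`. -/
noncomputable def badW (ρ : Measure ℝ) (h θ R : ℝ) : ℝ × ℝ → ℝ := (badSet ρ h θ R).indicator 1

lemma measurable_badW (ρ : Measure ℝ) [SFinite ρ] (h θ R : ℝ) : Measurable (badW ρ h θ R) := by
  refine measurable_one.indicator (MeasurableSet.union ?_ ?_)
  · exact measurableSet_lt ((measurable_kap ρ h).comp measurable_fst) measurable_const
  · exact measurableSet_lt measurable_const measurable_snd.abs

lemma badW_mem (ρ : Measure ℝ) (h θ R : ℝ) (z : ℝ × ℝ) : badW ρ h θ R z ∈ Set.Icc (0 : ℝ) 1 := by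
  unfold badW
  by_cases hz : z ∈ badSet ρ h θ R <;> simp [hz]

lemma badW_le (ρ : Measure ℝ) (h θ R s x : ℝ) : badW ρ h θ R (s, x) ≤
    {t | kap ρ h t < θ}.indicator 1 s + {y : ℝ | R < |y|}.indicator 1 x := by
  unfold badW badSet
  by_cases h1 : kap ρ h s < θ <;> by_cases h2 : R < |x| <;> simp [Set.indicator, h1, h2]

/-- The mass that the envelope of the densities leaves outside `[-R, R]`. -/
noncomputable def tailC (lo hi M R : ℝ) : ℝ :=
  ∫ x in {x : ℝ | R < |x|}, envC lo hi M * (1 + x ^ 2)⁻¹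

lemma measurableSet_lt_abs (R : ℝ) : MeasurableSet {x : ℝ | R < |x|} :=
  measurableSet_lt measurable_const measurable_id.abs

lemma tendsto_tailC (lo hi M : ℝ) : Tendsto (tailC lo hi M) atTop (𝓝 0) := by
  unfold tailC
  simp_rw [← integral_indicator (measurableSet_lt_abs _)]
  have h_int : Integrable fun x : ℝ => ‖envC lo hi M * (1 + x ^ 2)⁻¹‖ :=
    (integrable_inv_one_add_sq.const_mul _).norm
  rw [← integral_zero ℝ ℝ (μ := volume)]
  refine tendsto_integral_filter_of_dominated_convergence _ ?_ ?_ h_int ?_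
  · refine Eventually.of_forall fun R => ?_
    exact (((by fun_prop : Measurable fun x : ℝ => envC lo hi M * (1 + x ^ 2)⁻¹)).indicator
      (measurableSet_lt_abs R)).aestronglyMeasurable
  · exact Eventually.of_forall fun R => ae_of_all _ fun x => norm_indicator_le_norm_self _ _
  · refine ae_of_all _ fun x => tendsto_const_nhds.congr' ?_
    filter_upwards [eventually_ge_atTop |x|] with R hR
    rw [Set.indicator_of_notMem]
    simpa using hR

lemma IIDData.setIntegral_fMix_le_tailC (D : IIDData P p gμ ρ lo hi M σ X) {s : ℝ}
    (hs : s ∈ Set.Icc lo hi) (R : ℝ) : ∫ x in {x : ℝ | R < |x|}, fMix p gμ s x ≤ tailC lo hi M R :=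
  integral_mono (D.integrable_fMix hs.1).integrableOn
    (integrable_inv_one_add_sq.const_mul _).integrableOn (fun x => D.fMix_le_env hs x)

lemma IIDData.integral_kerS_bad_le (D : IIDData P p gμ ρ lo hi M σ X) (hh : 0 < h) {θ : ℝ}
    (hθ : 0 ≤ θ) (R s : ℝ) :
    ∫ z, kerS (badW ρ h θ R) h s z ∂dataLaw p gμ ρ ≤
      massC * (2 * Real.exp (1 / 4)) * θ + tailC lo hi M R * kap ρ h s := by
  have iφ := integrable_phi_measure hh s ρ
  have hm := measurableSet_kap_lt ρ h θ
  refine (D.integral_dataLaw_le (c := fun t => {t | kap ρ h t < θ}.indicator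
    (fun t => phi h (s - t)) t + tailC lo hi M R * phi h (s - t))
    (D.integrable_kerS (measurable_badW ρ h θ R) (badW_mem ρ h θ R) hh s)
    ((iφ.indicator hm).add (iφ.const_mul _)) fun t ht => ?_).trans ?_
  · have hif := D.integrable_fMix ht.1
    have h0 := phi_nonneg hh.le (s - t)
    have e : ∫ x, fMix p gμ t x * kerS (badW ρ h θ R) h s (t, x) =
        (∫ x, fMix p gμ t x * badW ρ h θ R (t, x)) * phi h (s - t) := by
      rw [← integral_mul_const]
      refine integral_congr_ae (ae_of_all _ fun x => ?_)
      simp only [kerS]; ring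
    have h1 : ∫ x, fMix p gμ t x * badW ρ h θ R (t, x) ≤
        ∫ x, (fMix p gμ t x * {t | kap ρ h t < θ}.indicator 1 t +
          {y : ℝ | R < |y|}.indicator (fMix p gμ t) x) := by
      refine integral_mono (D.integrable_fMix_mul (measurable_badW ρ h θ R) (badW_mem ρ h θ R) ht.1)
        ((hif.mul_const _).add (hif.indicator (measurableSet_lt_abs R))) fun x => ?_
      have := mul_le_mul_of_nonneg_left (badW_le ρ h θ R t x) (D.fMix_nonneg ht.1 x)
      refine this.trans (le_of_eq ?_)
      rw [mul_add]
      congr 1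
      by_cases h2 : R < |x| <;> simp [Set.indicator, h2]
    rw [integral_add (hif.mul_const _) (hif.indicator (measurableSet_lt_abs R)),
      integral_mul_const, D.integral_fMix ht.1, one_mul,
      integral_indicator (measurableSet_lt_abs R)] at h1
    have h2 := D.setIntegral_fMix_le_tailC ht R
    rw [e]
    calc _ ≤ ({t | kap ρ h t < θ}.indicator 1 t + tailC lo hi M R) * phi h (s - t) := by
          gcongr; linarith
      _ = _ := by
          rw [add_mul]
          by_cases h2 : kap ρ h t < θ <;> simp [Set.indicator, h2]
  · rw [integral_add (iφ.indicator hm) (iφ.const_mul _), integral_const_mul,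
      integral_indicator hm]
    have := setIntegral_phi_kap_lt_le (ρ := ρ) hh hθ s
    have e : ∫ t, phi h (s - t) ∂ρ = kap ρ h s := rfl
    rw [e]; linarith

lemma IIDData.integral_kerA_bad_le (D : IIDData P p gμ ρ lo hi M σ X) (hh : 0 < h) (hhx : 0 < hx)
    {θ : ℝ} (hθ : 0 ≤ θ) (R s x : ℝ) (hR : 0 ≤ R) :
    ∫ z, kerA (badW ρ h θ R) h hx s x z ∂dataLaw p gμ ρ ≤
      lo⁻¹ * (massC * (2 * Real.exp (1 / 4)) * θ) +
        envC lo hi M * (1 + R ^ 2)⁻¹ * kap ρ h s := by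
  have iφ := integrable_phi_measure hh s ρ
  have hm := measurableSet_kap_lt ρ h θ
  have hlo := D.lo_pos
  have hE := envC_pos D.lo_pos D.lo_le_hi M
  refine (D.integral_dataLaw_le (c := fun t => lo⁻¹ * {t | kap ρ h t < θ}.indicator
    (fun t => phi h (s - t)) t + envC lo hi M * (1 + R ^ 2)⁻¹ * phi h (s - t))
    (D.integrable_kerA (measurable_badW ρ h θ R) (badW_mem ρ h θ R) hh hhx s x)
    (((iφ.indicator hm).const_mul _).add (iφ.const_mul _)) fun t ht => ?_).trans ?_
  · have h0 := phi_nonneg hh.le (s - t)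
    have hw : 0 < hx * t := mul_pos hhx (hlo.trans_le ht.1)
    set K := (lo⁻¹ * {t | kap ρ h t < θ}.indicator 1 t + envC lo hi M * (1 + R ^ 2)⁻¹) *
      phi h (s - t) with hK
    have h1 : ∫ y, fMix p gμ t y * kerA (badW ρ h θ R) h hx s x (t, y) ≤
        ∫ y, K * phi (hx * t) (x - y) := by
      refine integral_mono_of_nonneg (ae_of_all _ fun y =>
        mul_nonneg (D.fMix_nonneg ht.1 y) (kerA_mem (badW_mem ρ h θ R) hh hhx hlo s x ht).1)
        ((integrable_phi_sub' hw x).const_mul _) (ae_of_all _ fun y => ?_)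
      have a0 := D.fMix_nonneg ht.1 y
      have a1 : fMix p gμ t y * badW ρ h θ R (t, y) ≤
          lo⁻¹ * {t | kap ρ h t < θ}.indicator 1 t + envC lo hi M * (1 + R ^ 2)⁻¹ := by
        refine (mul_le_mul_of_nonneg_left (badW_le ρ h θ R t y) a0).trans ?_
        rw [mul_add]
        refine add_le_add ?_ ?_
        · refine mul_le_mul_of_nonneg_right (D.fMix_le ht.1 y) ?_
          exact Set.indicator_nonneg (fun _ _ => zero_le_one) _
        · by_cases h2 : R < |y|
          · have h3 : R ^ 2 ≤ y ^ 2 := by rw [← sq_abs y]; gcongr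
            simp only [Set.indicator, Set.mem_ofPred_eq, h2, if_true, Pi.one_apply, mul_one]
            refine (D.fMix_le_env ht y).trans ?_
            gcongr
          · simp only [Set.indicator, Set.mem_ofPred_eq, h2, if_false, mul_zero]
            positivity
      have a2 := phi_nonneg hw.le (x - y)
      simp only [kerA]
      calc fMix p gμ t y * (badW ρ h θ R (t, y) * phi h (s - t) * phi (hx * t) (x - y))
          = fMix p gμ t y * badW ρ h θ R (t, y) * (phi h (s - t) * phi (hx * t) (x - y)) := by ring
        _ ≤ (lo⁻¹ * {t | kap ρ h t < θ}.indicator 1 t + envC lo hi M * (1 + R ^ 2)⁻¹) *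
            (phi h (s - t) * phi (hx * t) (x - y)) := by gcongr
        _ = _ := by rw [hK]; ring
    rw [integral_const_mul, integral_phi_sub' hw, mul_one] at h1
    refine h1.trans (le_of_eq ?_)
    rw [hK, add_mul]
    by_cases h2 : kap ρ h t < θ <;> simp [Set.indicator, h2]
  · rw [integral_add ((iφ.indicator hm).const_mul _) (iφ.const_mul _), integral_const_mul,
      integral_const_mul, integral_indicator hm]
    have := setIntegral_phi_kap_lt_le (ρ := ρ) hh hθ s
    have e : ∫ t, phi h (s - t) ∂ρ = kap ρ h s := rfl
    rw [e]; gcongr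

lemma IIDData.integral_kerA_le (D : IIDData P p gμ ρ lo hi M σ X) (hβ : Measurable β)
    (hβ1 : ∀ z, β z ∈ Set.Icc (0 : ℝ) 1) (hh : 0 < h) (hhx : 0 < hx) (s x : ℝ) :
    ∫ z, kerA β h hx s x z ∂dataLaw p gμ ρ ≤ lo⁻¹ * kap ρ h s := by
  have iφ := integrable_phi_measure hh s ρ
  have hlo := D.lo_pos
  refine (D.integral_dataLaw_le (c := fun t => lo⁻¹ * phi h (s - t))
    (D.integrable_kerA hβ hβ1 hh hhx s x) (iφ.const_mul _) fun t ht => ?_).trans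
    (le_of_eq (integral_const_mul _ _))
  have h0 := phi_nonneg hh.le (s - t)
  have hw : 0 < hx * t := mul_pos hhx (hlo.trans_le ht.1)
  have h1 : ∫ y, fMix p gμ t y * kerA β h hx s x (t, y) ≤
      ∫ y, (lo⁻¹ * phi h (s - t)) * phi (hx * t) (x - y) := by
    refine integral_mono_of_nonneg (ae_of_all _ fun y =>
      mul_nonneg (D.fMix_nonneg ht.1 y) (kerA_mem hβ1 hh hhx hlo s x ht).1)
      ((integrable_phi_sub' hw x).const_mul _) (ae_of_all _ fun y => ?_)
    have a0 := D.fMix_nonneg ht.1 y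
    have a1 := D.fMix_le ht.1 y
    obtain ⟨a3, a4⟩ := hβ1 (t, y)
    have a2 := phi_nonneg hw.le (x - y)
    simp only [kerA]
    calc fMix p gμ t y * (β (t, y) * phi h (s - t) * phi (hx * t) (x - y))
        = fMix p gμ t y * β (t, y) * (phi h (s - t) * phi (hx * t) (x - y)) := by ring
      _ ≤ lo⁻¹ * 1 * (phi h (s - t) * phi (hx * t) (x - y)) := by gcongr
      _ = _ := by ring
  rwa [integral_const_mul, integral_phi_sub' hw, mul_one] at h1

end means

/-! ### Events of high probability -/

section likely

variable {Ω : Type*} [MeasurableSpace Ω] {P : Measure Ω}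

/-- The probability that `A m` fails is `o(1 / r m)`. -/
def Likely (P : Measure Ω) (r : ℕ → ENNReal) (A : ℕ → Ω → Prop) : Prop :=
  Tendsto (fun m => r m * P {ω | ¬A m ω}) atTop (𝓝 0)

variable {r : ℕ → ENNReal} {A B : ℕ → Ω → Prop}

lemma Likely.mono (hA : Likely P r A) (h : ∀ᶠ m in atTop, ∀ᵐ ω ∂P, A m ω → B m ω) :
    Likely P r B := by
  refine tendsto_of_tendsto_of_tendsto_of_le_of_le' tendsto_const_nhds hA
    (Eventually.of_forall fun _ => zero_le) ?_
  filter_upwards [h] with m hm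
  refine mul_le_mul_right (measure_mono_ae ?_) _
  filter_upwards [hm] with ω hω h1 h2
  exact h1 (hω h2)

lemma Likely.and (hA : Likely P r A) (hB : Likely P r B) :
    Likely P r fun m ω => A m ω ∧ B m ω := by
  have h := Tendsto.add hA hB
  rw [add_zero] at h
  refine tendsto_of_tendsto_of_tendsto_of_le_of_le tendsto_const_nhds h (fun _ => zero_le)
    fun m => ?_
  rw [← mul_add]
  refine mul_le_mul_right (le_trans (measure_mono ?_) (measure_union_le _ _)) _
  intro ω hω
  by_cases h1 : A m ω
  · exact Or.inr fun h2 => hω ⟨h1, h2⟩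
  · exact Or.inl h1

lemma Likely.of_le {r' : ℕ → ENNReal} (hA : Likely P r' A) (h : ∀ᶠ m in atTop, r m ≤ r' m) :
    Likely P r A := by
  refine tendsto_of_tendsto_of_tendsto_of_le_of_le' tendsto_const_nhds hA
    (Eventually.of_forall fun _ => zero_le) ?_
  filter_upwards [h] with m hm
  exact mul_le_mul_left hm _

lemma eventually_one_le_natCast : ∀ᶠ m : ℕ in atTop, (1 : ℕ → ENNReal) m ≤ m := by
  filter_upwards [eventually_ge_atTop 1] with m hm
  simpa using hm

end likely

/-! ### Consequences of the bandwidth conditions -/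

section bandwidth

variable {hx hσ : ℕ → ℝ}

lemma BandwidthCondition.hx_zero (B : BandwidthCondition hx hσ) : Tendsto hx atTop (𝓝 0) := by
  refine B.hx_log.isBigO.trans_tendsto ?_
  exact (Real.tendsto_log_atTop.comp tendsto_natCast_atTop_atTop).inv_tendsto_atTop

lemma BandwidthCondition.mul_hx_atTop (B : BandwidthCondition hx hσ) :
    Tendsto (fun m : ℕ => (m : ℝ) * hx m) atTop atTop := by
  refine tendsto_atTop_mono' _ ?_ B.lim₁
  filter_upwards [B.hσ_zero.eventually_lt_const one_pos] with m hm
  have h1 := B.hσ_pos m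
  have h2 := B.hx_pos m
  have h3 : hσ m ^ 2 ≤ 1 := pow_le_one₀ h1.le hm.le
  exact mul_le_of_le_one_right (by positivity) h3

lemma BandwidthCondition.exists_rpow_le (B : BandwidthCondition hx hσ) :
    ∃ δ : ℝ, 0 < δ ∧ ∀ᶠ m : ℕ in atTop, (m : ℝ) ^ δ ≤ m * (hσ m * hx m) := by
  obtain ⟨δ, hδ, h1, -⟩ := B.exists_δ
  refine ⟨δ, hδ, ?_⟩
  filter_upwards [h1.eventually_ge_atTop 1, B.hx_zero.eventually_lt_const one_pos,
    eventually_gt_atTop 0] with m hm hm2 hm0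
  have hm' : (0 : ℝ) < m := by exact_mod_cast hm0
  have a1 := B.hσ_pos m
  have a2 := B.hx_pos m
  have a3 : 0 < (m : ℝ) ^ δ := Real.rpow_pos_of_pos hm' _
  have a4 : 0 < (m : ℝ) ^ (1 - δ) := Real.rpow_pos_of_pos hm' _
  have e : (m : ℝ) = (m : ℝ) ^ δ * (m : ℝ) ^ (1 - δ) := by
    rw [← Real.rpow_add hm']; simp
  have h2 : 1 ≤ (m : ℝ) ^ (1 - δ) * hσ m * hx m := by
    refine hm.trans ?_
    have : hx m ^ 2 ≤ hx m := by nlinarith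
    gcongr
  calc (m : ℝ) ^ δ ≤ (m : ℝ) ^ δ * ((m : ℝ) ^ (1 - δ) * hσ m * hx m) :=
        le_mul_of_one_le_right a3.le h2
    _ = ((m : ℝ) ^ δ * (m : ℝ) ^ (1 - δ)) * (hσ m * hx m) := by ring
    _ = m * (hσ m * hx m) := by rw [← e]

lemma BandwidthCondition.mul_atTop (B : BandwidthCondition hx hσ) :
    Tendsto (fun m : ℕ => (m : ℝ) * (hσ m * hx m)) atTop atTop := by
  obtain ⟨δ, hδ, h⟩ := B.exists_rpow_le
  exact tendsto_atTop_mono' _ h ((tendsto_rpow_atTop hδ).comp tendsto_natCast_atTop_atTop)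

lemma BandwidthCondition.tendsto_sq_mul_exp (B : BandwidthCondition hx hσ) {c : ℝ} (hc : 0 < c) :
    Tendsto (fun m : ℕ => (m : ℝ) ^ 2 * Real.exp (-(c * (m * (hσ m * hx m))))) atTop (𝓝 0) := by
  obtain ⟨δ, hδ, h⟩ := B.exists_rpow_le
  have h1 := (tendsto_rpow_mul_exp_neg_mul_atTop_nhds_zero (2 / δ) c hc).comp
    ((tendsto_rpow_atTop hδ).comp tendsto_natCast_atTop_atTop)
  refine tendsto_of_tendsto_of_tendsto_of_le_of_le' tendsto_const_nhds h1
    (Eventually.of_forall fun m => by positivity) ?_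
  filter_upwards [h] with m hm
  have e : ((m : ℝ) ^ δ) ^ (2 / δ) = (m : ℝ) ^ 2 := by
    rw [← Real.rpow_mul (by positivity), mul_div_cancel₀ _ hδ.ne']
    exact_mod_cast Real.rpow_natCast (m : ℝ) 2
  simp only [Function.comp, e]
  gcongr
  nlinarith

end bandwidth

/-! ### Uniform approximation of kernel averages -/

section approx

/-- Normalised kernel average with weight `β`. -/
noncomputable def avgA (ρ : Measure ℝ) (β : ℝ × ℝ → ℝ) (h hx : ℝ) (m : ℕ) (x s : ℕ → ℝ)
    (t y : ℝ) : ℝ :=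
  (m * kap ρ h t)⁻¹ * ∑ k ∈ Finset.range m, kerA β h hx t y (s k, x k)

/-- Normalised average of the kernel in the scale only, with weight `β`. -/
noncomputable def avgS (ρ : Measure ℝ) (β : ℝ × ℝ → ℝ) (h : ℝ) (m : ℕ) (x s : ℕ → ℝ)
    (t : ℝ) : ℝ :=
  (m * kap ρ h t)⁻¹ * ∑ k ∈ Finset.range m, kerS β h t (s k, x k)

variable {Ω : Type*} [MeasurableSpace Ω] {P : Measure Ω} [IsProbabilityMeasure P] {p : ℝ}
  {gμ ρ : Measure ℝ} [IsProbabilityMeasure gμ] [IsProbabilityMeasure ρ] {lo hi M : ℝ}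
  {σ X : ℕ → Ω → ℝ} {hx hσ : ℕ → ℝ}

/-- A family of kernels satisfying the bounds needed for the deviation inequalities. -/
structure KernelBound (p : ℝ) (gμ ρ : Measure ℝ) (hx hσ : ℕ → ℝ) (C V : ℝ)
    (K : ℕ → ℝ × ℝ → ℝ × ℝ → ℝ) : Prop where
  C_pos : 0 < C
  V_pos : 0 < V
  meas : ∀ m, Measurable (Function.uncurry (K m))
  bound : ∀ᶠ m in atTop, ∀ᵐ b ∂dataLaw p gμ ρ, ∀ a, 0 ≤ K m a b ∧ K m a b ≤ C * (hσ m * hx m)⁻¹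
  mean : ∀ m a, ∫ b, K m a b ∂dataLaw p gμ ρ ≤ V * kap ρ (hσ m) a.1

lemma tendsto_natCast_mul_ofReal {f : ℕ → ℝ} (hf : Tendsto (fun m : ℕ => (m : ℝ) * f m) atTop (𝓝 0)) :
    Tendsto (fun m : ℕ => (m : ENNReal) * ENNReal.ofReal (f m)) atTop (𝓝 0) := by
  have := ENNReal.tendsto_ofReal hf
  rw [ENNReal.ofReal_zero] at this
  refine this.congr fun m => ?_
  rw [ENNReal.ofReal_mul (by positivity), ENNReal.ofReal_natCast]

lemma IIDData.likely_dev (D : IIDData P p gμ ρ lo hi M σ X) (B : BandwidthCondition hx hσ)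
    {C V : ℝ} {K : ℕ → ℝ × ℝ → ℝ × ℝ → ℝ} (hK : KernelBound p gμ ρ hx hσ C V K)
    {θ ε : ℝ} (hθ : 0 < θ) (hε : 0 < ε) :
    Likely P (fun m => m) fun m ω => ∀ i < m, θ ≤ kap ρ (hσ m) (σ i ω) →
      |(m : ℝ)⁻¹ * ∑ k ∈ Finset.range m, K m (σ i ω, X i ω) (σ k ω, X k ω) -
        ∫ b, K m (σ i ω, X i ω) b ∂dataLaw p gμ ρ| < ε * kap ρ (hσ m) (σ i ω) := by
  have hQ := D.isProbabilityMeasure_dataLaw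
  have hC := hK.C_pos
  have hV := hK.V_pos
  set c := devRate ε V * (θ / C) with hc
  have hc0 : 0 < c := mul_pos (devRate_pos hε hV) (by positivity)
  have lim := tendsto_natCast_mul_ofReal (f := fun m : ℕ =>
    m * (2 * Real.exp (-(c * (m * (hσ m * hx m)))))) (by
      have := (B.tendsto_sq_mul_exp hc0).const_mul 2
      rw [mul_zero] at this
      exact this.congr fun m => by ring)
  refine tendsto_of_tendsto_of_tendsto_of_le_of_le' tendsto_const_nhds lim
    (Eventually.of_forall fun _ => zero_le) ?_
  have hB0 : Tendsto (fun m : ℕ => (C / θ) * (m * (hσ m * hx m))⁻¹ + V / m) atTop (𝓝 0) := by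
    have h1 := (B.mul_atTop.inv_tendsto_atTop).const_mul (C / θ)
    have h2 := tendsto_const_div_atTop_nhds_zero_nat V
    simpa using h1.add h2
  filter_upwards [hK.bound, hB0.eventually_lt_const (by positivity : 0 < ε / 2),
    eventually_gt_atTop 0] with m hm hm2 hm0
  refine mul_le_mul_right ?_ _
  have hm' : (0 : ℝ) < m := by exact_mod_cast hm0
  have h1 := B.hσ_pos m
  have h2 := B.hx_pos m
  set Bd := C / θ * (hσ m * hx m)⁻¹ with hBd
  have hBd0 : 0 < Bd := by positivity
  let ψ : ℝ × ℝ → ℝ × ℝ → ℝ := fun a b =>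
    {a : ℝ × ℝ | θ ≤ kap ρ (hσ m) a.1}.indicator (fun a => (kap ρ (hσ m) a.1)⁻¹ * K m a b) a
  have hkm : Measurable fun a : ℝ × ℝ => kap ρ (hσ m) a.1 := (measurable_kap ρ _).comp measurable_fst
  have hset : MeasurableSet {a : ℝ × ℝ | θ ≤ kap ρ (hσ m) a.1} :=
    measurableSet_le measurable_const hkm
  have hψ : Measurable (Function.uncurry ψ) := by
    have : Function.uncurry ψ = {q : (ℝ × ℝ) × (ℝ × ℝ) | θ ≤ kap ρ (hσ m) q.1.1}.indicator
        (fun q => (kap ρ (hσ m) q.1.1)⁻¹ * K m q.1 q.2) := rfl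
    rw [this]
    exact ((hkm.comp measurable_fst).inv.mul (hK.meas m)).indicator (measurable_fst hset)
  have hψB : ∀ᵐ b ∂dataLaw p gμ ρ, ∀ a, 0 ≤ ψ a b ∧ ψ a b ≤ Bd := by
    filter_upwards [hm] with b hb a
    by_cases ha : θ ≤ kap ρ (hσ m) a.1
    · simp only [ψ, Set.indicator, Set.mem_ofPred_eq, ha, if_true]
      have hk : 0 < kap ρ (hσ m) a.1 := hθ.trans_le ha
      obtain ⟨b1, b2⟩ := hb a
      refine ⟨by positivity, ?_⟩
      calc (kap ρ (hσ m) a.1)⁻¹ * K m a b ≤ θ⁻¹ * (C * (hσ m * hx m)⁻¹) := by gcongr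
        _ = Bd := by rw [hBd]; ring
    · simp only [ψ, Set.indicator, Set.mem_ofPred_eq, ha, if_false]
      exact ⟨le_rfl, hBd0.le⟩
  have hψI : ∀ a, θ ≤ kap ρ (hσ m) a.1 → ∫ b, ψ a b ∂dataLaw p gμ ρ =
      (kap ρ (hσ m) a.1)⁻¹ * ∫ b, K m a b ∂dataLaw p gμ ρ := by
    intro a ha
    simp only [ψ, Set.indicator, Set.mem_ofPred_eq, ha, if_true]
    rw [integral_const_mul]
  have hψV : ∀ a, ∫ b, ψ a b ∂dataLaw p gμ ρ ≤ V := by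
    intro a
    by_cases ha : θ ≤ kap ρ (hσ m) a.1
    · have hk : 0 < kap ρ (hσ m) a.1 := hθ.trans_le ha
      rw [hψI a ha, inv_mul_le_iff₀ hk, mul_comm]
      exact hK.mean m a
    · simp only [ψ, Set.indicator, Set.mem_ofPred_eq, ha, if_false]
      simpa using hV.le
  have hBm : (Bd + V) / m ≤ ε / 2 := by
    refine le_trans (le_of_eq ?_) hm2.le
    rw [hBd, mul_inv]; field_simp
  have key : ∀ i < m, P {ω | ε ≤ |(m : ℝ)⁻¹ * ∑ k ∈ Finset.range m,
      ψ (σ i ω, X i ω) (σ k ω, X k ω) - ∫ b, ψ (σ i ω, X i ω) b ∂dataLaw p gμ ρ|} ≤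
      ENNReal.ofReal (2 * Real.exp (-(c * (m * (hσ m * hx m))))) := by
    intro i hi
    have := measure_avg_dev_le (P := P) (Q := dataLaw p gμ ρ) (Z := fun i ω => (σ i ω, X i ω))
      D.measurable_data D.indep D.law hψ hBd0 hV hε hψB hψV hBm hi
    refine this.trans (le_of_eq ?_)
    congr 4
    rw [hc, hBd]
    field_simp
  calc P {ω | ¬∀ i < m, θ ≤ kap ρ (hσ m) (σ i ω) → _}
      ≤ P (⋃ i ∈ Finset.range m, {ω | ε ≤ |(m : ℝ)⁻¹ * ∑ k ∈ Finset.range m,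
        ψ (σ i ω, X i ω) (σ k ω, X k ω) - ∫ b, ψ (σ i ω, X i ω) b ∂dataLaw p gμ ρ|}) := by
        refine measure_mono fun ω hω => ?_
        simp only [Set.mem_ofPred_eq, not_forall, not_lt] at hω
        obtain ⟨i, hi, hk, hω⟩ := hω
        simp only [Set.mem_iUnion, Finset.mem_range]
        refine ⟨i, hi, ?_⟩
        have hk0 : 0 < kap ρ (hσ m) (σ i ω) := hθ.trans_le hk
        rw [Set.mem_ofPred_eq, hψI _ hk]
        simp only [ψ, Set.indicator, Set.mem_ofPred_eq, hk, if_true]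
        rw [← Finset.mul_sum, mul_left_comm, ← mul_sub, abs_mul, abs_of_pos (inv_pos.2 hk0),
          le_inv_mul_iff₀ hk0, mul_comm]
        exact hω
    _ ≤ ∑ i ∈ Finset.range m, P {ω | ε ≤ |(m : ℝ)⁻¹ * ∑ k ∈ Finset.range m,
        ψ (σ i ω, X i ω) (σ k ω, X k ω) - ∫ b, ψ (σ i ω, X i ω) b ∂dataLaw p gμ ρ|} :=
        measure_biUnion_finset_le _ _
    _ ≤ ∑ i ∈ Finset.range m, ENNReal.ofReal (2 * Real.exp (-(c * (m * (hσ m * hx m))))) :=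
        Finset.sum_le_sum fun i hi => key i (Finset.mem_range.1 hi)
    _ = _ := by
        rw [Finset.sum_const, Finset.card_range, nsmul_eq_mul,
          ENNReal.ofReal_mul (p := (m : ℝ)) (by positivity), ENNReal.ofReal_natCast]

lemma IIDData.likely_dev_fixed (D : IIDData P p gμ ρ lo hi M σ X) (B : BandwidthCondition hx hσ)
    {C V : ℝ} {K : ℕ → ℝ × ℝ → ℝ × ℝ → ℝ} (hK : KernelBound p gμ ρ hx hσ C V K)
    {θ ε : ℝ} (hθ : 0 < θ) (hε : 0 < ε) {a : ℝ × ℝ} (ha : ∀ᶠ m in atTop, θ ≤ kap ρ (hσ m) a.1) :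
    Likely P (fun m => m) fun m ω =>
      |(m : ℝ)⁻¹ * ∑ k ∈ Finset.range m, K m a (σ k ω, X k ω) -
        ∫ b, K m a b ∂dataLaw p gμ ρ| < ε * kap ρ (hσ m) a.1 := by
  have hQ := D.isProbabilityMeasure_dataLaw
  have hC := hK.C_pos
  have hV := hK.V_pos
  set c := devRate ε V * (θ / C) with hc
  have hc0 : 0 < c := mul_pos (devRate_pos hε hV) (by positivity)
  have lim := tendsto_natCast_mul_ofReal (f := fun m : ℕ =>
    m * (2 * Real.exp (-(c * (m * (hσ m * hx m)))))) (by
      have := (B.tendsto_sq_mul_exp hc0).const_mul 2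
      rw [mul_zero] at this
      exact this.congr fun m => by ring)
  refine tendsto_of_tendsto_of_tendsto_of_le_of_le' tendsto_const_nhds lim
    (Eventually.of_forall fun _ => zero_le) ?_
  filter_upwards [hK.bound, ha, eventually_gt_atTop 0] with m hm hm2 hm0
  refine mul_le_mul_right ?_ _
  have h1 := B.hσ_pos m
  have h2 := B.hx_pos m
  have hk0 : 0 < kap ρ (hσ m) a.1 := hθ.trans_le hm2
  set Bd := C / θ * (hσ m * hx m)⁻¹ with hBd
  have hBd0 : 0 < Bd := by positivity
  have key := measure_avg_dev_fixed_le (P := P) (Q := dataLaw p gμ ρ)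
    (Z := fun i ω => (σ i ω, X i ω)) D.measurable_data D.indep D.law
    (g := fun b => (kap ρ (hσ m) a.1)⁻¹ * K m a b)
    (((hK.meas m).comp measurable_prodMk_left).const_mul _) hBd0 hV hε
    (by
      filter_upwards [hm] with b hb
      obtain ⟨b1, b2⟩ := hb a
      refine ⟨by positivity, ?_⟩
      calc (kap ρ (hσ m) a.1)⁻¹ * K m a b ≤ θ⁻¹ * (C * (hσ m * hx m)⁻¹) := by gcongr
        _ = Bd := by rw [hBd]; ring)
    (by
      rw [integral_const_mul, inv_mul_le_iff₀ hk0, mul_comm]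
      exact hK.mean m a) hm0
  refine (measure_mono fun ω hω => ?_).trans (key.trans ?_)
  · simp only [Set.mem_ofPred_eq, not_lt] at hω ⊢
    rw [integral_const_mul, ← Finset.mul_sum, mul_left_comm, ← mul_sub, abs_mul,
      abs_of_pos (inv_pos.2 hk0), le_inv_mul_iff₀ hk0, mul_comm]
    exact hω
  · refine ENNReal.ofReal_le_ofReal ?_
    have e : devRate ε V * (m / Bd) = c * (m * (hσ m * hx m)) := by
      rw [hc, hBd]; field_simp
    rw [e]
    have : (1 : ℝ) ≤ m := by exact_mod_cast hm0
    exact le_mul_of_one_le_left (by positivity) this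

variable {β : ℝ × ℝ → ℝ}

lemma IIDData.kernelBound_kerA (D : IIDData P p gμ ρ lo hi M σ X) (B : BandwidthCondition hx hσ)
    {β : ℕ → ℝ × ℝ → ℝ} (hβ : ∀ m, Measurable (β m)) (hβ1 : ∀ m z, β m z ∈ Set.Icc (0 : ℝ) 1) :
    KernelBound p gμ ρ hx hσ lo⁻¹ lo⁻¹ fun m a b => kerA (β m) (hσ m) (hx m) a.1 a.2 b where
  C_pos := inv_pos.2 D.lo_pos
  V_pos := inv_pos.2 D.lo_pos
  meas m := measurable_kerA (hβ m)
  bound := by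
    refine Eventually.of_forall fun m => D.ae_dataLaw.mono fun b hb a => ?_
    have := kerA_mem (hβ1 m) (B.hσ_pos m) (B.hx_pos m) D.lo_pos a.1 a.2 hb
    rw [mul_inv, mul_comm] at this
    exact this
  mean m a := D.integral_kerA_le (hβ m) (hβ1 m) (B.hσ_pos m) (B.hx_pos m) a.1 a.2

lemma IIDData.kernelBound_kerS (D : IIDData P p gμ ρ lo hi M σ X) (B : BandwidthCondition hx hσ)
    {β : ℕ → ℝ × ℝ → ℝ} (hβ : ∀ m, Measurable (β m)) (hβ1 : ∀ m z, β m z ∈ Set.Icc (0 : ℝ) 1) :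
    KernelBound p gμ ρ hx hσ 1 1 fun m a b => kerS (β m) (hσ m) a.1 b where
  C_pos := one_pos
  V_pos := one_pos
  meas m := (measurable_kerS (hβ m)).comp
    ((measurable_fst.comp measurable_fst).prodMk measurable_snd)
  bound := by
    filter_upwards [B.hx_zero.eventually_lt_const one_pos] with m hm
    refine ae_of_all _ fun b a => ?_
    have h1 := kerS_mem (hβ1 m) (B.hσ_pos m) a.1 b
    refine ⟨h1.1, h1.2.trans ?_⟩
    have h2 := B.hσ_pos m
    have h3 := B.hx_pos m
    rw [one_mul]
    exact inv_anti₀ (by positivity) (mul_le_of_le_one_right h2.le hm.le)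
  mean m a := by
    rw [one_mul]
    exact D.integral_kerS_le (hβ m) (hβ1 m) (B.hσ_pos m) a.1

lemma abs_inv_mul_sub_lt {m κ S I u ε₁ ε₂ : ℝ} (hκ : 0 < κ) (h1 : |m⁻¹ * S - I| < ε₁ * κ)
    (h2 : |I - κ * u| ≤ ε₂ * κ) : |(m * κ)⁻¹ * S - u| < ε₁ + ε₂ := by
  have e : (m * κ)⁻¹ * S - u = κ⁻¹ * ((m⁻¹ * S - I) + (I - κ * u)) := by
    rw [mul_inv]; field_simp; ring
  rw [e, abs_mul, abs_of_pos (inv_pos.2 hκ), inv_mul_lt_iff₀ hκ]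
  have := abs_add_le (m⁻¹ * S - I) (I - κ * u)
  nlinarith

lemma inv_mul_lt_of_le {m κ S I u ε₁ : ℝ} (hκ : 0 < κ) (h1 : |m⁻¹ * S - I| < ε₁ * κ)
    (h2 : I ≤ u * κ) : (m * κ)⁻¹ * S < ε₁ + u := by
  have h3 := (abs_lt.1 h1).2
  have e : (m * κ)⁻¹ * S = κ⁻¹ * (m⁻¹ * S) := by rw [mul_inv]; ring
  rw [e, inv_mul_lt_iff₀ hκ]
  nlinarith

lemma lt_inv_mul_of_le {m κ S I u ε₁ : ℝ} (hκ : 0 < κ) (h1 : |m⁻¹ * S - I| < ε₁ * κ)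
    (h2 : u * κ ≤ I) : u - ε₁ < (m * κ)⁻¹ * S := by
  have h3 := (abs_lt.1 h1).1
  have e : (m * κ)⁻¹ * S = κ⁻¹ * (m⁻¹ * S) := by rw [mul_inv]; ring
  rw [e, lt_inv_mul_iff₀ hκ]
  nlinarith

lemma tendsto_phi_zero {η : ℝ} (hη : 0 < η) {h : ℕ → ℝ} (hpos : ∀ m, 0 < h m)
    (hh : Tendsto h atTop (𝓝 0)) : Tendsto (fun m => phi (h m) η) atTop (𝓝 0) := by
  have h1 : Tendsto (fun m => 2 * h m / η ^ 2) atTop (𝓝 0) := by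
    have := (hh.const_mul 2).div_const (η ^ 2)
    simpa using this
  refine squeeze_zero (fun m => phi_nonneg (hpos m).le η) (fun m => ?_) h1
  rw [le_div_iff₀ (by positivity), mul_comm]
  exact sq_mul_phi_le (hpos m) η

/-- The bias of the kernel averages is eventually small, uniformly over scales that are not
isolated. -/
lemma IIDData.eventually_bias (D : IIDData P p gμ ρ lo hi M σ X) (B : BandwidthCondition hx hσ)
    (hβ : Measurable β) (hβ1 : ∀ z, β z ∈ Set.Icc (0 : ℝ) 1) {L : ℝ} (hL : 0 ≤ L)
    (hLip : ∀ s ∈ Set.Icc lo hi, ∀ t ∈ Set.Icc lo hi, ∀ x y,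
      |fMix p gμ s x * β (s, x) - fMix p gμ t y * β (t, y)| ≤ L * (|s - t| + |x - y|))
    {θ ε : ℝ} (hθ : 0 < θ) (hε : 0 < ε) :
    ∀ᶠ m in atTop, ∀ s ∈ Set.Icc lo hi, θ ≤ kap ρ (hσ m) s → ∀ x,
      |∫ z, kerA β (hσ m) (hx m) s x z ∂dataLaw p gμ ρ -
        kap ρ (hσ m) s * (fMix p gμ s x * β (s, x))| ≤ ε * kap ρ (hσ m) s := by
  set η := ε / (4 * (L + 1)) with hη
  have hη0 : 0 < η := by positivity
  have hLη : L * η ≤ ε / 4 := by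
    have : (L + 1) * η = ε / 4 := by rw [hη]; field_simp
    nlinarith
  have l1 : Tendsto (fun m => L * (2 * hx m * hi)) atTop (𝓝 0) := by
    have := ((B.hx_zero.const_mul 2).mul_const hi).const_mul L
    simpa using this
  have l2 : Tendsto (fun m => L * ((hi - lo) * phi (hσ m) η)) atTop (𝓝 0) := by
    have := ((tendsto_phi_zero hη0 B.hσ_pos B.hσ_zero).const_mul (hi - lo)).const_mul L
    simpa using this
  filter_upwards [l1.eventually_lt_const (by positivity : 0 < ε / 4),
    l2.eventually_lt_const (by positivity : 0 < ε / 4 * θ)] with m h1 h2 s hs hk x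
  refine (D.abs_integral_kerA_sub_le hβ hβ1 (B.hσ_pos m) (B.hx_pos m) hL hLip hs x hη0.le).trans ?_
  have hk0 : 0 < kap ρ (hσ m) s := hθ.trans_le hk
  have e : L * ((η + 2 * hx m * hi) * kap ρ (hσ m) s + (hi - lo) * phi (hσ m) η) =
      (L * η) * kap ρ (hσ m) s + (L * (2 * hx m * hi)) * kap ρ (hσ m) s +
        L * ((hi - lo) * phi (hσ m) η) := by ring
  rw [e]
  have h3 : ε / 4 * θ ≤ ε / 4 * kap ρ (hσ m) s := by gcongr
  have h4 : (L * η) * kap ρ (hσ m) s ≤ ε / 4 * kap ρ (hσ m) s := by gcongr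
  have h5 : (L * (2 * hx m * hi)) * kap ρ (hσ m) s ≤ ε / 4 * kap ρ (hσ m) s := by gcongr
  nlinarith

lemma IIDData.likely_avgA (D : IIDData P p gμ ρ lo hi M σ X) (B : BandwidthCondition hx hσ)
    (hβ : Measurable β) (hβ1 : ∀ z, β z ∈ Set.Icc (0 : ℝ) 1) {L : ℝ} (hL : 0 ≤ L)
    (hLip : ∀ s ∈ Set.Icc lo hi, ∀ t ∈ Set.Icc lo hi, ∀ x y,
      |fMix p gμ s x * β (s, x) - fMix p gμ t y * β (t, y)| ≤ L * (|s - t| + |x - y|))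
    {θ ε : ℝ} (hθ : 0 < θ) (hε : 0 < ε) :
    Likely P (fun m => m) fun m ω => ∀ i < m, θ ≤ kap ρ (hσ m) (σ i ω) →
      |avgA ρ β (hσ m) (hx m) m (fun j => X j ω) (fun j => σ j ω) (σ i ω) (X i ω) -
        fMix p gμ (σ i ω) (X i ω) * β (σ i ω, X i ω)| < ε := by
  refine (D.likely_dev B (D.kernelBound_kerA B (fun _ => hβ) (fun _ => hβ1)) hθ
    (half_pos hε)).mono ?_
  filter_upwards [D.eventually_bias B hβ hβ1 hL hLip hθ (half_pos hε)] with m hm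
  filter_upwards [D.ae_all_mem] with ω hω h i hi hk
  have := abs_inv_mul_sub_lt (hθ.trans_le hk) (h i hi hk) (hm _ (hω i) hk (X i ω))
  rwa [add_halves] at this

lemma IIDData.likely_avgS (D : IIDData P p gμ ρ lo hi M σ X) (B : BandwidthCondition hx hσ)
    (hβ : Measurable β) (hβ1 : ∀ z, β z ∈ Set.Icc (0 : ℝ) 1) {v : ℝ}
    (hv : ∀ t ∈ Set.Icc lo hi, ∫ x, fMix p gμ t x * β (t, x) = v)
    {θ ε : ℝ} (hθ : 0 < θ) (hε : 0 < ε) :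
    Likely P (fun m => m) fun m ω => ∀ i < m, θ ≤ kap ρ (hσ m) (σ i ω) →
      |avgS ρ β (hσ m) m (fun j => X j ω) (fun j => σ j ω) (σ i ω) - v| < ε := by
  refine (D.likely_dev B (D.kernelBound_kerS B (fun _ => hβ) (fun _ => hβ1)) hθ hε).mono
    (Eventually.of_forall fun m => ae_of_all _ fun ω h i hi hk => ?_)
  have := abs_inv_mul_sub_lt (ε₂ := 0) (u := v) (hθ.trans_le hk) (h i hi hk)
    (by rw [D.integral_kerS_eq hβ hβ1 (B.hσ_pos m) _ hv]; simp)
  rwa [add_zero] at this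

lemma IIDData.likely_avgS_fixed (D : IIDData P p gμ ρ lo hi M σ X) (B : BandwidthCondition hx hσ)
    (hβ : Measurable β) (hβ1 : ∀ z, β z ∈ Set.Icc (0 : ℝ) 1) {v : ℝ}
    (hv : ∀ t ∈ Set.Icc lo hi, ∫ x, fMix p gμ t x * β (t, x) = v)
    {θ ε : ℝ} (hθ : 0 < θ) (hε : 0 < ε) {σ₀ : ℝ} (h₀ : ∀ᶠ m in atTop, θ ≤ kap ρ (hσ m) σ₀) :
    Likely P (fun m => m) fun m ω =>
      |avgS ρ β (hσ m) m (fun j => X j ω) (fun j => σ j ω) σ₀ - v| < ε := by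
  refine (D.likely_dev_fixed B (D.kernelBound_kerS B (fun _ => hβ) (fun _ => hβ1)) hθ hε
    (a := (σ₀, 0)) h₀).mono ?_
  filter_upwards [h₀] with m hm
  refine ae_of_all _ fun ω h => ?_
  have := abs_inv_mul_sub_lt (ε₂ := 0) (u := v) (hθ.trans_le hm) h
    (by rw [D.integral_kerS_eq hβ hβ1 (B.hσ_pos m) _ hv]; simp)
  rwa [add_zero] at this

lemma exists_bad_params (lo hi M : ℝ) (hlo : 0 < lo) {θ ε : ℝ} (hθ : 0 < θ) (hε : 0 < ε) :
    ∃ θ' R : ℝ, 0 < θ' ∧ 0 < R ∧ massC * (2 * Real.exp (1 / 4)) * θ' ≤ ε * θ ∧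
      lo⁻¹ * (massC * (2 * Real.exp (1 / 4)) * θ') ≤ ε * θ ∧ tailC lo hi M R ≤ ε ∧
      envC lo hi M * (1 + R ^ 2)⁻¹ ≤ ε := by
  have hmC := massC_pos
  set c := massC * (2 * Real.exp (1 / 4)) with hc
  have hc0 : 0 < c := by positivity
  have t2 : Tendsto (fun R : ℝ => envC lo hi M * (1 + R ^ 2)⁻¹) atTop (𝓝 0) := by
    have : Tendsto (fun R : ℝ => 1 + R ^ 2) atTop atTop :=
      tendsto_atTop_add_const_left _ _ (tendsto_pow_atTop two_ne_zero)
    simpa using this.inv_tendsto_atTop.const_mul (envC lo hi M)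
  obtain ⟨R, h1, h2, h3⟩ := (((tendsto_tailC lo hi M).eventually_lt_const hε).and
    ((t2.eventually_lt_const hε).and (eventually_gt_atTop 0))).exists
  refine ⟨min (ε * θ / c) (ε * θ * lo / c), R, by positivity, h3, ?_, ?_, h1.le, h2.le⟩
  · calc c * min (ε * θ / c) (ε * θ * lo / c) ≤ c * (ε * θ / c) := by
          gcongr; exact min_le_left _ _
      _ = ε * θ := by field_simp
  · calc lo⁻¹ * (c * min (ε * θ / c) (ε * θ * lo / c)) ≤ lo⁻¹ * (c * (ε * θ * lo / c)) := by
          gcongr; exact min_le_right _ _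
      _ = ε * θ := by field_simp

/-- The bad observations have a small share in all averages at scales that are not isolated. -/
lemma IIDData.exists_likely_bad (D : IIDData P p gμ ρ lo hi M σ X) (B : BandwidthCondition hx hσ)
    {θ ε : ℝ} (hθ : 0 < θ) (hε : 0 < ε) : ∃ θ' R : ℝ, 0 < θ' ∧ 0 < R ∧
      (Likely P (fun m => m) fun m ω => ∀ i < m, θ ≤ kap ρ (hσ m) (σ i ω) →
        avgA ρ (badW ρ (hσ m) θ' R) (hσ m) (hx m) m (fun j => X j ω) (fun j => σ j ω) (σ i ω)
          (X i ω) < ε ∧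
        avgS ρ (badW ρ (hσ m) θ' R) (hσ m) m (fun j => X j ω) (fun j => σ j ω) (σ i ω) < ε) ∧
      ∀ σ₀, (∀ᶠ m in atTop, θ ≤ kap ρ (hσ m) σ₀) → Likely P (fun m => m) fun m ω =>
        avgS ρ (badW ρ (hσ m) θ' R) (hσ m) m (fun j => X j ω) (fun j => σ j ω) σ₀ < ε := by
  obtain ⟨θ', R, hθ', hR, h1, h2, h3, h4⟩ := exists_bad_params lo hi M D.lo_pos hθ
    (by positivity : 0 < ε / 4)
  have hε4 : 0 < ε / 4 := by positivity
  have hbm : ∀ m, Measurable (badW ρ (hσ m) θ' R) := fun m => measurable_badW _ _ _ _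
  have hb1 : ∀ m z, badW ρ (hσ m) θ' R z ∈ Set.Icc (0 : ℝ) 1 := fun m => badW_mem _ _ _ _
  have mA : ∀ m s x, θ ≤ kap ρ (hσ m) s → ∫ z, kerA (badW ρ (hσ m) θ' R) (hσ m) (hx m) s x z
      ∂dataLaw p gμ ρ ≤ ε / 2 * kap ρ (hσ m) s := by
    intro m s x hk
    refine (D.integral_kerA_bad_le (B.hσ_pos m) (B.hx_pos m) hθ'.le R s x hR.le).trans ?_
    have hk0 : 0 < kap ρ (hσ m) s := hθ.trans_le hk
    have : ε / 4 * θ ≤ ε / 4 * kap ρ (hσ m) s := by gcongr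
    nlinarith
  have mS : ∀ m s, θ ≤ kap ρ (hσ m) s → ∫ z, kerS (badW ρ (hσ m) θ' R) (hσ m) s z
      ∂dataLaw p gμ ρ ≤ ε / 2 * kap ρ (hσ m) s := by
    intro m s hk
    refine (D.integral_kerS_bad_le (B.hσ_pos m) hθ'.le R s).trans ?_
    have hk0 : 0 < kap ρ (hσ m) s := hθ.trans_le hk
    have : ε / 4 * θ ≤ ε / 4 * kap ρ (hσ m) s := by gcongr
    nlinarith
  refine ⟨θ', R, hθ', hR, ?_, fun σ₀ h₀ => ?_⟩
  · refine ((D.likely_dev B (D.kernelBound_kerA B hbm hb1) hθ hε4).and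
      (D.likely_dev B (D.kernelBound_kerS B hbm hb1) hθ hε4)).mono
      (Eventually.of_forall fun m => ae_of_all _ fun ω h i hi hk => ?_)
    have hk0 := hθ.trans_le hk
    have g1 := inv_mul_lt_of_le hk0 (h.1 i hi hk) (mA m _ _ hk)
    have g2 := inv_mul_lt_of_le hk0 (h.2 i hi hk) (mS m _ hk)
    unfold avgA avgS
    constructor <;> linarith
  · refine (D.likely_dev_fixed B (D.kernelBound_kerS B hbm hb1) hθ hε4
      (a := (σ₀, 0)) h₀).mono ?_
    filter_upwards [h₀] with m hm
    refine ae_of_all _ fun ω h => ?_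
    have g2 := inv_mul_lt_of_le (hθ.trans_le hm) h (mS m _ hm)
    unfold avgS
    linarith

end approx

/-! ### Elementary inequalities for quotients -/

lemma abs_div_sub_le {n d u v e U : ℝ} (hn : |n - u| ≤ e) (hd : |d - v| ≤ e) (hv : 0 < v)
    (he : e ≤ v / 2) (hU : |u / v| ≤ U) : |n / d - u / v| ≤ 2 * e * (1 + U) / v := by
  have hd' := abs_le.1 hd
  have hd0 : v / 2 ≤ d := by linarith
  have hdp : 0 < d := by linarith
  have he0 : 0 ≤ e := (abs_nonneg _).trans hn
  have hU0 : 0 ≤ U := (abs_nonneg _).trans hU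
  have e1 : n / d - u / v = ((n - u) - u / v * (d - v)) / d := by field_simp; ring
  rw [e1, abs_div, abs_of_pos hdp]
  have h1 : |(n - u) - u / v * (d - v)| ≤ e + U * e := by
    refine (abs_sub _ _).trans (add_le_add hn ?_)
    rw [abs_mul]
    exact mul_le_mul hU hd (abs_nonneg _) hU0
  calc |(n - u) - u / v * (d - v)| / d ≤ (e + U * e) / (v / 2) := by gcongr
    _ = 2 * e * (1 + U) / v := by field_simp

lemma abs_div_sub_div_le {N D N' D' : ℝ} (hN : 0 ≤ N) (hND : N ≤ D) (hD' : 0 < D') :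
    |N / D - N' / D'| ≤ (|N - N'| + |D - D'|) / D' := by
  have h1 : N / D ≤ 1 := div_le_one_of_le₀ hND (hN.trans hND)
  have h0 : 0 ≤ N / D := div_nonneg hN (hN.trans hND)
  have h2 : N = N / D * D := by
    rcases (hN.trans hND).eq_or_lt with h | h
    · rw [← h] at hND ⊢; simp; linarith
    · field_simp
  have e1 : N / D - N' / D' = ((N - N') - N / D * (D - D')) / D' := by
    rw [mul_sub, ← h2]; field_simp; ring
  rw [e1, abs_div, abs_of_pos hD']
  gcongr
  refine (abs_sub _ _).trans (add_le_add le_rfl ?_)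
  rw [abs_mul, abs_of_nonneg h0]
  exact mul_le_of_le_one_left (abs_nonneg _) h1

lemma min_div_one_eq (N : ℝ) {F : ℝ} (hF : 0 ≤ F) : min (N / F) 1 = min N F / F := by
  rcases hF.eq_or_lt with h | h
  · rw [← h]; simp
  · rw [← min_div_div_right h.le, div_self h.ne']

lemma abs_min_sub_min_le (a b c d : ℝ) : |min a b - min c d| ≤ |a - c| + |b - d| :=
  (abs_min_sub_min_le_max a b c d).trans
    (max_le (le_add_of_nonneg_right (abs_nonneg _)) (le_add_of_nonneg_left (abs_nonneg _)))

lemma abs_min_div_sub_min_div_le {N F N' F' : ℝ} (hN : 0 ≤ N) (hF : 0 ≤ F)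
    (hF' : 0 < F') : |min (N / F) 1 - min (N' / F') 1| ≤ (|N - N'| + 2 * |F - F'|) / F' := by
  rw [min_div_one_eq N hF, min_div_one_eq N' hF'.le]
  refine (abs_div_sub_div_le (le_min hN hF) (min_le_right _ _) hF').trans (div_le_div_of_nonneg_right ?_ hF'.le)
  linarith [abs_min_sub_min_le N F N' F']

/-! ### Limits of the estimated weights -/

section limits

/-- The limit of the initial estimate of `T` when the estimated proportion tends to `q`. -/
noncomputable def limT (p : ℝ) (gμ : Measure ℝ) (q : ℝ) (z : ℝ × ℝ) : ℝ :=
  max 0 (min ((1 - q) * f0 z.1 z.2 / fMix p gμ z.1 z.2) 1)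

/-- The weight `1 - limT`. -/
noncomputable def limW (p : ℝ) (gμ : Measure ℝ) (q : ℝ) (z : ℝ × ℝ) : ℝ := 1 - limT p gμ q z

lemma limT_mem (p : ℝ) (gμ : Measure ℝ) (q : ℝ) (z : ℝ × ℝ) :
    limT p gμ q z ∈ Set.Icc (0 : ℝ) 1 :=
  ⟨le_max_left _ _, max_le zero_le_one (min_le_right _ _)⟩

lemma limW_mem (p : ℝ) (gμ : Measure ℝ) (q : ℝ) (z : ℝ × ℝ) :
    limW p gμ q z ∈ Set.Icc (0 : ℝ) 1 := by
  have := limT_mem p gμ q z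
  unfold limW
  constructor <;> linarith [this.1, this.2]

lemma f0_nonneg {s : ℝ} (hs : 0 ≤ s) (x : ℝ) : 0 ≤ f0 s x := phi_nonneg hs x

lemma f0_le {lo s : ℝ} (hlo : 0 < lo) (hs : lo ≤ s) (x : ℝ) : f0 s x ≤ lo⁻¹ :=
  (phi_le (hlo.trans_le hs) x).trans (inv_anti₀ hlo hs)

variable {Ω : Type*} [MeasurableSpace Ω] {P : Measure Ω} [IsProbabilityMeasure P] {p : ℝ}
  {gμ ρ : Measure ℝ} [IsProbabilityMeasure gμ] [IsProbabilityMeasure ρ] {lo hi M : ℝ}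
  {σ X : ℕ → Ω → ℝ} {hx hσ : ℕ → ℝ}

lemma measurable_limT (p : ℝ) (gμ : Measure ℝ) [IsProbabilityMeasure gμ] (q : ℝ) :
    Measurable (limT p gμ q) := by
  have := measurable_fMix (p := p) (gμ := gμ)
  unfold limT f0; fun_prop

lemma measurable_limW (p : ℝ) (gμ : Measure ℝ) [IsProbabilityMeasure gμ] (q : ℝ) :
    Measurable (limW p gμ q) := measurable_const.sub (measurable_limT p gμ q)

lemma IIDData.limT_eq (D : IIDData P p gμ ρ lo hi M σ X) {q s : ℝ} (hq : q ≤ 1)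
    (hs : s ∈ Set.Icc lo hi) (x : ℝ) :
    limT p gμ q (s, x) = min ((1 - q) * f0 s x / fMix p gμ s x) 1 := by
  refine max_eq_right (le_min ?_ zero_le_one)
  exact div_nonneg (mul_nonneg (by linarith) (f0_nonneg (D.lo_pos.le.trans hs.1) x))
    (D.fMix_pos hs x).le

lemma IIDData.fMix_mul_limW (D : IIDData P p gμ ρ lo hi M σ X) {q s : ℝ} (hq : q ≤ 1)
    (hs : s ∈ Set.Icc lo hi) (x : ℝ) :
    fMix p gμ s x * limW p gμ q (s, x) = max (fMix p gμ s x - (1 - q) * f0 s x) 0 := by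
  have hf := D.fMix_pos hs x
  have hN : 0 ≤ (1 - q) * f0 s x :=
    mul_nonneg (by linarith) (f0_nonneg (D.lo_pos.le.trans hs.1) x)
  rw [limW, D.limT_eq hq hs, min_div_one_eq _ hf.le, mul_sub, mul_one, mul_div_cancel₀ _ hf.ne']
  rcases le_total ((1 - q) * f0 s x) (fMix p gμ s x) with h | h
  · rw [min_eq_left h, max_eq_left (by linarith)]
  · rw [min_eq_right h, max_eq_right (by linarith), sub_self]

lemma IIDData.fMix_mul_limW_lipschitz (D : IIDData P p gμ ρ lo hi M σ X) {q : ℝ}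
    (hq : q ∈ Set.Icc (0 : ℝ) 1) :
    ∀ s ∈ Set.Icc lo hi, ∀ t ∈ Set.Icc lo hi, ∀ x y,
      |fMix p gμ s x * limW p gμ q (s, x) - fMix p gμ t y * limW p gμ q (t, y)| ≤
        6 / lo ^ 2 * (|s - t| + |x - y|) := by
  intro s hs t ht x y
  rw [D.fMix_mul_limW hq.2 hs, D.fMix_mul_limW hq.2 ht]
  refine (abs_max_sub_max_le_abs _ _ _).trans ?_
  have h1 := D.abs_fMix_sub_le hs.1 ht.1 x y
  have h2 : |f0 s x - f0 t y| ≤ 3 / lo ^ 2 * (|s - t| + |x - y|) :=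
    abs_phi_sub_phi_le D.lo_pos hs.1 ht.1 x y
  have e : fMix p gμ s x - (1 - q) * f0 s x - (fMix p gμ t y - (1 - q) * f0 t y) =
      (fMix p gμ s x - fMix p gμ t y) - (1 - q) * (f0 s x - f0 t y) := by ring
  rw [e]
  refine (abs_sub _ _).trans ?_
  rw [abs_mul, abs_of_nonneg (by linarith [hq.2] : 0 ≤ 1 - q)]
  have h3 : (1 - q) * |f0 s x - f0 t y| ≤ |f0 s x - f0 t y| :=
    mul_le_of_le_one_left (abs_nonneg _) (by linarith [hq.1])
  have e2 : 6 / lo ^ 2 * (|s - t| + |x - y|) = 3 / lo ^ 2 * (|s - t| + |x - y|) +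
      3 / lo ^ 2 * (|s - t| + |x - y|) := by ring
  linarith

lemma IIDData.fMix_mul_one_lipschitz (D : IIDData P p gμ ρ lo hi M σ X) :
    ∀ s ∈ Set.Icc lo hi, ∀ t ∈ Set.Icc lo hi, ∀ x y,
      |fMix p gμ s x * (1 : ℝ × ℝ → ℝ) (s, x) - fMix p gμ t y * (1 : ℝ × ℝ → ℝ) (t, y)| ≤
        3 / lo ^ 2 * (|s - t| + |x - y|) := by
  intro s hs t ht x y
  simpa using D.abs_fMix_sub_le hs.1 ht.1 x y

lemma IIDData.fMix_mul_limW_self (D : IIDData P p gμ ρ lo hi M σ X) {s : ℝ}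
    (hs : s ∈ Set.Icc lo hi) (x : ℝ) :
    fMix p gμ s x * limW p gμ p (s, x) = p * f1 gμ s x := by
  rw [D.fMix_mul_limW D.p_le_one hs, fMix, add_sub_cancel_left, max_eq_left]
  exact mul_nonneg D.p_pos.le (f1_nonneg (D.lo_pos.le.trans hs.1) _ _)

lemma IIDData.limT_self (D : IIDData P p gμ ρ lo hi M σ X) {s : ℝ} (hs : s ∈ Set.Icc lo hi)
    (x : ℝ) : limT p gμ p (s, x) = oracleT p gμ x s := by
  rw [D.limT_eq D.p_le_one hs, oracleT, min_eq_left]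
  refine div_le_one_of_le₀ ?_ (D.fMix_pos hs x).le
  rw [fMix]
  have := mul_nonneg D.p_pos.le (f1_nonneg (D.lo_pos.le.trans hs.1) x gμ)
  linarith

lemma IIDData.integral_limW_self (D : IIDData P p gμ ρ lo hi M σ X) :
    ∀ t ∈ Set.Icc lo hi, ∫ x, fMix p gμ t x * limW p gμ p (t, x) = p := by
  intro t ht
  simp_rw [D.fMix_mul_limW_self ht]
  rw [integral_const_mul, integral_f1 (D.lo_pos.trans_le ht.1), mul_one]

lemma IIDData.integral_fMix_one (D : IIDData P p gμ ρ lo hi M σ X) :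
    ∀ t ∈ Set.Icc lo hi, ∫ x, fMix p gμ t x * (1 : ℝ × ℝ → ℝ) (t, x) = 1 := by
  intro t ht
  simpa using D.integral_fMix ht.1

end limits

/-! ### Weighted sums of kernels -/

section sums

/-- Numerator of the weighted kernel estimator. -/
noncomputable def sumA (h hx : ℝ) (m : ℕ) (w x s : ℕ → ℝ) (t y : ℝ) : ℝ :=
  ∑ k ∈ Finset.range m, w k * phi h (t - s k) * phi (hx * s k) (y - x k)

/-- Denominator of the weighted kernel estimator. -/
noncomputable def sumS (h : ℝ) (m : ℕ) (w s : ℕ → ℝ) (t : ℝ) : ℝ :=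
  ∑ k ∈ Finset.range m, w k * phi h (t - s k)

lemma weightedKDE_eq (hx h : ℝ) (m : ℕ) (w x s : ℕ → ℝ) (t y : ℝ) :
    weightedKDE hx h m w x s t y = sumA h hx m w x s t y / sumS h m w s t := by
  unfold weightedKDE sumA sumS
  rw [Finset.sum_div]
  exact Finset.sum_congr rfl fun k _ => by ring

lemma avgA_eq (ρ : Measure ℝ) (β : ℝ × ℝ → ℝ) (h hx : ℝ) (m : ℕ) (x s : ℕ → ℝ) (t y : ℝ) :
    avgA ρ β h hx m x s t y =
      (m * kap ρ h t)⁻¹ * sumA h hx m (fun k => β (s k, x k)) x s t y := rfl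

lemma avgS_eq (ρ : Measure ℝ) (β : ℝ × ℝ → ℝ) (h : ℝ) (m : ℕ) (x s : ℕ → ℝ) (t : ℝ) :
    avgS ρ β h m x s t = (m * kap ρ h t)⁻¹ * sumS h m (fun k => β (s k, x k)) s t := rfl

variable {h hx t y : ℝ} {m : ℕ} {w v x s : ℕ → ℝ}

lemma sumA_mono (hh : 0 < h) (hhx : 0 < hx) (hs : ∀ k, 0 < s k) (hwv : ∀ k < m, w k ≤ v k) :
    sumA h hx m w x s t y ≤ sumA h hx m v x s t y := by
  refine Finset.sum_le_sum fun k hk => ?_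
  have h1 := phi_nonneg hh.le (t - s k)
  have h2 := phi_nonneg (mul_pos hhx (hs k)).le (y - x k)
  have := hwv k (Finset.mem_range.1 hk)
  gcongr

lemma sumS_mono (hh : 0 < h) (hwv : ∀ k < m, w k ≤ v k) : sumS h m w s t ≤ sumS h m v s t := by
  refine Finset.sum_le_sum fun k hk => ?_
  have h1 := phi_nonneg hh.le (t - s k)
  have := hwv k (Finset.mem_range.1 hk)
  gcongr

lemma sumA_nonneg (hh : 0 < h) (hhx : 0 < hx) (hs : ∀ k, 0 < s k) (hw : ∀ k < m, 0 ≤ w k) :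
    0 ≤ sumA h hx m w x s t y :=
  Finset.sum_nonneg fun k hk => mul_nonneg (mul_nonneg (hw k (Finset.mem_range.1 hk))
    (phi_nonneg hh.le _)) (phi_nonneg (mul_pos hhx (hs k)).le _)

lemma sumS_nonneg (hh : 0 < h) (hw : ∀ k < m, 0 ≤ w k) : 0 ≤ sumS h m w s t :=
  Finset.sum_nonneg fun k hk => mul_nonneg (hw k (Finset.mem_range.1 hk)) (phi_nonneg hh.le _)

lemma sumA_sub : sumA h hx m (fun k => w k - v k) x s t y =
    sumA h hx m w x s t y - sumA h hx m v x s t y := by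
  unfold sumA
  rw [← Finset.sum_sub_distrib]
  exact Finset.sum_congr rfl fun k _ => by ring

lemma sumS_sub : sumS h m (fun k => w k - v k) s t = sumS h m w s t - sumS h m v s t := by
  unfold sumS
  rw [← Finset.sum_sub_distrib]
  exact Finset.sum_congr rfl fun k _ => by ring

lemma sumA_comb (ε : ℝ) : sumA h hx m (fun k => ε * w k + v k) x s t y =
    ε * sumA h hx m w x s t y + sumA h hx m v x s t y := by
  unfold sumA
  rw [Finset.mul_sum, ← Finset.sum_add_distrib]
  exact Finset.sum_congr rfl fun k _ => by ring

lemma sumS_comb (ε : ℝ) : sumS h m (fun k => ε * w k + v k) s t =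
    ε * sumS h m w s t + sumS h m v s t := by
  unfold sumS
  rw [Finset.mul_sum, ← Finset.sum_add_distrib]
  exact Finset.sum_congr rfl fun k _ => by ring

lemma abs_sumA_le (hh : 0 < h) (hhx : 0 < hx) (hs : ∀ k, 0 < s k) :
    |sumA h hx m w x s t y| ≤ sumA h hx m (fun k => |w k|) x s t y := by
  refine (Finset.abs_sum_le_sum_abs _ _).trans (Finset.sum_le_sum fun k _ => ?_)
  rw [abs_mul, abs_mul, abs_of_nonneg (phi_nonneg hh.le _),
    abs_of_nonneg (phi_nonneg (mul_pos hhx (hs k)).le _)]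

lemma abs_sumS_le (hh : 0 < h) : |sumS h m w s t| ≤ sumS h m (fun k => |w k|) s t := by
  refine (Finset.abs_sum_le_sum_abs _ _).trans (Finset.sum_le_sum fun k _ => ?_)
  rw [abs_mul, abs_of_nonneg (phi_nonneg hh.le _)]

lemma weightedKDE_nonneg (hh : 0 < h) (hhx : 0 < hx) (hs : ∀ k, 0 < s k) (hw : ∀ k < m, 0 ≤ w k) :
    0 ≤ weightedKDE hx h m w x s t y := by
  rw [weightedKDE_eq]
  exact div_nonneg (sumA_nonneg hh hhx hs hw) (sumS_nonneg hh hw)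

/-- The estimator as a quotient of normalised sums. -/
lemma weightedKDE_eq_div {c : ℝ} (hc : c ≠ 0) :
    weightedKDE hx h m w x s t y =
      (c⁻¹ * sumA h hx m w x s t y) / (c⁻¹ * sumS h m w s t) := by
  rw [weightedKDE_eq, mul_div_mul_left _ _ (inv_ne_zero hc)]

end sums

/-! ### Bounds for the estimated statistics -/

section stats

variable {h hx q : ℝ} {m : ℕ} {x s : ℕ → ℝ}

lemma plugInT_mem {σ t a : ℝ} (hq : q ∈ Set.Icc (0 : ℝ) 1) (hσ : 0 < σ) (ha : 0 ≤ a) :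
    plugInT q σ t a ∈ Set.Icc (0 : ℝ) 1 := by
  have h1 : 0 ≤ (1 - q) * f0 σ t := mul_nonneg (by linarith [hq.2]) (f0_nonneg hσ.le t)
  have h2 : 0 ≤ q * a := mul_nonneg hq.1 ha
  exact ⟨div_nonneg h1 (by linarith), div_le_one_of_le₀ (by linarith) (by linarith)⟩

lemma fStar_nonneg (hh : 0 < h) (hhx : 0 < hx) (hs : ∀ k, 0 < s k) (t y : ℝ) :
    0 ≤ fStar hx h m x s t y := weightedKDE_nonneg hh hhx hs fun _ _ => zero_le_one

lemma T0_mem (hh : 0 < h) (hhx : 0 < hx) (hs : ∀ k, 0 < s k) (hq : q ∈ Set.Icc (0 : ℝ) 1) (j : ℕ) :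
    T0 hx h q m x s j ∈ Set.Icc (0 : ℝ) 1 := by
  refine ⟨le_min (div_nonneg ?_ (fStar_nonneg hh hhx hs _ _)) zero_le_one, min_le_right _ _⟩
  exact mul_nonneg (by linarith [hq.2]) (f0_nonneg (hs j).le _)

lemma f1Hat0_nonneg (hh : 0 < h) (hhx : 0 < hx) (hs : ∀ k, 0 < s k) (hq : q ∈ Set.Icc (0 : ℝ) 1)
    (t y : ℝ) : 0 ≤ f1Hat0 hx h q m x s t y :=
  weightedKDE_nonneg hh hhx hs fun k _ => sub_nonneg.2 (T0_mem hh hhx hs hq k).2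

lemma T1_mem (hh : 0 < h) (hhx : 0 < hx) (hs : ∀ k, 0 < s k) (hq : q ∈ Set.Icc (0 : ℝ) 1) (j : ℕ) :
    T1 hx h q m x s j ∈ Set.Icc (0 : ℝ) 1 :=
  plugInT_mem hq (hs j) (f1Hat0_nonneg hh hhx hs hq _ _)

lemma f1Hat1_nonneg (hh : 0 < h) (hhx : 0 < hx) (hs : ∀ k, 0 < s k) (hq : q ∈ Set.Icc (0 : ℝ) 1)
    (t y : ℝ) : 0 ≤ f1Hat1 hx h q m x s t y :=
  weightedKDE_nonneg hh hhx hs fun k _ => sub_nonneg.2 (T1_mem hh hhx hs hq k).2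

lemma abs_plugInT_sub_oracleT_le {p lo σ t a : ℝ} {gμ : Measure ℝ} [IsProbabilityMeasure gμ]
    (hlo : 0 < lo) (hσ : lo ≤ σ) (hq : q ∈ Set.Icc (0 : ℝ) 1) (ha : 0 ≤ a)
    (hf : 0 < fMix p gμ σ t) :
    |plugInT q σ t a - oracleT p gμ t σ| ≤
      (3 * lo⁻¹ * |q - p| + |a - f1 gμ σ t|) / fMix p gμ σ t := by
  have hσ0 := hlo.trans_le hσ
  have h1 : 0 ≤ (1 - q) * f0 σ t := mul_nonneg (by linarith [hq.2]) (f0_nonneg hσ0.le t)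
  have h2 : 0 ≤ q * a := mul_nonneg hq.1 ha
  refine (abs_div_sub_div_le h1 (by linarith) hf).trans (div_le_div_of_nonneg_right ?_ hf.le)
  have a1 := f0_le hlo hσ t
  have a2 := f1_le_of_le (G := gμ) hlo hσ t
  have a3 := f0_nonneg hσ0.le t
  have a4 := f1_nonneg hσ0.le t gμ
  have e1 : (1 - q) * f0 σ t - (1 - p) * f0 σ t = -((q - p) * f0 σ t) := by ring
  have e2 : (1 - q) * f0 σ t + q * a - fMix p gμ σ t =
      -((q - p) * f0 σ t) + ((q - p) * f1 gμ σ t + q * (a - f1 gμ σ t)) := by rw [fMix]; ring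
  have b1 : |-((q - p) * f0 σ t)| ≤ |q - p| * lo⁻¹ := by
    rw [abs_neg, abs_mul, abs_of_nonneg a3]; gcongr
  have b2 : |(q - p) * f1 gμ σ t| ≤ |q - p| * lo⁻¹ := by
    rw [abs_mul, abs_of_nonneg a4]; gcongr
  have b3 : |q * (a - f1 gμ σ t)| ≤ |a - f1 gμ σ t| := by
    rw [abs_mul, abs_of_nonneg hq.1]; exact mul_le_of_le_one_left (abs_nonneg _) hq.2
  rw [e1, e2]
  have c1 := abs_add_le (-((q - p) * f0 σ t)) ((q - p) * f1 gμ σ t + q * (a - f1 gμ σ t))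
  have c2 := abs_add_le ((q - p) * f1 gμ σ t) (q * (a - f1 gμ σ t))
  linarith

end stats

/-! ### Consistency of the estimated statistics -/

section consistency

variable {Ω : Type*} [MeasurableSpace Ω] {P : Measure Ω} [IsProbabilityMeasure P] {p : ℝ}
  {gμ ρ : Measure ℝ} [IsProbabilityMeasure gμ] [IsProbabilityMeasure ρ] {lo hi M : ℝ}
  {σ X : ℕ → Ω → ℝ} {hx hσ : ℕ → ℝ}

lemma one_mem_Icc (z : ℝ × ℝ) : (1 : ℝ × ℝ → ℝ) z ∈ Set.Icc (0 : ℝ) 1 := by simp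

/-- Consistency of the initial estimates of `T`, uniformly in the estimated proportion. -/
lemma IIDData.likely_T0 (D : IIDData P p gμ ρ lo hi M σ X) (B : BandwidthCondition hx hσ)
    {θ R ε : ℝ} (hθ : 0 < θ) (hε : 0 < ε) :
    Likely P (fun m => m) fun m ω => ∀ i < m, θ ≤ kap ρ (hσ m) (σ i ω) → |X i ω| ≤ R →
      ∀ q' ∈ Set.Icc (0 : ℝ) 1, ∀ q ∈ Set.Icc (0 : ℝ) 1,
      |T0 (hx m) (hσ m) q' m (fun j => X j ω) (fun j => σ j ω) i - limT p gμ q (σ i ω, X i ω)| ≤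
        lo⁻¹ / lowC lo hi M R * |q' - q| + ε := by
  have hlo := D.lo_pos
  have hl := lowC_pos D.lo_pos D.lo_le_hi M R
  set l := lowC lo hi M R with hl_def
  set e := min (1 / 2) (ε * l / (4 * (1 + lo⁻¹))) with he
  have he0 : 0 < e := by positivity
  have he1 : e ≤ 1 / 2 := min_le_left _ _
  have he2 : 4 * e * (1 + lo⁻¹) ≤ ε * l := by
    have : e ≤ ε * l / (4 * (1 + lo⁻¹)) := min_le_right _ _
    rw [le_div_iff₀ (by positivity)] at this
    linarith
  refine ((D.likely_avgA B measurable_one one_mem_Icc (by positivity) D.fMix_mul_one_lipschitz hθ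
    he0).and (D.likely_avgS B measurable_one one_mem_Icc D.integral_fMix_one hθ he0)).mono ?_
  filter_upwards [eventually_gt_atTop 0] with m hm
  filter_upwards [D.ae_all_mem] with ω hω h i hi hk hX q' hq' q hq
  have hm' : (0 : ℝ) < m := by exact_mod_cast hm
  have hk0 : 0 < kap ρ (hσ m) (σ i ω) := hθ.trans_le hk
  have hpos : ∀ k, 0 < σ k ω := fun k => hlo.trans_le (hω k).1
  have hf := D.fMix_pos (hω i) (X i ω)
  have hfl := D.lowC_le_fMix (hω i) hX
  have hfu := D.fMix_le (hω i).1 (X i ω)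
  have h1 := (h.1 i hi hk).le
  have h2 := (h.2 i hi hk).le
  simp only [Pi.one_apply, mul_one] at h1
  have hst : |fStar (hx m) (hσ m) m (fun j => X j ω) (fun j => σ j ω) (σ i ω) (X i ω) -
      fMix p gμ (σ i ω) (X i ω)| ≤ 2 * e * (1 + lo⁻¹) := by
    have := abs_div_sub_le h1 h2 one_pos he1 (U := lo⁻¹)
      (by rw [div_one, abs_of_pos hf]; exact hfu)
    rw [div_one, div_one] at this
    rw [fStar, weightedKDE_eq_div (c := m * kap ρ (hσ m) (σ i ω)) (by positivity)]
    exact this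
  rw [D.limT_eq hq.2 (hω i), T0]
  refine (abs_min_div_sub_min_div_le (mul_nonneg (by linarith [hq'.2]) (f0_nonneg (hpos i).le _))
    (fStar_nonneg (B.hσ_pos m) (B.hx_pos m) hpos _ _)
    hf).trans ?_
  have e1 : (1 - q') * f0 (σ i ω) (X i ω) - (1 - q) * f0 (σ i ω) (X i ω) =
      -((q' - q) * f0 (σ i ω) (X i ω)) := by ring
  have b1 : |(1 - q') * f0 (σ i ω) (X i ω) - (1 - q) * f0 (σ i ω) (X i ω)| ≤ lo⁻¹ * |q' - q| := by
    rw [e1, abs_neg, abs_mul, abs_of_nonneg (f0_nonneg (hpos i).le _), mul_comm]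
    exact mul_le_mul_of_nonneg_right (f0_le hlo (hω i).1 _) (abs_nonneg _)
  calc _ ≤ (lo⁻¹ * |q' - q| + 2 * (2 * e * (1 + lo⁻¹))) / l := by gcongr
    _ ≤ (lo⁻¹ * |q' - q| + ε * l) / l := div_le_div_of_nonneg_right (by linarith) hl.le
    _ = _ := by field_simp

/-- The estimates `T` of the statistics are consistent, with limit `limT p gμ q`, at observations
that are neither isolated nor large. -/
def ConsistentT (P : Measure Ω) (p : ℝ) (gμ ρ : Measure ℝ) (σ X : ℕ → Ω → ℝ) (hσ : ℕ → ℝ)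
    (r : ℕ → ENNReal) (q : ℝ) (T : ℕ → Ω → ℕ → ℝ) : Prop :=
  ∀ θ R ε : ℝ, 0 < θ → 0 < R → 0 < ε → Likely P r fun m ω => ∀ i < m,
    θ ≤ kap ρ (hσ m) (σ i ω) → |X i ω| ≤ R → |T m ω i - limT p gμ q (σ i ω, X i ω)| ≤ ε

lemma abs_sub_limT_le_bad {h θ R ε q T s x : ℝ} (hT : T ∈ Set.Icc (0 : ℝ) 1) (hε : 0 ≤ ε)
    (hgood : θ ≤ kap ρ h s → |x| ≤ R → |T - limT p gμ q (s, x)| ≤ ε) :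
    |T - limT p gμ q (s, x)| ≤ ε * 1 + badW ρ h θ R (s, x) := by
  have h0 := badW_mem ρ h θ R (s, x)
  by_cases hb : kap ρ h s < θ ∨ R < |x|
  · have : badW ρ h θ R (s, x) = 1 := by
      unfold badW; rw [Set.indicator_of_mem (by exact hb)]; rfl
    rw [this, abs_le]
    have h1 := limT_mem p gμ q (s, x)
    constructor <;> linarith [hT.1, hT.2, h1.1, h1.2]
  · rw [not_or, not_lt, not_lt] at hb
    linarith [hgood hb.1 hb.2, h0.1]

variable {r : ℕ → ENNReal} {q : ℝ} {T : ℕ → Ω → ℕ → ℝ}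

/-- Normalised sums with consistent weights are close to those with the limiting weights. -/
lemma IIDData.likely_sum_sub (D : IIDData P p gμ ρ lo hi M σ X) (B : BandwidthCondition hx hσ)
    (hr : ∀ᶠ m in atTop, r m ≤ m) (hT : ConsistentT P p gμ ρ σ X hσ r q T)
    (hT1 : ∀ m, ∀ᵐ ω ∂P, ∀ i, T m ω i ∈ Set.Icc (0 : ℝ) 1) {θ ε : ℝ} (hθ : 0 < θ) (hε : 0 < ε) :
    Likely P r fun m ω => ∀ i < m, θ ≤ kap ρ (hσ m) (σ i ω) →
      |(m * kap ρ (hσ m) (σ i ω))⁻¹ * sumA (hσ m) (hx m) m (fun k => 1 - T m ω k) (fun j => X j ω)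
          (fun j => σ j ω) (σ i ω) (X i ω) -
        avgA ρ (limW p gμ q) (hσ m) (hx m) m (fun j => X j ω) (fun j => σ j ω) (σ i ω) (X i ω)|
          ≤ ε ∧
      |(m * kap ρ (hσ m) (σ i ω))⁻¹ * sumS (hσ m) m (fun k => 1 - T m ω k) (fun j => σ j ω)
          (σ i ω) -
        avgS ρ (limW p gμ q) (hσ m) m (fun j => X j ω) (fun j => σ j ω) (σ i ω)| ≤ ε := by
  have hlo := D.lo_pos
  obtain ⟨θ', R, hθ', hR, hbad, -⟩ := D.exists_likely_bad B hθ (half_pos hε)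
  set e := ε / (2 * (2 + lo⁻¹)) with he
  have he0 : 0 < e := by positivity
  have hee : e * (2 + lo⁻¹) = ε / 2 := by rw [he]; field_simp
  have L1 := (D.likely_avgA B measurable_one one_mem_Icc (by positivity) D.fMix_mul_one_lipschitz
    hθ one_pos).of_le hr
  have L2 := (D.likely_avgS B measurable_one one_mem_Icc D.integral_fMix_one hθ one_pos).of_le hr
  refine (((hT θ' R e hθ' hR he0).and (hbad.of_le hr)).and (L1.and L2)).mono ?_
  filter_upwards [eventually_gt_atTop 0] with m hm
  filter_upwards [D.ae_all_mem, hT1 m] with ω hω hT1ω h i hi hk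
  obtain ⟨⟨hg, hb⟩, hA, hS⟩ := h
  replace hA := hA i hi hk
  replace hS := hS i hi hk
  obtain ⟨hbA, hbS⟩ := hb i hi hk
  have hm' : (0 : ℝ) < m := by exact_mod_cast hm
  have hk0 : 0 < kap ρ (hσ m) (σ i ω) := hθ.trans_le hk
  have hpos : ∀ k, 0 < σ k ω := fun k => hlo.trans_le (hω k).1
  have hc : 0 < (m * kap ρ (hσ m) (σ i ω))⁻¹ := by positivity
  have hw : ∀ k < m, |1 - T m ω k - limW p gμ q (σ k ω, X k ω)| ≤
      e * (1 : ℝ × ℝ → ℝ) (σ k ω, X k ω) + badW ρ (hσ m) θ' R (σ k ω, X k ω) := by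
    intro k hk'
    have e1 : 1 - T m ω k - limW p gμ q (σ k ω, X k ω) =
        -(T m ω k - limT p gμ q (σ k ω, X k ω)) := by rw [limW]; ring
    rw [e1, abs_neg]
    exact abs_sub_limT_le_bad (hT1ω k) he0.le (hg k hk')
  have hfu := D.fMix_le (hω i).1 (X i ω)
  simp only [Pi.one_apply, mul_one] at hA
  have hA' := (abs_lt.1 hA).2
  have hS' := (abs_lt.1 hS).2
  constructor
  · rw [avgA_eq, ← mul_sub, ← sumA_sub, abs_mul, abs_of_pos hc]
    calc _ ≤ (m * kap ρ (hσ m) (σ i ω))⁻¹ * (e * sumA (hσ m) (hx m) m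
            (fun k => (1 : ℝ × ℝ → ℝ) (σ k ω, X k ω)) (fun j => X j ω) (fun j => σ j ω)
              (σ i ω) (X i ω) +
            sumA (hσ m) (hx m) m (fun k => badW ρ (hσ m) θ' R (σ k ω, X k ω)) (fun j => X j ω)
              (fun j => σ j ω) (σ i ω) (X i ω)) := by
          gcongr
          rw [← sumA_comb]
          exact (abs_sumA_le (B.hσ_pos m) (B.hx_pos m) hpos).trans
            (sumA_mono (B.hσ_pos m) (B.hx_pos m) hpos hw)
      _ = e * avgA ρ 1 (hσ m) (hx m) m (fun j => X j ω) (fun j => σ j ω) (σ i ω) (X i ω) +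
          avgA ρ (badW ρ (hσ m) θ' R) (hσ m) (hx m) m (fun j => X j ω) (fun j => σ j ω) (σ i ω)
            (X i ω) := by rw [avgA_eq, avgA_eq]; ring
      _ ≤ e * (2 + lo⁻¹) + ε / 2 := by gcongr; linarith
      _ = ε := by rw [hee]; ring
  · rw [avgS_eq, ← mul_sub, ← sumS_sub, abs_mul, abs_of_pos hc]
    calc _ ≤ (m * kap ρ (hσ m) (σ i ω))⁻¹ * (e * sumS (hσ m) m
            (fun k => (1 : ℝ × ℝ → ℝ) (σ k ω, X k ω)) (fun j => σ j ω) (σ i ω) +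
            sumS (hσ m) m (fun k => badW ρ (hσ m) θ' R (σ k ω, X k ω)) (fun j => σ j ω)
              (σ i ω)) := by
          gcongr
          rw [← sumS_comb]
          exact (abs_sumS_le (B.hσ_pos m)).trans (sumS_mono (B.hσ_pos m) hw)
      _ = e * avgS ρ 1 (hσ m) m (fun j => X j ω) (fun j => σ j ω) (σ i ω) +
          avgS ρ (badW ρ (hσ m) θ' R) (hσ m) m (fun j => X j ω) (fun j => σ j ω) (σ i ω) := by
          rw [avgS_eq, avgS_eq]; ring
      _ ≤ e * (2 + lo⁻¹) + ε / 2 := by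
          gcongr
          have : 0 < lo⁻¹ := by positivity
          linarith
      _ = ε := by rw [hee]; ring

/-- At a fixed scale, the total weight carried by the estimation errors is small. -/
lemma IIDData.likely_sumS_abs_fixed (D : IIDData P p gμ ρ lo hi M σ X)
    (B : BandwidthCondition hx hσ) (hr : ∀ᶠ m in atTop, r m ≤ m)
    (hT : ConsistentT P p gμ ρ σ X hσ r q T)
    (hT1 : ∀ m, ∀ᵐ ω ∂P, ∀ i, T m ω i ∈ Set.Icc (0 : ℝ) 1) {θ ε : ℝ} (hθ : 0 < θ) (hε : 0 < ε)
    {σ₀ : ℝ} (h₀ : ∀ᶠ m in atTop, θ ≤ kap ρ (hσ m) σ₀) :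
    Likely P r fun m ω => (m * kap ρ (hσ m) σ₀)⁻¹ * sumS (hσ m) m
      (fun k => |1 - T m ω k - limW p gμ q (σ k ω, X k ω)|) (fun j => σ j ω) σ₀ ≤ ε := by
  obtain ⟨θ', R, hθ', hR, -, hbad⟩ := D.exists_likely_bad B hθ (half_pos hε)
  have L2 := (D.likely_avgS_fixed B measurable_one one_mem_Icc D.integral_fMix_one hθ one_pos
    h₀).of_le hr
  refine (((hT θ' R (ε / 4) hθ' hR (by positivity)).and ((hbad σ₀ h₀).of_le hr)).and L2).mono ?_
  filter_upwards [eventually_gt_atTop 0, h₀] with m hm hk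
  filter_upwards [hT1 m] with ω hT1ω h
  obtain ⟨⟨hg, hb⟩, hS⟩ := h
  have hm' : (0 : ℝ) < m := by exact_mod_cast hm
  have hk0 : 0 < kap ρ (hσ m) σ₀ := hθ.trans_le hk
  have hc : 0 < (m * kap ρ (hσ m) σ₀)⁻¹ := by positivity
  have hw : ∀ k < m, |1 - T m ω k - limW p gμ q (σ k ω, X k ω)| ≤
      ε / 4 * (1 : ℝ × ℝ → ℝ) (σ k ω, X k ω) + badW ρ (hσ m) θ' R (σ k ω, X k ω) := by
    intro k hk'
    have e1 : 1 - T m ω k - limW p gμ q (σ k ω, X k ω) =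
        -(T m ω k - limT p gμ q (σ k ω, X k ω)) := by rw [limW]; ring
    rw [e1, abs_neg]
    exact abs_sub_limT_le_bad (hT1ω k) (by positivity) (hg k hk')
  have hS' := (abs_lt.1 hS).2
  calc _ ≤ (m * kap ρ (hσ m) σ₀)⁻¹ * (ε / 4 * sumS (hσ m) m
          (fun k => (1 : ℝ × ℝ → ℝ) (σ k ω, X k ω)) (fun j => σ j ω) σ₀ +
          sumS (hσ m) m (fun k => badW ρ (hσ m) θ' R (σ k ω, X k ω)) (fun j => σ j ω) σ₀) := by
        gcongr
        rw [← sumS_comb]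
        exact sumS_mono (B.hσ_pos m) hw
    _ = ε / 4 * avgS ρ 1 (hσ m) m (fun j => X j ω) (fun j => σ j ω) σ₀ +
        avgS ρ (badW ρ (hσ m) θ' R) (hσ m) m (fun j => X j ω) (fun j => σ j ω) σ₀ := by
        rw [avgS_eq, avgS_eq]; ring
    _ ≤ ε / 4 * 2 + ε / 2 := by gcongr; linarith
    _ = ε := by ring

/-- One step of the iteration preserves consistency. -/
lemma IIDData.consistentT_step (D : IIDData P p gμ ρ lo hi M σ X) (B : BandwidthCondition hx hσ)
    (hT : ConsistentT P p gμ ρ σ X hσ 1 p T)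
    (hT1 : ∀ m, ∀ᵐ ω ∂P, ∀ i, T m ω i ∈ Set.Icc (0 : ℝ) 1) {pHat : ℕ → Ω → ℝ}
    (hpHat_mem : ∀ m, ∀ᵐ ω ∂P, pHat m ω ∈ Set.Icc (0 : ℝ) 1)
    (hpHat : ∀ η : ℝ, 0 < η → Likely P 1 fun m ω => |pHat m ω - p| ≤ η) :
    ConsistentT P p gμ ρ σ X hσ 1 p fun m ω i => plugInT (pHat m ω) (σ i ω) (X i ω)
      (weightedKDE (hx m) (hσ m) m (fun k => 1 - T m ω k) (fun j => X j ω) (fun j => σ j ω)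
        (σ i ω) (X i ω)) := by
  intro θ R ε hθ hR hε
  have hlo := D.lo_pos
  have hp := D.p_pos
  have hl := lowC_pos D.lo_pos D.lo_le_hi M R
  set l := lowC lo hi M R with hl_def
  set η := ε * l / (6 * lo⁻¹) with hη
  have hη0 : 0 < η := by positivity
  set e := min (p / 4) (ε * l * p / (8 * (1 + lo⁻¹))) with he
  have he0 : 0 < e := by positivity
  have he1 : e ≤ p / 4 := min_le_left _ _
  have he2 : 8 * e * (1 + lo⁻¹) ≤ ε * l * p := by
    have : e ≤ ε * l * p / (8 * (1 + lo⁻¹)) := min_le_right _ _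
    rw [le_div_iff₀ (by positivity)] at this
    linarith
  have hpm : p ∈ Set.Icc (0 : ℝ) 1 := ⟨D.p_pos.le, D.p_le_one⟩
  have L1 := (D.likely_avgA B (measurable_limW p gμ p) (limW_mem p gμ p) (by positivity)
    (D.fMix_mul_limW_lipschitz hpm) hθ he0).of_le eventually_one_le_natCast
  have L2 := (D.likely_avgS B (measurable_limW p gμ p) (limW_mem p gμ p) D.integral_limW_self hθ
    he0).of_le eventually_one_le_natCast
  refine (((D.likely_sum_sub B eventually_one_le_natCast hT hT1 hθ he0).and (L1.and L2)).and
    (hpHat η hη0)).mono ?_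
  filter_upwards [eventually_gt_atTop 0] with m hm
  filter_upwards [D.ae_all_mem, hT1 m, hpHat_mem m] with ω hω hT1ω hq h i hi hk hX
  obtain ⟨⟨h1, h2, h3⟩, h4⟩ := h
  obtain ⟨h1a, h1b⟩ := h1 i hi hk
  replace h2 := h2 i hi hk
  replace h3 := h3 i hi hk
  have hm' : (0 : ℝ) < m := by exact_mod_cast hm
  have hk0 : 0 < kap ρ (hσ m) (σ i ω) := hθ.trans_le hk
  have hpos : ∀ k, 0 < σ k ω := fun k => hlo.trans_le (hω k).1
  have hf := D.fMix_pos (hω i) (X i ω)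
  have hfl := D.lowC_le_fMix (hω i) hX
  have hf1 := f1_nonneg (hpos i).le (X i ω) gμ
  have hf1u := f1_le_of_le (G := gμ) hlo (hω i).1 (X i ω)
  rw [D.fMix_mul_limW_self (hω i)] at h2
  rw [D.limT_self (hω i)]
  set a := weightedKDE (hx m) (hσ m) m (fun k => 1 - T m ω k) (fun j => X j ω) (fun j => σ j ω)
        (σ i ω) (X i ω) with ha
  have ha0 : 0 ≤ a := weightedKDE_nonneg (B.hσ_pos m) (B.hx_pos m) hpos
    fun k _ => sub_nonneg.2 (hT1ω k).2
  have hdiff : |a - f1 gμ (σ i ω) (X i ω)| ≤ 4 * e * (1 + lo⁻¹) / p := by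
    have n1 := (abs_sub_le _ _ _).trans (add_le_add h1a h2.le)
    have n2 := (abs_sub_le _ _ _).trans (add_le_add h1b h3.le)
    have e1 : p * f1 gμ (σ i ω) (X i ω) / p = f1 gμ (σ i ω) (X i ω) := by field_simp
    have := abs_div_sub_le n1 n2 D.p_pos (by linarith) (U := lo⁻¹)
      (by rw [e1, abs_of_nonneg hf1]; exact hf1u)
    rw [e1] at this
    rw [ha, weightedKDE_eq_div (c := m * kap ρ (hσ m) (σ i ω)) (by positivity)]
    refine this.trans (le_of_eq ?_)
    ring
  refine (abs_plugInT_sub_oracleT_le hlo (hω i).1 hq ha0 hf).trans ?_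
  have b1 : 3 * lo⁻¹ * |pHat m ω - p| ≤ ε * l / 2 := by
    calc 3 * lo⁻¹ * |pHat m ω - p| ≤ 3 * lo⁻¹ * η := by gcongr
      _ = ε * l / 2 := by rw [hη]; field_simp; ring
  have b2 : 4 * e * (1 + lo⁻¹) / p ≤ ε * l / 2 := by
    rw [div_le_iff₀ hp]; linarith
  calc _ ≤ (ε * l / 2 + ε * l / 2) / l := by gcongr; linarith
    _ = ε := by field_simp; norm_num

end consistency

section uniform

variable {Ω : Type*} [MeasurableSpace Ω] {P : Measure Ω} [IsProbabilityMeasure P] {p : ℝ}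
  {gμ ρ : Measure ℝ} [IsProbabilityMeasure gμ] [IsProbabilityMeasure ρ] {lo hi M : ℝ}
  {σ X : ℕ → Ω → ℝ} {hx hσ : ℕ → ℝ} {pHat : ℕ → Ω → ℝ}

lemma likely_of_tendstoInMeasure (h : TendstoInMeasure P pHat atTop fun _ => p) {η : ℝ}
    (hη : 0 < η) : Likely P 1 fun m ω => |pHat m ω - p| ≤ η := by
  have h1 := h (ENNReal.ofReal η) (by simpa using hη)
  refine tendsto_of_tendsto_of_tendsto_of_le_of_le tendsto_const_nhds h1 (fun _ => zero_le)
    fun m => ?_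
  simp only [Pi.one_apply, one_mul]
  refine measure_mono fun ω hω => ?_
  simp only [Set.mem_ofPred_eq, not_le] at hω ⊢
  rw [edist_dist, Real.dist_eq]
  exact ENNReal.ofReal_le_ofReal hω.le

lemma IIDData.consistentT_T0 (D : IIDData P p gμ ρ lo hi M σ X) (B : BandwidthCondition hx hσ)
    (hpHat_mem : ∀ m, ∀ᵐ ω ∂P, pHat m ω ∈ Set.Icc (0 : ℝ) 1)
    (hpHat : ∀ η : ℝ, 0 < η → Likely P 1 fun m ω => |pHat m ω - p| ≤ η) :
    ConsistentT P p gμ ρ σ X hσ 1 p fun m ω i =>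
      T0 (hx m) (hσ m) (pHat m ω) m (fun j => X j ω) (fun j => σ j ω) i := by
  intro θ R ε hθ hR hε
  have hlo := D.lo_pos
  have hl := lowC_pos D.lo_pos D.lo_le_hi M R
  set c := lo⁻¹ / lowC lo hi M R with hc
  have hc0 : 0 < c := by positivity
  refine (((D.likely_T0 B (R := R) hθ (half_pos hε)).of_le eventually_one_le_natCast).and
    (hpHat (ε / (2 * c)) (by positivity))).mono (Eventually.of_forall fun m => ?_)
  filter_upwards [hpHat_mem m] with ω hq h i hi hk hX
  refine (h.1 i hi hk hX _ hq p ⟨D.p_pos.le, D.p_le_one⟩).trans ?_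
  calc c * |pHat m ω - p| + ε / 2 ≤ c * (ε / (2 * c)) + ε / 2 := by
        gcongr; exact h.2
    _ = ε := by field_simp; norm_num

lemma IIDData.ae_T0_mem (D : IIDData P p gμ ρ lo hi M σ X) (B : BandwidthCondition hx hσ)
    (hpHat_mem : ∀ m, ∀ᵐ ω ∂P, pHat m ω ∈ Set.Icc (0 : ℝ) 1) (m : ℕ) :
    ∀ᵐ ω ∂P, ∀ i, T0 (hx m) (hσ m) (pHat m ω) m (fun j => X j ω) (fun j => σ j ω) i ∈
      Set.Icc (0 : ℝ) 1 := by
  filter_upwards [D.ae_all_mem, hpHat_mem m] with ω hω hq i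
  exact T0_mem (B.hσ_pos m) (B.hx_pos m) (fun k => D.lo_pos.trans_le (hω k).1) hq i

lemma IIDData.ae_T1_mem (D : IIDData P p gμ ρ lo hi M σ X) (B : BandwidthCondition hx hσ)
    (hpHat_mem : ∀ m, ∀ᵐ ω ∂P, pHat m ω ∈ Set.Icc (0 : ℝ) 1) (m : ℕ) :
    ∀ᵐ ω ∂P, ∀ i, T1 (hx m) (hσ m) (pHat m ω) m (fun j => X j ω) (fun j => σ j ω) i ∈
      Set.Icc (0 : ℝ) 1 := by
  filter_upwards [D.ae_all_mem, hpHat_mem m] with ω hω hq i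
  exact T1_mem (B.hσ_pos m) (B.hx_pos m) (fun k => D.lo_pos.trans_le (hω k).1) hq i

lemma IIDData.consistentT_T1 (D : IIDData P p gμ ρ lo hi M σ X) (B : BandwidthCondition hx hσ)
    (hpHat_mem : ∀ m, ∀ᵐ ω ∂P, pHat m ω ∈ Set.Icc (0 : ℝ) 1)
    (hpHat : ∀ η : ℝ, 0 < η → Likely P 1 fun m ω => |pHat m ω - p| ≤ η) :
    ConsistentT P p gμ ρ σ X hσ 1 p fun m ω i =>
      T1 (hx m) (hσ m) (pHat m ω) m (fun j => X j ω) (fun j => σ j ω) i :=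
  D.consistentT_step B (D.consistentT_T0 B hpHat_mem hpHat) (D.ae_T0_mem B hpHat_mem)
    hpHat_mem hpHat

lemma IIDData.consistentT_THat (D : IIDData P p gμ ρ lo hi M σ X) (B : BandwidthCondition hx hσ)
    (hpHat_mem : ∀ m, ∀ᵐ ω ∂P, pHat m ω ∈ Set.Icc (0 : ℝ) 1)
    (hpHat : ∀ η : ℝ, 0 < η → Likely P 1 fun m ω => |pHat m ω - p| ≤ η) :
    ConsistentT P p gμ ρ σ X hσ 1 p fun m ω i =>
      THat (hx m) (hσ m) (pHat m ω) m (fun j => X j ω) (fun j => σ j ω) i :=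
  D.consistentT_step B (D.consistentT_T1 B hpHat_mem hpHat) (D.ae_T1_mem B hpHat_mem)
    hpHat_mem hpHat

lemma IIDData.measure_kap_lt_le (D : IIDData P p gμ ρ lo hi M σ X) (i : ℕ) {h θ : ℝ} (hh : 0 < h)
    (hh1 : h ≤ 1) (hθ : 0 ≤ θ) :
    P {ω | kap ρ h (σ i ω) < θ} ≤ ENNReal.ofReal (massC * (hi - lo + 2) * θ) := by
  have hm : MeasurableSet {z : ℝ × ℝ | kap ρ h z.1 < θ} :=
    measurable_fst (measurableSet_kap_lt ρ h θ)
  have e : P {ω | kap ρ h (σ i ω) < θ} = dataLaw p gμ ρ {z | kap ρ h z.1 < θ} := by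
    rw [← D.law i, Measure.map_apply (D.measurable_data i) hm]; rfl
  refine le_trans (le_of_eq ?_) (HART.measure_kap_lt_le D.ρ_ae hh hh1 hθ)
  rw [e, ← lintegral_indicator_one hm, lintegral_dataLaw (measurable_one.indicator hm),
    ← lintegral_indicator_one (measurableSet_kap_lt ρ h θ)]
  have hG := D.isProb
  refine lintegral_congr_ae (D.ρ_ae.mono fun s hs => ?_)
  have : ∀ x, {z : ℝ × ℝ | kap ρ h z.1 < θ}.indicator (1 : ℝ × ℝ → ENNReal) (s, x) =
      {s | kap ρ h s < θ}.indicator 1 s := fun x => rfl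
  simp_rw [this, D.fMix_eq hs.1]
  have hmf : Measurable fun x => ENNReal.ofReal (f1 (meanPrior p gμ) s x) :=
    ((measurable_f1 _).comp measurable_prodMk_left).ennreal_ofReal
  rw [lintegral_mul_const _ hmf, lintegral_f1 (D.lo_pos.trans_le hs.1), one_mul]

lemma IIDData.measure_lt_abs_le (D : IIDData P p gμ ρ lo hi M σ X) (i : ℕ) (R : ℝ) :
    P {ω | R < |X i ω|} ≤ ENNReal.ofReal (tailC lo hi M R) := by
  have hm : MeasurableSet {z : ℝ × ℝ | R < |z.2|} := measurable_snd (measurableSet_lt_abs R)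
  have e : P {ω | R < |X i ω|} = dataLaw p gμ ρ {z | R < |z.2|} := by
    rw [← D.law i, Measure.map_apply (D.measurable_data i) hm]; rfl
  rw [e, ← lintegral_indicator_one hm, lintegral_dataLaw (measurable_one.indicator hm)]
  calc ∫⁻ s, ∫⁻ x, ENNReal.ofReal (fMix p gμ s x) *
        {z : ℝ × ℝ | R < |z.2|}.indicator 1 (s, x) ∂volume ∂ρ
      ≤ ∫⁻ s, ENNReal.ofReal (tailC lo hi M R) ∂ρ := by
        refine lintegral_mono_ae (D.ρ_ae.mono fun s hs => ?_)
        have : ∀ x, ENNReal.ofReal (fMix p gμ s x) *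
            {z : ℝ × ℝ | R < |z.2|}.indicator (1 : ℝ × ℝ → ENNReal) (s, x) =
            {x : ℝ | R < |x|}.indicator (fun x => ENNReal.ofReal (fMix p gμ s x)) x := by
          intro x
          by_cases hx : R < |x| <;> simp [Set.indicator, hx]
        simp_rw [this]
        rw [lintegral_indicator (measurableSet_lt_abs R),
          ← ofReal_integral_eq_lintegral_ofReal (D.integrable_fMix hs.1).integrableOn
            (ae_of_all _ fun x => D.fMix_nonneg hs.1 x)]
        exact ENNReal.ofReal_le_ofReal (D.setIntegral_fMix_le_tailC hs R)
    _ = _ := by simp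

/-- Consistency at the good observations gives uniform consistency in probability. -/
lemma IIDData.tendsto_iSup_measure (D : IIDData P p gμ ρ lo hi M σ X)
    (B : BandwidthCondition hx hσ) {T : ℕ → Ω → ℕ → ℝ} (hT : ConsistentT P p gμ ρ σ X hσ 1 p T)
    {ε : ℝ} (hε : 0 < ε) :
    Tendsto (fun m => ⨆ i ∈ Finset.range m,
      P {ω | ε ≤ |T m ω i - oracleT p gμ (X i ω) (σ i ω)|}) atTop (𝓝 0) := by
  rw [ENNReal.tendsto_nhds_zero]
  intro τ hτ
  obtain ⟨τ', hτ', hττ⟩ : ∃ τ' : ℝ, 0 < τ' ∧ ENNReal.ofReal (3 * τ') ≤ τ := by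
    rcases eq_or_ne τ ⊤ with rfl | h
    · exact ⟨1, one_pos, le_top⟩
    · refine ⟨τ.toReal / 3, div_pos (ENNReal.toReal_pos hτ.ne' h) (by norm_num), ?_⟩
      rw [mul_div_cancel₀ _ (by norm_num), ENNReal.ofReal_toReal h]
  have hmC := massC_pos
  have hlh := D.lo_le_hi
  have hd : 0 < hi - lo + 2 := by linarith
  set θ := τ' / (massC * (hi - lo + 2)) with hθ
  have hθ0 : 0 < θ := by positivity
  obtain ⟨R, hR, hR0⟩ := (((tendsto_tailC lo hi M).eventually_lt_const hτ').and
    (eventually_gt_atTop 0)).exists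
  have h1 := hT θ R (ε / 2) hθ0 hR0 (half_pos hε)
  have h1' := (ENNReal.tendsto_nhds_zero.1 h1) (ENNReal.ofReal τ') (by simpa using hτ')
  filter_upwards [h1', B.hσ_zero.eventually_lt_const one_pos] with m hm hm1
  refine iSup₂_le fun i hi => le_trans ?_ hττ
  simp only [Pi.one_apply, one_mul] at hm
  have hi' := Finset.mem_range.1 hi
  have e3 : ENNReal.ofReal (3 * τ') = ENNReal.ofReal τ' + ENNReal.ofReal τ' + ENNReal.ofReal τ' := by
    rw [← ENNReal.ofReal_add hτ'.le hτ'.le, ← ENNReal.ofReal_add (by positivity) hτ'.le]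
    congr 1; ring
  rw [e3]
  have hk : P {ω | kap ρ (hσ m) (σ i ω) < θ} ≤ ENNReal.ofReal τ' := by
    refine (D.measure_kap_lt_le i (B.hσ_pos m) hm1.le hθ0.le).trans (le_of_eq ?_)
    congr 1; rw [hθ]; field_simp
  have hX : P {ω | R < |X i ω|} ≤ ENNReal.ofReal τ' :=
    (D.measure_lt_abs_le i R).trans (ENNReal.ofReal_le_ofReal hR.le)
  refine le_trans (measure_mono_ae ?_) (le_trans (measure_union_le _ _)
    (add_le_add (le_trans (measure_union_le _ _) (add_le_add hm hk)) hX))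
  filter_upwards [D.ae_mem i] with ω hω hω'
  by_contra hcon
  have hcon' : ω ∉ ({ω | ¬∀ i < m, θ ≤ kap ρ (hσ m) (σ i ω) → |X i ω| ≤ R →
      |T m ω i - limT p gμ p (σ i ω, X i ω)| ≤ ε / 2} ∪ {ω | kap ρ (hσ m) (σ i ω) < θ}) ∪
      {ω | R < |X i ω|} := hcon
  simp only [Set.mem_union, Set.mem_ofPred_eq, not_or, not_not, not_lt] at hcon'
  obtain ⟨⟨c1, c2⟩, c3⟩ := hcon'
  have := c1 i hi' c2 c3
  rw [D.limT_self hω] at this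
  have hω'' : ε ≤ |T m ω i - oracleT p gμ (X i ω) (σ i ω)| := hω'
  linarith

lemma tendstoInMeasure_of_tendsto_iSup {T : ℕ → Ω → ℕ → ℝ} {S : Ω → ℕ → ℝ}
    (h : ∀ ε : ℝ, 0 < ε → Tendsto (fun m => ⨆ i ∈ Finset.range m,
      P {ω | ε ≤ |T m ω i - S ω i|}) atTop (𝓝 0)) (i : ℕ) :
    TendstoInMeasure P (fun m ω => T m ω i) atTop fun ω => S ω i := by
  refine tendstoInMeasure_of_ne_top fun ε hε hε' => ?_
  refine tendsto_of_tendsto_of_tendsto_of_le_of_le' tendsto_const_nhds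
    (h ε.toReal (ENNReal.toReal_pos hε.ne' hε')) (Eventually.of_forall fun _ => zero_le) ?_
  filter_upwards [eventually_gt_atTop i] with m hm
  refine le_trans (measure_mono fun ω hω => ?_)
    (le_iSup₂ (f := fun i (_ : i ∈ Finset.range m) => P {ω | ε.toReal ≤ |T m ω i - S ω i|}) i
      (Finset.mem_range.2 hm))
  simp only [Set.mem_ofPred_eq] at hω ⊢
  rw [edist_dist, Real.dist_eq] at hω
  exact ENNReal.toReal_le_of_le_ofReal (abs_nonneg _) hω

end uniform

/-! ### Mean integrated squared error with known weights -/

section secondMoment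

variable {Ω : Type*} [MeasurableSpace Ω] {P : Measure Ω} [IsProbabilityMeasure P]
  {E : Type*} [MeasurableSpace E] {Q : Measure E} {Z : ℕ → Ω → E}

lemma lintegral_sq_avg_sub_le (hZ : ∀ k, Measurable (Z k)) (hind : iIndepFun Z P)
    (hlaw : ∀ k, P.map (Z k) = Q) {g : E → ℝ} (hg : Measurable g) {B : ℝ}
    (hgB : ∀ᵐ b ∂Q, 0 ≤ g b ∧ g b ≤ B) (u : ℝ) {m : ℕ} (hm : 0 < m) :
    ∫⁻ ω, ENNReal.ofReal (((m : ℝ)⁻¹ * ∑ k ∈ Finset.range m, g (Z k ω) - u) ^ 2) ∂P ≤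
      ENNReal.ofReal ((m : ℝ)⁻¹ * (B * ∫ b, g b ∂Q) + (∫ b, g b ∂Q - u) ^ 2) := by
  have hm' : (0 : ℝ) < m := by exact_mod_cast hm
  set ν := ∫ b, g b ∂Q with hν
  have hZb : ∀ k, ∀ᵐ ω ∂P, 0 ≤ g (Z k ω) ∧ g (Z k ω) ≤ B := by
    intro k
    have := hgB
    rw [← hlaw k] at this
    exact ae_of_ae_map (hZ k).aemeasurable this
  have hgZ : ∀ k, Measurable fun ω => g (Z k ω) := fun k => hg.comp (hZ k)
  have hL2 : ∀ k, MemLp (fun ω => g (Z k ω)) 2 P := by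
    intro k
    refine MemLp.of_bound (hgZ k).aestronglyMeasurable B ?_
    filter_upwards [hZb k] with ω hω
    rw [Real.norm_eq_abs, abs_of_nonneg hω.1]; exact hω.2
  have hmean : ∀ k, ∫ ω, g (Z k ω) ∂P = ν := by
    intro k
    rw [hν, ← hlaw k, integral_map (hZ k).aemeasurable hg.aestronglyMeasurable]
  have hvar : ∀ k, variance (fun ω => g (Z k ω)) P ≤ B * ν := by
    intro k
    refine (variance_le_expectation_sq (hgZ k).aestronglyMeasurable).trans ?_
    rw [← hmean k, ← integral_const_mul]
    refine integral_mono_ae ((hL2 k).integrable_sq) (((hL2 k).integrable one_le_two).const_mul B) ?_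
    filter_upwards [hZb k] with ω hω
    simp only [Pi.pow_apply]
    nlinarith [hω.1, hω.2]
  set Y : Ω → ℝ := fun ω => (m : ℝ)⁻¹ * ∑ k ∈ Finset.range m, g (Z k ω) with hY
  have hsum : MemLp (∑ k ∈ Finset.range m, fun ω => g (Z k ω)) 2 P :=
    memLp_finsetSum' _ fun k _ => hL2 k
  have hYL : MemLp Y 2 P := by
    have := hsum.const_mul (m : ℝ)⁻¹
    refine this.ae_eq (ae_of_all _ fun ω => ?_)
    simp [hY]
  have hYvar : variance Y P ≤ (m : ℝ)⁻¹ * (B * ν) := by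
    have e : Y = fun ω => (m : ℝ)⁻¹ * (∑ k ∈ Finset.range m, fun ω => g (Z k ω)) ω := by
      funext ω; simp [hY]
    rw [e, variance_const_mul, IndepFun.variance_sum (fun k _ => hL2 k)]
    · calc ((m : ℝ)⁻¹) ^ 2 * ∑ k ∈ Finset.range m, variance (fun ω => g (Z k ω)) P
          ≤ ((m : ℝ)⁻¹) ^ 2 * ∑ k ∈ Finset.range m, B * ν := by
            gcongr with k _
            exact hvar k
        _ = (m : ℝ)⁻¹ * (B * ν) := by simp; field_simp
    · intro i _ j _ hij
      exact (hind.indepFun hij).comp hg hg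
  have hYmean : ∫ ω, Y ω ∂P = ν := by
    rw [hY, integral_const_mul, integral_finsetSum _ fun k _ => (hL2 k).integrable one_le_two]
    simp_rw [hmean]
    simp; field_simp
  have hYu : MemLp (fun ω => Y ω - u) 2 P := hYL.sub (memLp_const u)
  have hE : ∫ ω, (Y ω - u) ^ 2 ∂P ≤ (m : ℝ)⁻¹ * (B * ν) + (ν - u) ^ 2 := by
    have h1 := variance_eq_sub hYu
    rw [variance_sub_const hYL.aestronglyMeasurable] at h1
    have h2 : ∫ ω, (Y ω - u) ∂P = ν - u := by
      rw [integral_sub (hYL.integrable one_le_two) (integrable_const _), hYmean]; simp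
    simp only [Pi.pow_apply] at h1
    rw [h2] at h1
    linarith
  rw [← ofReal_integral_eq_lintegral_ofReal hYu.integrable_sq (ae_of_all _ fun ω => sq_nonneg _)]
  exact ENNReal.ofReal_le_ofReal hE

end secondMoment

section mise

variable {Ω : Type*} [MeasurableSpace Ω] {P : Measure Ω} [IsProbabilityMeasure P] {p : ℝ}
  {gμ ρ : Measure ℝ} [IsProbabilityMeasure gμ] [IsProbabilityMeasure ρ] {lo hi M : ℝ}
  {σ X : ℕ → Ω → ℝ} {hx hσ : ℕ → ℝ} {β : ℝ × ℝ → ℝ}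

lemma IIDData.lintegral_integral_kerA_le (D : IIDData P p gμ ρ lo hi M σ X) (hβ : Measurable β)
    (hβ1 : ∀ z, β z ∈ Set.Icc (0 : ℝ) 1) {h hx : ℝ} (hh : 0 < h) (hhx : 0 < hx) (s : ℝ) :
    ∫⁻ t, ENNReal.ofReal (∫ z, kerA β h hx s t z ∂dataLaw p gμ ρ) ≤
      ENNReal.ofReal (kap ρ h s) := by
  have hQ := D.isProbabilityMeasure_dataLaw
  have e1 : ∀ t, ENNReal.ofReal (∫ z, kerA β h hx s t z ∂dataLaw p gμ ρ) =
      ∫⁻ z, ENNReal.ofReal (kerA β h hx s t z) ∂dataLaw p gμ ρ := fun t =>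
    ofReal_integral_eq_lintegral_ofReal (D.integrable_kerA hβ hβ1 hh hhx s t)
      (D.ae_dataLaw.mono fun z hz => (kerA_mem hβ1 hh hhx D.lo_pos s t hz).1)
  simp_rw [e1]
  have hmeas : Measurable fun q : ℝ × (ℝ × ℝ) => ENNReal.ofReal (kerA β h hx s q.1 q.2) :=
    ((measurable_kerA hβ).comp ((measurable_const.prodMk measurable_fst).prodMk
      measurable_snd)).ennreal_ofReal
  rw [lintegral_lintegral_swap hmeas.aemeasurable]
  calc ∫⁻ z, ∫⁻ t, ENNReal.ofReal (kerA β h hx s t z) ∂volume ∂dataLaw p gμ ρ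
      = ∫⁻ z, ENNReal.ofReal (kerS β h s z) ∂dataLaw p gμ ρ := by
        refine lintegral_congr_ae (D.ae_dataLaw.mono fun z hz => ?_)
        have hw : 0 < hx * z.1 := mul_pos hhx (D.lo_pos.trans_le hz.1)
        have h0 := (kerS_mem hβ1 hh s z).1
        have : ∀ t, ENNReal.ofReal (kerA β h hx s t z) =
            ENNReal.ofReal (kerS β h s z) * ENNReal.ofReal (phi (hx * z.1) (t - z.2)) := by
          intro t
          rw [← ENNReal.ofReal_mul h0]; rfl
        simp_rw [this]
        rw [lintegral_const_mul _ (by fun_prop), lintegral_phi_sub hw, mul_one]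
    _ = ENNReal.ofReal (∫ z, kerS β h s z ∂dataLaw p gμ ρ) :=
        (ofReal_integral_eq_lintegral_ofReal (D.integrable_kerS hβ hβ1 hh s)
          (ae_of_all _ fun z => (kerS_mem hβ1 hh s z).1)).symm
    _ ≤ _ := ENNReal.ofReal_le_ofReal (D.integral_kerS_le hβ hβ1 hh s)

/-- Integrated squared error of the normalised kernel average with weight `β`. -/
noncomputable def ise (p : ℝ) (gμ ρ : Measure ℝ) (β : ℝ × ℝ → ℝ) (h hx : ℝ) (m : ℕ) (x s : ℕ → ℝ)
    (σ₀ : ℝ) : ENNReal :=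
  ∫⁻ t, ENNReal.ofReal ((avgA ρ β h hx m x s σ₀ t - fMix p gμ σ₀ t * β (σ₀, t)) ^ 2)

lemma IIDData.measurable_ise_integrand (D : IIDData P p gμ ρ lo hi M σ X) (hβ : Measurable β)
    (h hx : ℝ) (m : ℕ) (σ₀ : ℝ) : Measurable fun q : Ω × ℝ => ENNReal.ofReal
      ((avgA ρ β h hx m (fun j => X j q.1) (fun j => σ j q.1) σ₀ q.2 -
        fMix p gμ σ₀ q.2 * β (σ₀, q.2)) ^ 2) := by
  have h1 : Measurable fun q : Ω × ℝ =>
      avgA ρ β h hx m (fun j => X j q.1) (fun j => σ j q.1) σ₀ q.2 := by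
    unfold avgA
    refine measurable_const.mul (Finset.measurable_sum _ fun k _ => ?_)
    exact (measurable_kerA hβ).comp ((measurable_const.prodMk measurable_snd).prodMk
      ((D.measurable_data k).comp measurable_fst))
  have h2 : Measurable fun q : Ω × ℝ => fMix p gμ σ₀ q.2 * β (σ₀, q.2) :=
    (measurable_fMix.comp (measurable_const.prodMk measurable_snd)).mul
      (hβ.comp (measurable_const.prodMk measurable_snd))
  exact ((h1.sub h2).pow_const 2).ennreal_ofReal

lemma IIDData.measurable_ise (D : IIDData P p gμ ρ lo hi M σ X) (hβ : Measurable β)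
    (h hx : ℝ) (m : ℕ) (σ₀ : ℝ) : Measurable fun ω =>
      ise p gμ ρ β h hx m (fun j => X j ω) (fun j => σ j ω) σ₀ :=
  (D.measurable_ise_integrand hβ h hx m σ₀).lintegral_prod_right'

lemma IIDData.lintegral_fMix (D : IIDData P p gμ ρ lo hi M σ X) {s : ℝ} (hs : lo ≤ s) :
    ∫⁻ t, ENNReal.ofReal (fMix p gμ s t) = 1 := by
  have := D.isProb
  simp_rw [D.fMix_eq hs]
  exact lintegral_f1 (D.lo_pos.trans_le hs)

/-- The kernel averages with a fixed weight are consistent in mean integrated squared error. -/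
lemma IIDData.tendsto_lintegral_ise (D : IIDData P p gμ ρ lo hi M σ X)
    (B : BandwidthCondition hx hσ) (hβ : Measurable β) (hβ1 : ∀ z, β z ∈ Set.Icc (0 : ℝ) 1) {L : ℝ}
    (hL : 0 ≤ L)
    (hLip : ∀ s ∈ Set.Icc lo hi, ∀ t ∈ Set.Icc lo hi, ∀ x y,
      |fMix p gμ s x * β (s, x) - fMix p gμ t y * β (t, y)| ≤ L * (|s - t| + |x - y|))
    {θ : ℝ} (hθ : 0 < θ) {σ₀ : ℝ} (hσ₀ : σ₀ ∈ Set.Icc lo hi)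
    (h₀ : ∀ᶠ m in atTop, θ ≤ kap ρ (hσ m) σ₀) :
    Tendsto (fun m => ∫⁻ ω, ise p gμ ρ β (hσ m) (hx m) m (fun j => X j ω) (fun j => σ j ω) σ₀ ∂P)
      atTop (𝓝 0) := by
  have hlo := D.lo_pos
  rw [ENNReal.tendsto_nhds_zero]
  intro τ hτ
  obtain ⟨ε, hε, hετ⟩ : ∃ ε : ℝ, 0 < ε ∧ ENNReal.ofReal (3 * ε) ≤ τ := by
    rcases eq_or_ne τ ⊤ with rfl | h
    · exact ⟨1, one_pos, le_top⟩
    · refine ⟨τ.toReal / 3, div_pos (ENNReal.toReal_pos hτ.ne' h) (by norm_num), ?_⟩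
      rw [mul_div_cancel₀ _ (by norm_num), ENNReal.ofReal_toReal h]
  have lim : Tendsto (fun m : ℕ => (lo * θ)⁻¹ * (m * (hσ m * hx m))⁻¹) atTop (𝓝 0) := by
    have := B.mul_atTop.inv_tendsto_atTop.const_mul (lo * θ)⁻¹
    simpa using this
  filter_upwards [D.eventually_bias B hβ hβ1 hL hLip hθ hε, h₀, lim.eventually_lt_const hε,
    eventually_gt_atTop 0] with m hbias hk hlim hm
  refine le_trans ?_ hετ
  have hm' : (0 : ℝ) < m := by exact_mod_cast hm
  have h1 := B.hσ_pos m
  have h2 := B.hx_pos m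
  set κ := kap ρ (hσ m) σ₀ with hκ
  have hκ0 : 0 < κ := hθ.trans_le hk
  set I : ℝ → ℝ := fun t => ∫ z, kerA β (hσ m) (hx m) σ₀ t z ∂dataLaw p gμ ρ with hI
  have hI0 : ∀ t, 0 ≤ I t := fun t => integral_nonneg_of_ae
    (D.ae_dataLaw.mono fun z hz => (kerA_mem hβ1 h1 h2 hlo σ₀ t hz).1)
  set Bd := κ⁻¹ * (hσ m * hx m * lo)⁻¹ with hBd
  have hBm : (m : ℝ)⁻¹ * Bd ≤ ε := by
    refine le_trans ?_ hlim.le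
    rw [hBd]
    calc (m : ℝ)⁻¹ * (κ⁻¹ * (hσ m * hx m * lo)⁻¹) ≤ (m : ℝ)⁻¹ * (θ⁻¹ * (hσ m * hx m * lo)⁻¹) := by
          gcongr
      _ = _ := by field_simp
  have pt : ∀ t, ∫⁻ ω, ENNReal.ofReal ((avgA ρ β (hσ m) (hx m) m (fun j => X j ω)
      (fun j => σ j ω) σ₀ t - fMix p gμ σ₀ t * β (σ₀, t)) ^ 2) ∂P ≤
      ENNReal.ofReal (2 * ε) * ENNReal.ofReal (κ⁻¹ * I t) +
        ENNReal.ofReal ε * ENNReal.ofReal (fMix p gμ σ₀ t) := by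
    intro t
    have hg : Measurable fun z => κ⁻¹ * kerA β (hσ m) (hx m) σ₀ t z :=
      measurable_const.mul ((measurable_kerA hβ).comp (measurable_prodMk_left (x := (σ₀, t))))
    have key := lintegral_sq_avg_sub_le (P := P) (Z := fun i ω => (σ i ω, X i ω))
      D.measurable_data D.indep D.law hg (B := Bd)
      (D.ae_dataLaw.mono fun z hz => by
        have := kerA_mem hβ1 h1 h2 hlo σ₀ t hz
        exact ⟨mul_nonneg (by positivity) this.1, by rw [hBd]; gcongr; exact this.2⟩)
      (fMix p gμ σ₀ t * β (σ₀, t)) hm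
    have e : ∀ ω, avgA ρ β (hσ m) (hx m) m (fun j => X j ω) (fun j => σ j ω) σ₀ t =
        (m : ℝ)⁻¹ * ∑ k ∈ Finset.range m, κ⁻¹ * kerA β (hσ m) (hx m) σ₀ t (σ k ω, X k ω) := by
      intro ω
      rw [avgA, ← Finset.mul_sum, mul_inv, mul_assoc]
    simp_rw [e]
    refine key.trans ?_
    have eI : ∫ b, κ⁻¹ * kerA β (hσ m) (hx m) σ₀ t b ∂dataLaw p gμ ρ = κ⁻¹ * I t :=
      integral_const_mul _ _
    rw [eI]
    set ν := κ⁻¹ * I t with hν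
    have hν0 : 0 ≤ ν := mul_nonneg (by positivity) (hI0 t)
    have hf0 := D.fMix_nonneg hσ₀.1 t
    obtain ⟨hb0, hb1⟩ := hβ1 (σ₀, t)
    set u := fMix p gμ σ₀ t * β (σ₀, t) with hu
    have hu0 : 0 ≤ u := mul_nonneg hf0 hb0
    have hu1 : u ≤ fMix p gμ σ₀ t := mul_le_of_le_one_right hf0 hb1
    have hbt : |ν - u| ≤ ε := by
      have := hbias σ₀ hσ₀ hk t
      have e : ν - u = κ⁻¹ * (I t - κ * u) := by rw [hν]; field_simp
      rw [e, abs_mul, abs_of_pos (inv_pos.2 hκ0), inv_mul_le_iff₀ hκ0]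
      exact this.trans (le_of_eq (mul_comm _ _))
    have hsq : (ν - u) ^ 2 ≤ ε * (ν + u) := by
      rw [← sq_abs, sq]
      have : |ν - u| ≤ ν + u := by rw [abs_le]; constructor <;> linarith
      exact mul_le_mul hbt this (abs_nonneg _) hε.le
    rw [← ENNReal.ofReal_mul (by positivity), ← ENNReal.ofReal_mul hε.le,
      ← ENNReal.ofReal_add (by positivity) (by positivity)]
    refine ENNReal.ofReal_le_ofReal ?_
    have h3 : (m : ℝ)⁻¹ * (Bd * ν) ≤ ε * ν := by rw [← mul_assoc]; gcongr
    nlinarith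
  unfold ise
  rw [lintegral_lintegral_swap (D.measurable_ise_integrand hβ (hσ m) (hx m) m σ₀).aemeasurable]
  have hmf : Measurable fun t => ENNReal.ofReal (fMix p gμ σ₀ t) :=
    (measurable_fMix.comp measurable_prodMk_left).ennreal_ofReal
  calc _ ≤ ∫⁻ t, (ENNReal.ofReal (2 * ε) * ENNReal.ofReal (κ⁻¹ * I t) +
        ENNReal.ofReal ε * ENNReal.ofReal (fMix p gμ σ₀ t)) := lintegral_mono pt
    _ = ENNReal.ofReal (2 * ε) * (∫⁻ t, ENNReal.ofReal (κ⁻¹ * I t)) +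
        ENNReal.ofReal ε * ∫⁻ t, ENNReal.ofReal (fMix p gμ σ₀ t) := by
        rw [lintegral_add_right _ (hmf.const_mul _), lintegral_const_mul' _ _ ENNReal.ofReal_ne_top,
          lintegral_const_mul' _ _ ENNReal.ofReal_ne_top]
    _ ≤ ENNReal.ofReal (2 * ε) * 1 + ENNReal.ofReal ε * 1 := by
        gcongr
        · have e : ∀ t, ENNReal.ofReal (κ⁻¹ * I t) = ENNReal.ofReal κ⁻¹ * ENNReal.ofReal (I t) :=
            fun t => ENNReal.ofReal_mul (by positivity)
          simp_rw [e]
          rw [lintegral_const_mul' _ _ ENNReal.ofReal_ne_top]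
          calc _ ≤ ENNReal.ofReal κ⁻¹ * ENNReal.ofReal κ := by
                gcongr
                exact D.lintegral_integral_kerA_le hβ hβ1 h1 h2 σ₀
            _ = 1 := by
                rw [← ENNReal.ofReal_mul (by positivity), inv_mul_cancel₀ hκ0.ne',
                  ENNReal.ofReal_one]
        · exact (D.lintegral_fMix hσ₀.1).le
    _ = ENNReal.ofReal (3 * ε) := by
        rw [mul_one, mul_one, ← ENNReal.ofReal_add (by positivity) hε.le]
        congr 1; ring

end mise

/-! ### The alternative density exceeds the null density somewhere -/

section exceed

lemma half_sq_le_exp_add_exp_neg (y : ℝ) : y ^ 2 / 2 ≤ Real.exp y + Real.exp (-y) := by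
  have h := Real.quadratic_le_exp_of_nonneg (abs_nonneg y)
  rw [sq_abs] at h
  have h1 : Real.exp |y| ≤ Real.exp y + Real.exp (-y) := by
    rcases abs_cases y with ⟨e, -⟩ | ⟨e, -⟩ <;> rw [e] <;>
      linarith [Real.exp_pos y, Real.exp_pos (-y)]
  linarith [abs_nonneg y]

lemma phi_mul_phi_mul_le {h : ℝ} (hh : 0 < h) (x u : ℝ) :
    phi h x * phi h u * (√(2 * Real.pi) * h) * ((x * u / h ^ 2) ^ 2 / 2) ≤
      phi h (x - u) + phi h (-x - u) := by
  have hc : 0 < √(2 * Real.pi) * h := by positivity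
  have e1 : phi h (x - u) = phi h x * phi h u * (√(2 * Real.pi) * h) * Real.exp (x * u / h ^ 2) := by
    unfold phi
    have : -(x - u) ^ 2 / (2 * h ^ 2) =
        -x ^ 2 / (2 * h ^ 2) + -u ^ 2 / (2 * h ^ 2) + x * u / h ^ 2 := by field_simp; ring
    rw [this, Real.exp_add, Real.exp_add]
    field_simp
  have e2 : phi h (-x - u) =
      phi h x * phi h u * (√(2 * Real.pi) * h) * Real.exp (-(x * u / h ^ 2)) := by
    unfold phi
    have : -(-x - u) ^ 2 / (2 * h ^ 2) =
        -x ^ 2 / (2 * h ^ 2) + -u ^ 2 / (2 * h ^ 2) + -(x * u / h ^ 2) := by field_simp; ring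
    rw [this, Real.exp_add, Real.exp_add]
    field_simp
  rw [e1, e2, ← mul_add]
  have h1 := phi_pos hh x
  have h2 := phi_pos hh u
  exact mul_le_mul_of_nonneg_left (half_sq_le_exp_add_exp_neg _) (by positivity)

lemma exists_f0_lt_f1 {gμ : Measure ℝ} [IsProbabilityMeasure gμ] (h0 : gμ {0} = 0) {s : ℝ}
    (hs : 0 < s) : ∃ x, f0 s x < f1 gμ s x := by
  by_contra! hcon
  set c := √(2 * Real.pi) * s with hc
  have hc0 : 0 < c := by positivity
  have h_int : Integrable (fun u => u ^ 2 * phi s u) gμ := by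
    refine Integrable.of_bound (C := 2 * s) (by fun_prop) (ae_of_all _ fun u => ?_)
    rw [Real.norm_eq_abs, abs_of_nonneg (mul_nonneg (sq_nonneg _) (phi_nonneg hs.le _))]
    exact sq_mul_phi_le hs u
  set I := ∫ u, u ^ 2 * phi s u ∂gμ with hI
  have hI0 : 0 < I := by
    rw [hI, integral_pos_iff_support_of_nonneg
      (fun u => mul_nonneg (sq_nonneg _) (phi_nonneg hs.le _)) h_int]
    have e : Function.support (fun u => u ^ 2 * phi s u) = {0}ᶜ := by
      ext u
      simp [(phi_pos hs u).ne']
    rw [e, prob_compl_eq_one_sub (measurableSet_singleton 0), h0]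
    simp
  have key : ∀ x : ℝ, x ^ 2 * (c / (2 * s ^ 4) * I) ≤ 2 := by
    intro x
    have h1 : ∫ u, phi s x * (x ^ 2 * (c / (2 * s ^ 4))) * (u ^ 2 * phi s u) ∂gμ ≤
        ∫ u, (phi s (x - u) + phi s (-x - u)) ∂gμ := by
      refine integral_mono (h_int.const_mul _)
        ((integrable_phi_measure hs x gμ).add (integrable_phi_measure hs (-x) gμ)) fun u => ?_
      refine le_trans (le_of_eq ?_) (phi_mul_phi_mul_le hs x u)
      rw [hc]; field_simp
    rw [integral_const_mul, integral_add (integrable_phi_measure hs x gμ)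
      (integrable_phi_measure hs (-x) gμ)] at h1
    have h2 := hcon x
    have h3 := hcon (-x)
    have e : f0 s (-x) = f0 s x := by simp [f0, phi]
    rw [e] at h3
    have h4 : f0 s x * (x ^ 2 * (c / (2 * s ^ 4)) * I) ≤ f0 s x * 2 := by
      unfold f1 at h2 h3
      unfold f0 at h2 h3 ⊢
      rw [← hI] at h1
      linarith
    have h5 := le_of_mul_le_mul_left h4 (phi_pos hs x)
    linarith
  have hb : 0 < c / (2 * s ^ 4) * I := by positivity
  set b := c / (2 * s ^ 4) * I
  have h6 := key (√(3 / b))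
  rw [Real.sq_sqrt (by positivity), div_mul_cancel₀ _ hb.ne'] at h6
  linarith

end exceed

section lower

variable {Ω : Type*} [MeasurableSpace Ω] {P : Measure Ω} [IsProbabilityMeasure P] {p : ℝ}
  {gμ ρ : Measure ℝ} [IsProbabilityMeasure gμ] [IsProbabilityMeasure ρ] {lo hi M : ℝ}
  {σ X : ℕ → Ω → ℝ} {hx hσ : ℕ → ℝ}

lemma zero_mem_Icc : (0 : ℝ) ∈ Set.Icc (0 : ℝ) 1 := ⟨le_rfl, zero_le_one⟩

lemma IIDData.exists_le_integral_limW_zero (D : IIDData P p gμ ρ lo hi M σ X) (h0 : gμ {0} = 0)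
    {σ₀ : ℝ} (hσ₀ : σ₀ ∈ Set.Icc lo hi) : ∃ c r : ℝ, 0 < c ∧ 0 < r ∧
      ∀ s ∈ Set.Icc lo hi, |σ₀ - s| < r → c ≤ ∫ x, fMix p gμ s x * limW p gμ 0 (s, x) := by
  have hlo := D.lo_pos
  obtain ⟨x₀, hx₀⟩ := exists_f0_lt_f1 h0 (hlo.trans_le hσ₀.1)
  set a := fMix p gμ σ₀ x₀ * limW p gμ 0 (σ₀, x₀) with ha
  have ha0 : 0 < a := by
    rw [ha, D.fMix_mul_limW zero_le_one hσ₀, fMix]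
    refine lt_max_of_lt_left ?_
    have := mul_pos D.p_pos (sub_pos.2 hx₀)
    nlinarith
  set L := 6 / lo ^ 2 with hL
  have hL0 : 0 < L := by positivity
  set r := a / (4 * L) with hr
  have hr0 : 0 < r := by positivity
  have hLr : L * (r + r) = a / 2 := by rw [hr]; field_simp; ring
  refine ⟨r * a, r, by positivity, hr0, fun s hs hsr => ?_⟩
  have h_int := D.integrable_fMix_mul (measurable_limW p gμ 0) (limW_mem p gμ 0) hs.1
  have hnn : ∀ x, 0 ≤ fMix p gμ s x * limW p gμ 0 (s, x) := fun x =>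
    mul_nonneg (D.fMix_nonneg hs.1 x) (limW_mem p gμ 0 _).1
  calc r * a = ∫ x in Set.Icc (x₀ - r) (x₀ + r), a / 2 := by
        rw [setIntegral_const, Measure.real, Real.volume_Icc, ENNReal.toReal_ofReal (by linarith),
          smul_eq_mul]
        ring
    _ ≤ ∫ x in Set.Icc (x₀ - r) (x₀ + r), fMix p gμ s x * limW p gμ 0 (s, x) := by
        refine setIntegral_mono_on (by simp) h_int.integrableOn measurableSet_Icc
          fun x hx => ?_
        have h1 := D.fMix_mul_limW_lipschitz zero_mem_Icc σ₀ hσ₀ s hs x₀ x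
        have h2 : |x₀ - x| ≤ r := by
          rw [abs_le]; constructor <;> linarith [hx.1, hx.2]
        have h3 : L * (|σ₀ - s| + |x₀ - x|) ≤ L * (r + r) := by gcongr
        have h4 := (abs_le.1 (h1.trans h3)).2
        rw [hLr] at h4
        linarith
    _ ≤ _ := setIntegral_le_integral h_int (ae_of_all _ hnn)

lemma IIDData.exists_likely_le_avgS_limW_zero (D : IIDData P p gμ ρ lo hi M σ X)
    (B : BandwidthCondition hx hσ) (h0 : gμ {0} = 0) {σ₀ : ℝ} (hσ₀ : σ₀ ∈ Set.Icc lo hi) {θ : ℝ}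
    (hθ : 0 < θ) (h₀ : ∀ᶠ m in atTop, θ ≤ kap ρ (hσ m) σ₀) :
    ∃ c : ℝ, 0 < c ∧ Likely P (fun m => m) fun m ω =>
      c < avgS ρ (limW p gμ 0) (hσ m) m (fun j => X j ω) (fun j => σ j ω) σ₀ := by
  obtain ⟨c, r, hc, hr, hcr⟩ := D.exists_le_integral_limW_zero h0 hσ₀
  have hm := measurable_limW p gμ 0
  have h1 := limW_mem p gμ 0
  refine ⟨c / 4, by positivity, ?_⟩
  refine (D.likely_dev_fixed B (D.kernelBound_kerS B (fun _ => hm) (fun _ => h1)) hθ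
    (by positivity : 0 < c / 4) (a := (σ₀, 0)) h₀).mono ?_
  filter_upwards [h₀, (tendsto_phi_zero hr B.hσ_pos B.hσ_zero).eventually_lt_const
    (by positivity : 0 < θ / 2)] with m hk hphi
  refine ae_of_all _ fun ω h => ?_
  have hh := B.hσ_pos m
  have hI : c / 2 * kap ρ (hσ m) σ₀ ≤ ∫ b, kerS (limW p gμ 0) (hσ m) σ₀ b ∂dataLaw p gμ ρ := by
    have iφ := integrable_phi_measure hh σ₀ ρ
    have := D.le_integral_dataLaw (D.integrable_kerS hm h1 hh σ₀)
      (c := fun s => c * (phi (hσ m) (σ₀ - s) - phi (hσ m) r))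
      ((iφ.sub (integrable_const _)).const_mul c) fun s hs => by
        have e : ∫ x, fMix p gμ s x * kerS (limW p gμ 0) (hσ m) σ₀ (s, x) =
            phi (hσ m) (σ₀ - s) * ∫ x, fMix p gμ s x * limW p gμ 0 (s, x) := by
          rw [← integral_const_mul]
          refine integral_congr_ae (ae_of_all _ fun x => ?_)
          simp only [kerS]; ring
        rw [e]
        have hφ := phi_nonneg hh.le (σ₀ - s)
        have hφr := phi_nonneg hh.le r
        rcases lt_or_ge |σ₀ - s| r with hlt | hge
        · have := hcr s hs hlt
          nlinarith
        · have h2 : phi (hσ m) (σ₀ - s) ≤ phi (hσ m) r :=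
            phi_anti hh.le (by rwa [abs_of_pos hr])
          have h3 : 0 ≤ ∫ x, fMix p gμ s x * limW p gμ 0 (s, x) :=
            integral_nonneg fun x => mul_nonneg (D.fMix_nonneg hs.1 x) (h1 _).1
          nlinarith [mul_nonneg hφ h3]
    refine le_trans ?_ this
    rw [integral_const_mul, integral_sub iφ (integrable_const _)]
    simp only [integral_const, probReal_univ, one_smul]
    have e : ∫ s, phi (hσ m) (σ₀ - s) ∂ρ = kap ρ (hσ m) σ₀ := rfl
    rw [e]
    nlinarith
  have := lt_inv_mul_of_le (hθ.trans_le hk) h hI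
  unfold avgS
  linarith

lemma le_weightedKDE {h hx t y : ℝ} {m : ℕ} {w v x s : ℕ → ℝ} (hh : 0 < h) (hhx : 0 < hx)
    (hs : ∀ k, 0 < s k) (hv : ∀ k, 0 ≤ v k) (hvw : ∀ k, v k ≤ w k) (hw : ∀ k, w k ≤ 1) :
    sumA h hx m v x s t y / sumS h m (fun _ => 1) s t ≤ weightedKDE hx h m w x s t y := by
  rw [weightedKDE_eq]
  have hw0 : ∀ k, 0 ≤ w k := fun k => (hv k).trans (hvw k)
  have hS : sumS h m w s t ≤ sumS h m (fun _ => 1) s t := sumS_mono hh fun k _ => hw k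
  rcases (sumS_nonneg (s := s) (t := t) hh fun k (_ : k < m) => hw0 k).eq_or_lt with h0 | h0
  · have hz : ∀ k ∈ Finset.range m, w k * phi h (t - s k) = 0 :=
      (Finset.sum_eq_zero_iff_of_nonneg fun k _ =>
        mul_nonneg (hw0 k) (phi_nonneg hh.le _)).1 h0.symm
    have hA : sumA h hx m v x s t y = 0 := by
      refine Finset.sum_eq_zero fun k hk => ?_
      have h1 : w k = 0 := (mul_eq_zero.1 (hz k hk)).resolve_right (phi_pos hh _).ne'
      have h2 : v k = 0 := le_antisymm (h1 ▸ hvw k) (hv k)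
      rw [h2, zero_mul, zero_mul]
    rw [hA, ← h0]; simp
  · exact div_le_div₀ (sumA_nonneg hh hhx hs fun k _ => hw0 k)
      (sumA_mono hh hhx hs fun k _ => hvw k) h0 hS

lemma T0_le_T0_zero {h hx q : ℝ} {m : ℕ} {x s : ℕ → ℝ} (hh : 0 < h) (hhx : 0 < hx)
    (hs : ∀ k, 0 < s k) (hq : 0 ≤ q) (j : ℕ) : T0 hx h q m x s j ≤ T0 hx h 0 m x s j := by
  refine min_le_min_right _ (div_le_div_of_nonneg_right ?_ (fStar_nonneg hh hhx hs _ _))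
  exact mul_le_mul_of_nonneg_right (by linarith) (f0_nonneg (hs j).le _)

lemma mul_le_one_sub_plugInT {lo q s t a ν : ℝ} (hlo : 0 < lo) (hs : lo ≤ s)
    (hq : q ∈ Set.Icc (0 : ℝ) 1) (ha : 0 ≤ a) (hν : ν ≤ a) (hνl : ν ≤ lo⁻¹) :
    q * (ν * (lo / 2)) ≤ 1 - plugInT q s t a := by
  have hm := plugInT_mem (t := t) hq (hlo.trans_le hs) ha
  have hνlo : ν * lo ≤ 1 := by
    calc ν * lo ≤ lo⁻¹ * lo := by gcongr
      _ = 1 := inv_mul_cancel₀ hlo.ne'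
  rcases le_or_gt ν 0 with h0 | h0
  · have : q * (ν * (lo / 2)) ≤ 0 :=
      mul_nonpos_of_nonneg_of_nonpos hq.1 (mul_nonpos_of_nonpos_of_nonneg h0 (by positivity))
    linarith [hm.2]
  · have hf0 := f0_nonneg (hlo.trans_le hs).le t
    have hfl : f0 s t * lo ≤ 1 := by
      calc f0 s t * lo ≤ lo⁻¹ * lo := by gcongr; exact f0_le hlo hs t
        _ = 1 := inv_mul_cancel₀ hlo.ne'
    have h1 : 0 ≤ (1 - q) * f0 s t := mul_nonneg (by linarith [hq.2]) hf0
    have h2 : 0 ≤ q * a := mul_nonneg hq.1 ha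
    unfold plugInT
    rcases (add_nonneg h1 h2).eq_or_lt with hD | hD
    · rw [← hD, div_zero]
      nlinarith [hq.1, hq.2]
    · rw [one_sub_div hD.ne', le_div_iff₀ hD, add_sub_cancel_left]
      have h3 : ν * (lo / 2) * ((1 - q) * f0 s t) ≤ a / 2 := by
        have : (1 - q) * (f0 s t * lo) ≤ 1 := by
          have := mul_nonneg hf0 hlo.le
          nlinarith [hq.1, hq.2]
        calc ν * (lo / 2) * ((1 - q) * f0 s t) = ν / 2 * ((1 - q) * (f0 s t * lo)) := by ring
          _ ≤ ν / 2 * 1 := by gcongr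
          _ ≤ a / 2 := by linarith
      have h4 : ν * (lo / 2) * (q * a) ≤ a / 2 := by
        have : q * (ν * lo) ≤ 1 := by nlinarith [hq.1, hq.2, mul_pos h0 hlo]
        calc ν * (lo / 2) * (q * a) = a / 2 * (q * (ν * lo)) := by ring
          _ ≤ a / 2 * 1 := by gcongr
          _ = a / 2 := mul_one _
      calc q * (ν * (lo / 2)) * ((1 - q) * f0 s t + q * a)
          = q * (ν * (lo / 2) * ((1 - q) * f0 s t) + ν * (lo / 2) * (q * a)) := by ring
        _ ≤ q * (a / 2 + a / 2) := by gcongr; exact hq.1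
        _ = q * a := by ring

/-- The total weight of the second-step estimator is, up to a constant, at least the estimated
proportion, except on an event of probability `o(1 / m)`. -/
lemma IIDData.exists_likely_le_sumS (D : IIDData P p gμ ρ lo hi M σ X)
    (B : BandwidthCondition hx hσ) (h0 : gμ {0} = 0) {σ₀ : ℝ} (hσ₀ : σ₀ ∈ Set.Icc lo hi) {θ : ℝ}
    (hθ : 0 < θ) (h₀ : ∀ᶠ m in atTop, θ ≤ kap ρ (hσ m) σ₀) :
    ∃ c : ℝ, 0 < c ∧ Likely P (fun m => m) fun m ω => ∀ q ∈ Set.Icc (0 : ℝ) 1,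
      q * c ≤ (m * kap ρ (hσ m) σ₀)⁻¹ * sumS (hσ m) m
        (fun k => 1 - T1 (hx m) (hσ m) q m (fun j => X j ω) (fun j => σ j ω) k)
        (fun j => σ j ω) σ₀ := by
  have hlo := D.lo_pos
  obtain ⟨c, hc, hcL⟩ := D.exists_likely_le_avgS_limW_zero B h0 hσ₀ hθ h₀
  obtain ⟨θ', R, hθ', hR, -, hbad⟩ := D.exists_likely_bad B hθ (half_pos hc)
  have hl := lowC_pos D.lo_pos D.lo_le_hi M R
  set l := lowC lo hi M R with hl_def
  set e := l * c / 16 with he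
  have he0 : 0 < e := by positivity
  have hcons : ConsistentT P p gμ ρ σ X hσ (fun m => m) 0 fun m ω i =>
      T0 (hx m) (hσ m) 0 m (fun j => X j ω) (fun j => σ j ω) i := by
    intro θ R ε hθ hR hε
    refine (D.likely_T0 B (R := R) hθ hε).mono (Eventually.of_forall fun m => ae_of_all _ ?_)
    intro ω h i hi hk hX
    simpa using h i hi hk hX 0 zero_mem_Icc 0 zero_mem_Icc
  have hrr : ∀ᶠ m : ℕ in atTop, (m : ENNReal) ≤ m := Eventually.of_forall fun _ => le_rfl
  have L1 := D.likely_sum_sub B hrr hcons (D.ae_T0_mem B (pHat := fun _ _ => 0)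
    fun m => ae_of_all _ fun ω => zero_mem_Icc) hθ' he0
  have L2 := D.likely_avgA B (measurable_limW p gμ 0) (limW_mem p gμ 0) (by positivity)
    (D.fMix_mul_limW_lipschitz zero_mem_Icc) hθ' he0
  have L3 := D.likely_avgS B measurable_one one_mem_Icc D.integral_fMix_one hθ' one_pos
  have L4 := D.likely_avgS_fixed B measurable_one one_mem_Icc D.integral_fMix_one hθ one_pos h₀
  refine ⟨l * c * (lo / 16), by positivity,
    ((L1.and (L2.and L3)).and ((hcL.and (hbad σ₀ h₀)).and L4)).mono ?_⟩
  filter_upwards [eventually_gt_atTop 0, h₀] with m hm hk₀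
  filter_upwards [D.ae_all_mem] with ω hω h q hq
  obtain ⟨⟨h1, h2, h3⟩, ⟨h4, h5⟩, h6⟩ := h
  have hm' : (0 : ℝ) < m := by exact_mod_cast hm
  have hpos : ∀ k, 0 < σ k ω := fun k => hlo.trans_le (hω k).1
  have hh := B.hσ_pos m
  have hhx := B.hx_pos m
  set x : ℕ → ℝ := fun j => X j ω with hx_def
  set s : ℕ → ℝ := fun j => σ j ω with hs_def
  have hT1 := T1_mem (m := m) (x := x) hh hhx hpos hq
  have hgood : ∀ j < m, θ' ≤ kap ρ (hσ m) (s j) → |x j| ≤ R →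
      q * (lo / 4) * (l * limW p gμ 0 (s j, x j) - 2 * e) ≤ 1 - T1 (hx m) (hσ m) q m x s j := by
    intro j hj hk hX
    have hk0 : 0 < kap ρ (hσ m) (s j) := hθ'.trans_le hk
    have g1 := (abs_le.1 (h1 j hj hk).1).1
    have g2 := (abs_lt.1 (h2 j hj hk)).1
    have g3 := (abs_lt.1 (h3 j hj hk)).2
    have hwm := limW_mem p gμ 0 (s j, x j)
    have hfl := D.lowC_le_fMix (hω j) hX
    have hfu := D.fMix_le (hω j).1 (x j)
    have hlw : l * limW p gμ 0 (s j, x j) ≤ fMix p gμ (s j) (x j) * limW p gμ 0 (s j, x j) := by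
      gcongr; exact hwm.1
    set N := sumA (hσ m) (hx m) m (fun k => 1 - T0 (hx m) (hσ m) 0 m x s k) x s (s j) (x j) with hN
    set S := sumS (hσ m) m (fun _ => 1) s (s j) with hS
    set K := m * kap ρ (hσ m) (s j) with hK
    have hK0 : 0 < K := by positivity
    have hT0 := T0_mem (m := m) (x := x) hh hhx hpos zero_mem_Icc
    have hN0 : 0 ≤ N := sumA_nonneg hh hhx hpos fun k _ => sub_nonneg.2 (hT0 k).2
    have hS0 : 0 < S := Finset.sum_pos (fun k _ => mul_pos one_pos (phi_pos hh _))
      ⟨j, Finset.mem_range.2 hj⟩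
    have hSK : S ≤ 2 * K := by
      have : avgS ρ 1 (hσ m) m x s (s j) = K⁻¹ * S := rfl
      rw [this] at g3
      have g4 : K⁻¹ * S < 2 := by linarith
      rw [inv_mul_lt_iff₀ hK0] at g4
      linarith
    have hKDE : N / S ≤ f1Hat0 (hx m) (hσ m) q m x s (s j) (x j) :=
      le_weightedKDE hh hhx hpos (fun k => sub_nonneg.2 (hT0 k).2)
        (fun k => sub_le_sub_left (T0_le_T0_zero hh hhx hpos hq.1 k) _)
        (fun k => by linarith [(T0_mem (m := m) (x := x) hh hhx hpos hq k).1])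
    have hNS : K⁻¹ * N / 2 ≤ N / S := by
      rw [le_div_iff₀ hS0]
      calc K⁻¹ * N / 2 * S ≤ K⁻¹ * N / 2 * (2 * K) := by gcongr
        _ = N := by field_simp
    have hν : (l * limW p gμ 0 (s j, x j) - 2 * e) / 2 ≤
        f1Hat0 (hx m) (hσ m) q m x s (s j) (x j) := by
      refine le_trans ?_ (hNS.trans hKDE)
      linarith
    have hνl : (l * limW p gμ 0 (s j, x j) - 2 * e) / 2 ≤ lo⁻¹ := by
      have : fMix p gμ (s j) (x j) * limW p gμ 0 (s j, x j) ≤ fMix p gμ (s j) (x j) :=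
        mul_le_of_le_one_right (D.fMix_nonneg (hω j).1 _) hwm.2
      have : 0 < lo⁻¹ := by positivity
      linarith
    have := mul_le_one_sub_plugInT (t := x j) hlo (hω j).1 hq
      (f1Hat0_nonneg hh hhx hpos hq (s j) (x j)) hν hνl
    refine le_trans (le_of_eq ?_) this
    ring
  have hall : ∀ j < m, q * (lo / 4) * (l * limW p gμ 0 (s j, x j) - 2 * e -
      l * badW ρ (hσ m) θ' R (s j, x j)) ≤ 1 - T1 (hx m) (hσ m) q m x s j := by
    intro j hj
    have hb := badW_mem ρ (hσ m) θ' R (s j, x j)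
    have hq0 : 0 ≤ q * (lo / 4) := mul_nonneg hq.1 (by positivity)
    by_cases hbd : kap ρ (hσ m) (s j) < θ' ∨ R < |x j|
    · have e1 : badW ρ (hσ m) θ' R (s j, x j) = 1 := by
        unfold badW; rw [Set.indicator_of_mem (by exact hbd)]; rfl
      have hwm := limW_mem p gμ 0 (s j, x j)
      rw [e1]
      have : l * limW p gμ 0 (s j, x j) ≤ l * 1 := by gcongr; exact hwm.2
      have : q * (lo / 4) * (l * limW p gμ 0 (s j, x j) - 2 * e - l * 1) ≤ 0 :=
        mul_nonpos_of_nonneg_of_nonpos hq0 (by linarith)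
      linarith [(hT1 j).2]
    · rw [not_or, not_lt, not_lt] at hbd
      refine le_trans ?_ (hgood j hj hbd.1 hbd.2)
      have := mul_nonneg hl.le hb.1
      exact mul_le_mul_of_nonneg_left (by linarith) hq0
  have hk0 : 0 < kap ρ (hσ m) σ₀ := hθ.trans_le hk₀
  have hc0 : 0 < (m * kap ρ (hσ m) σ₀)⁻¹ := by positivity
  have hsum : q * (lo / 4) * (l * avgS ρ (limW p gμ 0) (hσ m) m x s σ₀ -
      2 * e * avgS ρ 1 (hσ m) m x s σ₀ - l * avgS ρ (badW ρ (hσ m) θ' R) (hσ m) m x s σ₀) ≤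
      (m * kap ρ (hσ m) σ₀)⁻¹ * sumS (hσ m) m (fun k => 1 - T1 (hx m) (hσ m) q m x s k) s σ₀ := by
    refine le_trans (le_of_eq ?_) (mul_le_mul_of_nonneg_left (sumS_mono hh hall) hc0.le)
    rw [avgS_eq, avgS_eq, avgS_eq]
    simp only [sumS, Finset.mul_sum, ← Finset.sum_sub_distrib]
    refine Finset.sum_congr rfl fun k _ => ?_
    simp only [Pi.one_apply]; ring
  refine le_trans ?_ hsum
  have h6' := (abs_lt.1 h6).2
  have h7 : l * c ≤ l * avgS ρ (limW p gμ 0) (hσ m) m x s σ₀ := by gcongr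
  have h8 : l * avgS ρ (badW ρ (hσ m) θ' R) (hσ m) m x s σ₀ ≤ l * (c / 2) := by gcongr
  have h9 : 2 * e * avgS ρ 1 (hσ m) m x s σ₀ ≤ 2 * e * 2 := by gcongr; linarith
  have h10 : l * c / 4 ≤ l * avgS ρ (limW p gμ 0) (hσ m) m x s σ₀ -
      2 * e * avgS ρ 1 (hσ m) m x s σ₀ - l * avgS ρ (badW ρ (hσ m) θ' R) (hσ m) m x s σ₀ := by
    have : 2 * e * 2 = l * c / 4 := by rw [he]; ring
    linarith
  calc q * (l * c * (lo / 16)) = q * (lo / 4) * (l * c / 4) := by ring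
    _ ≤ _ := by gcongr; exact mul_nonneg hq.1 (by positivity)

end lower

/-! ### Integrated squared error of the two-step estimator -/

section calculus

variable {h hx t : ℝ} {m : ℕ} {w x s : ℕ → ℝ}

lemma lintegral_ofReal_comb_le {a : ℝ} {u v : ℝ → ℝ} (ha : 0 ≤ a) (hu : Measurable u) :
    ∫⁻ t, ENNReal.ofReal (a * u t + v t) ≤
      ENNReal.ofReal a * (∫⁻ t, ENNReal.ofReal (u t)) + ∫⁻ t, ENNReal.ofReal (v t) := by
  calc _ ≤ ∫⁻ t, (ENNReal.ofReal a * ENNReal.ofReal (u t) + ENNReal.ofReal (v t)) := by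
        refine lintegral_mono fun t => ?_
        rw [← ENNReal.ofReal_mul ha]
        exact ENNReal.ofReal_add_le
    _ = _ := by
        rw [lintegral_add_left (hu.ennreal_ofReal.const_mul _),
          lintegral_const_mul' _ _ ENNReal.ofReal_ne_top]

lemma lintegral_ofReal_const_mul {a : ℝ} {u : ℝ → ℝ} (ha : 0 ≤ a) :
    ∫⁻ t, ENNReal.ofReal (a * u t) = ENNReal.ofReal a * ∫⁻ t, ENNReal.ofReal (u t) := by
  simp_rw [ENNReal.ofReal_mul ha]
  exact lintegral_const_mul' _ _ ENNReal.ofReal_ne_top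

lemma measurable_sumA (h hx : ℝ) (m : ℕ) (w x s : ℕ → ℝ) (t : ℝ) :
    Measurable fun y => sumA h hx m w x s t y := by
  unfold sumA
  fun_prop

lemma lintegral_sumA (hh : 0 < h) (hhx : 0 < hx) (hs : ∀ k, 0 < s k) (hw : ∀ k, 0 ≤ w k) :
    ∫⁻ y, ENNReal.ofReal (sumA h hx m w x s t y) = ENNReal.ofReal (sumS h m w s t) := by
  have hn : ∀ k, 0 ≤ w k * phi h (t - s k) := fun k => mul_nonneg (hw k) (phi_nonneg hh.le _)
  have e : ∀ y, ENNReal.ofReal (sumA h hx m w x s t y) = ∑ k ∈ Finset.range m,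
      ENNReal.ofReal (w k * phi h (t - s k)) * ENNReal.ofReal (phi (hx * s k) (y - x k)) := by
    intro y
    rw [sumA, ENNReal.ofReal_sum_of_nonneg fun k _ => mul_nonneg (hn k)
      (phi_nonneg (mul_pos hhx (hs k)).le _)]
    exact Finset.sum_congr rfl fun k _ => ENNReal.ofReal_mul (hn k)
  simp_rw [e]
  rw [lintegral_finsetSum _ fun k _ => by fun_prop, sumS,
    ENNReal.ofReal_sum_of_nonneg fun k _ => hn k]
  refine Finset.sum_congr rfl fun k _ => ?_
  rw [lintegral_const_mul _ (by fun_prop), lintegral_phi_sub (mul_pos hhx (hs k)), mul_one]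

lemma sumA_le_mul_sumS {lo : ℝ} (hlo : 0 < lo) (hh : 0 < h) (hhx : 0 < hx) (hs : ∀ k, lo ≤ s k)
    (hw : ∀ k, 0 ≤ w k) (y : ℝ) :
    sumA h hx m w x s t y ≤ (hx * lo)⁻¹ * sumS h m w s t := by
  unfold sumA sumS
  rw [Finset.mul_sum]
  refine Finset.sum_le_sum fun k _ => ?_
  have h1 : phi (hx * s k) (y - x k) ≤ (hx * lo)⁻¹ :=
    (phi_le (mul_pos hhx (hlo.trans_le (hs k))) _).trans
      (inv_anti₀ (by positivity) (mul_le_mul_of_nonneg_left (hs k) hhx.le))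
  rw [mul_comm]
  exact mul_le_mul_of_nonneg_right h1 (mul_nonneg (hw k) (phi_nonneg hh.le _))

lemma weightedKDE_le {lo : ℝ} (hlo : 0 < lo) (hh : 0 < h) (hhx : 0 < hx) (hs : ∀ k, lo ≤ s k)
    (hw : ∀ k, 0 ≤ w k) (y : ℝ) : weightedKDE hx h m w x s t y ≤ (hx * lo)⁻¹ := by
  rw [weightedKDE_eq]
  exact div_le_of_le_mul₀ (sumS_nonneg hh fun k _ => hw k) (by positivity)
    (sumA_le_mul_sumS hlo hh hhx hs hw y)

lemma measurable_weightedKDE (h hx : ℝ) (m : ℕ) (w x s : ℕ → ℝ) (t : ℝ) :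
    Measurable fun y => weightedKDE hx h m w x s t y := by
  simp_rw [weightedKDE_eq]
  exact (measurable_sumA h hx m w x s t).div_const _

lemma lintegral_weightedKDE_le (hh : 0 < h) (hhx : 0 < hx) (hs : ∀ k, 0 < s k)
    (hw : ∀ k, 0 ≤ w k) : ∫⁻ y, ENNReal.ofReal (weightedKDE hx h m w x s t y) ≤ 1 := by
  have hS : 0 ≤ sumS h m w s t := sumS_nonneg hh fun k _ => hw k
  have e : ∀ y, weightedKDE hx h m w x s t y = (sumS h m w s t)⁻¹ * sumA h hx m w x s t y :=
    fun y => by rw [weightedKDE_eq, div_eq_inv_mul]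
  simp_rw [e]
  rw [lintegral_ofReal_const_mul (inv_nonneg.2 hS), lintegral_sumA hh hhx hs hw,
    ← ENNReal.ofReal_mul (inv_nonneg.2 hS), ENNReal.ofReal_le_one]
  exact inv_mul_le_one

lemma sq_le_of_le_of_le {G A f l : ℝ} (hG : 0 ≤ G) (hGA : G ≤ A) (hfl : f ≤ l) (hl : 0 ≤ l) :
    G ^ 2 ≤ 2 * l * G + 4 * (A - f) ^ 2 := by
  rcases le_total G (2 * f) with h | h
  · have : G * G ≤ 2 * l * G := mul_le_mul_of_nonneg_right (by linarith) hG
    nlinarith [sq_nonneg (A - f)]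
  · have h1 : (G / 2) ^ 2 ≤ (A - f) ^ 2 := by gcongr; linarith
    have := mul_nonneg hl hG
    nlinarith

lemma sq_add_four_le (a b c d : ℝ) :
    (a + b + c + d) ^ 2 ≤ 4 * (a ^ 2 + b ^ 2 + c ^ 2 + d ^ 2) := by
  linarith [sq_nonneg (a - b), sq_nonneg (a - c), sq_nonneg (a - d), sq_nonneg (b - c),
    sq_nonneg (b - d), sq_nonneg (c - d)]

lemma sq_error_le {p q r e l u v n n₀ G A f : ℝ} (hp : 0 < p) (he1 : e ≤ 1)
    (hqp : |q - p| ≤ e) (hr0 : 0 ≤ r) (hr : r ≤ 2 / p) (hr1 : |r - 1| ≤ 6 * e / p) (hu : 0 ≤ u)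
    (hul : u ≤ l) (hv : 0 ≤ v) (hvl : v ≤ l) (hnn : |n - n₀| ≤ G)
    (hG2 : G ^ 2 ≤ 2 * l * G + 4 * (A - f) ^ 2) :
    ((p - q) * u + r * (n - n₀) + r * (n₀ - p * v) + (r - 1) * (p * v)) ^ 2 ≤
      4 * l * e * u + (144 * l * e * v + (32 * l / p ^ 2 * G +
        (64 / p ^ 2 * (A - f) ^ 2 + 16 / p ^ 2 * (n₀ - p * v) ^ 2))) := by
  have he0 : 0 ≤ e := (abs_nonneg _).trans hqp
  have h3 : e ^ 2 ≤ e := by rw [sq]; exact mul_le_of_le_one_left he0 he1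
  have s1 : ((p - q) * u) ^ 2 ≤ l * e * u := by
    have h1 : (p - q) ^ 2 ≤ e := by
      rw [← sq_abs, abs_sub_comm]
      exact (pow_le_pow_left₀ (abs_nonneg _) hqp 2).trans h3
    have h2 : u ^ 2 ≤ l * u := by rw [sq]; exact mul_le_mul_of_nonneg_right hul hu
    calc ((p - q) * u) ^ 2 = (p - q) ^ 2 * u ^ 2 := mul_pow _ _ _
      _ ≤ e * (l * u) := mul_le_mul h1 h2 (sq_nonneg _) he0
      _ = _ := by ring
  have hqq : r ^ 2 ≤ 4 / p ^ 2 := by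
    calc r ^ 2 ≤ (2 / p) ^ 2 := by gcongr
      _ = 4 / p ^ 2 := by ring
  have s2 : (r * (n - n₀)) ^ 2 ≤ 8 * l / p ^ 2 * G + 16 / p ^ 2 * (A - f) ^ 2 := by
    have h2 : (n - n₀) ^ 2 ≤ 2 * l * G + 4 * (A - f) ^ 2 := by
      refine le_trans ?_ hG2
      rw [← sq_abs]
      gcongr
    calc (r * (n - n₀)) ^ 2 = r ^ 2 * (n - n₀) ^ 2 := mul_pow _ _ _
      _ ≤ 4 / p ^ 2 * (2 * l * G + 4 * (A - f) ^ 2) :=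
        mul_le_mul hqq h2 (sq_nonneg _) (by positivity)
      _ = _ := by ring
  have s3 : (r * (n₀ - p * v)) ^ 2 ≤ 4 / p ^ 2 * (n₀ - p * v) ^ 2 := by
    rw [mul_pow]
    exact mul_le_mul_of_nonneg_right hqq (sq_nonneg _)
  have s4 : ((r - 1) * (p * v)) ^ 2 ≤ 36 * l * e * v := by
    have h1 : (r - 1) ^ 2 ≤ (6 * e / p) ^ 2 := by
      rw [← sq_abs (r - 1)]
      gcongr
    have h2 : v ^ 2 ≤ l * v := by rw [sq]; exact mul_le_mul_of_nonneg_right hvl hv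
    calc ((r - 1) * (p * v)) ^ 2 = (r - 1) ^ 2 * (p ^ 2 * v ^ 2) := by ring
      _ ≤ (6 * e / p) ^ 2 * (p ^ 2 * v ^ 2) := by gcongr
      _ = 36 * e ^ 2 * v ^ 2 := by field_simp; ring
      _ ≤ 36 * e * (l * v) := by gcongr
      _ = _ := by ring
  have cs := sq_add_four_le ((p - q) * u) (r * (n - n₀)) (r * (n₀ - p * v)) ((r - 1) * (p * v))
  have e1 : 4 * (l * e * u + (8 * l / p ^ 2 * G + 16 / p ^ 2 * (A - f) ^ 2) +
      4 / p ^ 2 * (n₀ - p * v) ^ 2 + 36 * l * e * v) =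
      4 * l * e * u + (144 * l * e * v + (32 * l / p ^ 2 * G +
      (64 / p ^ 2 * (A - f) ^ 2 + 16 / p ^ 2 * (n₀ - p * v) ^ 2))) := by ring
  rw [← e1]
  linarith

lemma lintegral_f0 {s : ℝ} (hs : 0 < s) : ∫⁻ t, ENNReal.ofReal (f0 s t) = 1 := by
  simpa [f0] using lintegral_phi_sub hs 0

lemma measurable_f0 (s : ℝ) : Measurable fun t => f0 s t := by
  unfold f0; fun_prop

end calculus

section ise

variable {Ω : Type*} [MeasurableSpace Ω] {P : Measure Ω} [IsProbabilityMeasure P] {p : ℝ}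
  {gμ ρ : Measure ℝ} [IsProbabilityMeasure gμ] [IsProbabilityMeasure ρ] {lo hi M : ℝ}
  {σ X : ℕ → Ω → ℝ} {h hx q σ₀ : ℝ} {m : ℕ} {x s : ℕ → ℝ}

/-- A bound that holds without exception. -/
lemma IIDData.lintegral_fHat_sub_le (D : IIDData P p gμ ρ lo hi M σ X) (hh : 0 < h) (hhx : 0 < hx)
    (hhx1 : hx ≤ 1) (hs : ∀ k, lo ≤ s k) (hq : q ∈ Set.Icc (0 : ℝ) 1) (hσ₀ : σ₀ ∈ Set.Icc lo hi) :
    ∫⁻ t, ENNReal.ofReal ((fHat hx h q m x s σ₀ t - fMix p gμ σ₀ t) ^ 2) ≤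
      ENNReal.ofReal (10 * (hx * lo)⁻¹) := by
  have hlo := D.lo_pos
  have hpos : ∀ k, 0 < s k := fun k => hlo.trans_le (hs k)
  have hσp := hlo.trans_le hσ₀.1
  have hw : ∀ k, 0 ≤ 1 - T1 hx h q m x s k := fun k =>
    sub_nonneg.2 (T1_mem hh hhx hpos hq k).2
  set b := (hx * lo)⁻¹ with hb
  have hb0 : 0 < b := by positivity
  have hlb : lo⁻¹ ≤ b := inv_anti₀ (by positivity) (mul_le_of_le_one_left hlo.le hhx1)
  have pt : ∀ t, (fHat hx h q m x s σ₀ t - fMix p gμ σ₀ t) ^ 2 ≤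
      4 * b * f0 σ₀ t + (4 * b * f1Hat1 hx h q m x s σ₀ t + 2 * b * fMix p gμ σ₀ t) := by
    intro t
    have a1 := f0_nonneg hσp.le t
    have a2 := (f0_le hlo hσ₀.1 t).trans hlb
    have a3 := f1Hat1_nonneg (m := m) (x := x) hh hhx hpos hq σ₀ t
    have a4 : f1Hat1 hx h q m x s σ₀ t ≤ b := weightedKDE_le hlo hh hhx hs hw t
    have a5 := D.fMix_nonneg hσ₀.1 t
    have a6 := (D.fMix_le hσ₀.1 t).trans hlb
    have b1 : 0 ≤ fHat hx h q m x s σ₀ t :=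
      add_nonneg (mul_nonneg (by linarith [hq.2]) a1) (mul_nonneg hq.1 a3)
    have b2 : fHat hx h q m x s σ₀ t ≤ f0 σ₀ t + f1Hat1 hx h q m x s σ₀ t :=
      add_le_add (mul_le_of_le_one_left a1 (by linarith [hq.1])) (mul_le_of_le_one_left a3 hq.2)
    set F := fHat hx h q m x s σ₀ t
    set f := fMix p gμ σ₀ t
    set u := f0 σ₀ t
    set v := f1Hat1 hx h q m x s σ₀ t
    have c1 : F ^ 2 ≤ (u + v) ^ 2 := by gcongr
    have c2 : u * u ≤ b * u := mul_le_mul_of_nonneg_right a2 a1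
    have c3 : v * v ≤ b * v := mul_le_mul_of_nonneg_right a4 a3
    have c4 : f * f ≤ b * f := mul_le_mul_of_nonneg_right a6 a5
    nlinarith [sq_nonneg (F + f), sq_nonneg (u - v)]
  have hm1 : Measurable fun t => f1Hat1 hx h q m x s σ₀ t := measurable_weightedKDE _ _ _ _ _ _ _
  calc _ ≤ ∫⁻ t, ENNReal.ofReal (4 * b * f0 σ₀ t +
        (4 * b * f1Hat1 hx h q m x s σ₀ t + 2 * b * fMix p gμ σ₀ t)) :=
        lintegral_mono fun t => ENNReal.ofReal_le_ofReal (pt t)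
    _ ≤ ENNReal.ofReal (4 * b) * 1 + (ENNReal.ofReal (4 * b) * 1 + ENNReal.ofReal (2 * b) * 1) := by
        refine (lintegral_ofReal_comb_le (by positivity) (measurable_f0 σ₀)).trans
          (add_le_add (mul_le_mul_right (lintegral_f0 hσp).le _) ?_)
        refine (lintegral_ofReal_comb_le (by positivity) hm1).trans
          (add_le_add (mul_le_mul_right (lintegral_weightedKDE_le hh hhx hpos hw) _) ?_)
        rw [lintegral_ofReal_const_mul (by positivity), D.lintegral_fMix hσ₀.1]
    _ = ENNReal.ofReal (10 * b) := by
        rw [mul_one, mul_one, ← ENNReal.ofReal_add (by positivity) (by positivity),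
          ← ENNReal.ofReal_add (by positivity) (by positivity)]
        congr 1; ring

/-- A bound that holds when the total weight is not too small. -/
lemma IIDData.lintegral_fHat_sub_le_of_le_sumS (D : IIDData P p gμ ρ lo hi M σ X) (hh : 0 < h)
    (hhx : 0 < hx) (hs : ∀ k, lo ≤ s k) (hq : q ∈ Set.Icc (0 : ℝ) 1) (hσ₀ : σ₀ ∈ Set.Icc lo hi)
    (hm : 0 < m) (hκ : 0 < kap ρ h σ₀) {c : ℝ} (hc : 0 < c)
    (hd : q * c ≤ (m * kap ρ h σ₀)⁻¹ * sumS h m (fun k => 1 - T1 hx h q m x s k) s σ₀) :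
    ∫⁻ t, ENNReal.ofReal ((fHat hx h q m x s σ₀ t - fMix p gμ σ₀ t) ^ 2) ≤
      ENNReal.ofReal (6 * lo⁻¹ + 8 * lo⁻¹ / c ^ 2) +
        ENNReal.ofReal (8 / c ^ 2) * ise p gμ ρ 1 h hx m x s σ₀ := by
  have hlo := D.lo_pos
  have hpos : ∀ k, 0 < s k := fun k => hlo.trans_le (hs k)
  have hσp := hlo.trans_le hσ₀.1
  have hT := T1_mem (m := m) (x := x) hh hhx hpos hq
  have hm' : (0 : ℝ) < m := by exact_mod_cast hm
  have hK0 : 0 < m * kap ρ h σ₀ := by positivity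
  have pt : ∀ t, (fHat hx h q m x s σ₀ t - fMix p gμ σ₀ t) ^ 2 ≤
      4 * lo⁻¹ * f0 σ₀ t + ((2 * lo⁻¹ + 8 * lo⁻¹ / c ^ 2) * fMix p gμ σ₀ t +
        8 / c ^ 2 * (avgA ρ 1 h hx m x s σ₀ t - fMix p gμ σ₀ t) ^ 2) := by
    intro t
    have a1 := f0_nonneg hσp.le t
    have a2 := f0_le hlo hσ₀.1 t
    have a3 := f1Hat1_nonneg (m := m) (x := x) hh hhx hpos hq σ₀ t
    have a5 := D.fMix_nonneg hσ₀.1 t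
    have a6 := D.fMix_le hσ₀.1 t
    have a7 : q * f1Hat1 hx h q m x s σ₀ t ≤ avgA ρ 1 h hx m x s σ₀ t / c := by
      rw [f1Hat1, weightedKDE_eq_div hK0.ne']
      set n := sumA h hx m (fun k => 1 - T1 hx h q m x s k) x s σ₀ t with hn
      set d := (m * kap ρ h σ₀)⁻¹ * sumS h m (fun k => 1 - T1 hx h q m x s k) s σ₀
      have hn0 : 0 ≤ n := sumA_nonneg hh hhx hpos fun k _ => sub_nonneg.2 (hT k).2
      have hnA : (m * kap ρ h σ₀)⁻¹ * n ≤ avgA ρ 1 h hx m x s σ₀ t := by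
        rw [avgA_eq]
        refine mul_le_mul_of_nonneg_left (sumA_mono hh hhx hpos fun k _ => ?_) (by positivity)
        simp only [Pi.one_apply]
        linarith [(hT k).1]
      have hn1 : 0 ≤ (m * kap ρ h σ₀)⁻¹ * n := by positivity
      rcases hq.1.eq_or_lt with h0 | h0
      · rw [← h0, zero_mul]
        exact div_nonneg (hn1.trans hnA) hc.le
      · have hd0 : 0 < d := (mul_pos h0 hc).trans_le hd
        rw [le_div_iff₀ hc, mul_div_assoc', div_mul_eq_mul_div, div_le_iff₀ hd0]
        calc q * ((m * kap ρ h σ₀)⁻¹ * n) * c = ((m * kap ρ h σ₀)⁻¹ * n) * (q * c) := by ring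
          _ ≤ avgA ρ 1 h hx m x s σ₀ t * d :=
            mul_le_mul hnA hd (mul_nonneg hq.1 hc.le) (hn1.trans hnA)
    have b0 := mul_nonneg hq.1 a3
    have b1 : 0 ≤ fHat hx h q m x s σ₀ t :=
      add_nonneg (mul_nonneg (by linarith [hq.2]) a1) b0
    have b2 : fHat hx h q m x s σ₀ t ≤ f0 σ₀ t + avgA ρ 1 h hx m x s σ₀ t / c :=
      add_le_add (mul_le_of_le_one_left a1 (by linarith [hq.1])) a7
    set F := fHat hx h q m x s σ₀ t
    set f := fMix p gμ σ₀ t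
    set u := f0 σ₀ t
    set A := avgA ρ 1 h hx m x s σ₀ t
    have c1 : F ^ 2 ≤ (u + A / c) ^ 2 := by gcongr
    have c2 : u * u ≤ lo⁻¹ * u := mul_le_mul_of_nonneg_right a2 a1
    have c4 : f * f ≤ lo⁻¹ * f := mul_le_mul_of_nonneg_right a6 a5
    have c5 : (A / c) ^ 2 ≤ 2 / c ^ 2 * (A - f) ^ 2 + 2 * lo⁻¹ / c ^ 2 * f := by
      have : A ^ 2 ≤ 2 * (A - f) ^ 2 + 2 * lo⁻¹ * f := by nlinarith [sq_nonneg (A - 2 * f)]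
      calc (A / c) ^ 2 = A ^ 2 / c ^ 2 := div_pow _ _ _
        _ ≤ (2 * (A - f) ^ 2 + 2 * lo⁻¹ * f) / c ^ 2 := by gcongr
        _ = _ := by ring
    have e1 : (2 * lo⁻¹ + 8 * lo⁻¹ / c ^ 2) * f + 8 / c ^ 2 * (A - f) ^ 2 =
        2 * lo⁻¹ * f + 4 * (2 / c ^ 2 * (A - f) ^ 2 + 2 * lo⁻¹ / c ^ 2 * f) := by ring
    rw [e1]
    nlinarith [sq_nonneg (F + f), sq_nonneg (u - A / c)]
  have hmf : Measurable fun t => fMix p gμ σ₀ t := measurable_fMix.comp measurable_prodMk_left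
  calc _ ≤ ∫⁻ t, ENNReal.ofReal (4 * lo⁻¹ * f0 σ₀ t + ((2 * lo⁻¹ + 8 * lo⁻¹ / c ^ 2) *
        fMix p gμ σ₀ t + 8 / c ^ 2 * (avgA ρ 1 h hx m x s σ₀ t - fMix p gμ σ₀ t) ^ 2)) :=
        lintegral_mono fun t => ENNReal.ofReal_le_ofReal (pt t)
    _ ≤ ENNReal.ofReal (4 * lo⁻¹) * 1 + (ENNReal.ofReal (2 * lo⁻¹ + 8 * lo⁻¹ / c ^ 2) * 1 +
        ENNReal.ofReal (8 / c ^ 2) * ise p gμ ρ 1 h hx m x s σ₀) := by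
        refine (lintegral_ofReal_comb_le (by positivity) (measurable_f0 σ₀)).trans
          (add_le_add (mul_le_mul_right (lintegral_f0 hσp).le _) ?_)
        refine (lintegral_ofReal_comb_le (by positivity) hmf).trans
          (add_le_add (mul_le_mul_right (D.lintegral_fMix hσ₀.1).le _) ?_)
        rw [lintegral_ofReal_const_mul (by positivity)]
        simp [ise]
    _ = _ := by
        rw [mul_one, mul_one, ← add_assoc, ← ENNReal.ofReal_add (by positivity) (by positivity)]
        congr 2; ring

/-- The constant in the bound for the integrated squared error when the weights are accurate. -/
noncomputable def iseC (lo p : ℝ) : ℝ := 148 * lo⁻¹ + 32 * lo⁻¹ / p ^ 2 + 64 / p ^ 2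

/-- A bound that holds when the weights are accurate. -/
lemma IIDData.lintegral_fHat_sub_le_of_accurate (D : IIDData P p gμ ρ lo hi M σ X) (hh : 0 < h)
    (hhx : 0 < hx) (hs : ∀ k, lo ≤ s k) (hq : q ∈ Set.Icc (0 : ℝ) 1) (hσ₀ : σ₀ ∈ Set.Icc lo hi)
    (hm : 0 < m) (hκ : 0 < kap ρ h σ₀) {e : ℝ} (he1 : e ≤ 1) (hep : 4 * e ≤ p)
    (hqp : |q - p| ≤ e)
    (hg : (m * kap ρ h σ₀)⁻¹ * sumS h m
      (fun k => |1 - T1 hx h q m x s k - limW p gμ p (s k, x k)|) s σ₀ ≤ e)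
    (hd : |avgS ρ (limW p gμ p) h m x s σ₀ - p| ≤ e) :
    ∫⁻ t, ENNReal.ofReal ((fHat hx h q m x s σ₀ t - fMix p gμ σ₀ t) ^ 2) ≤
      ENNReal.ofReal (iseC lo p * e) + ENNReal.ofReal (iseC lo p) *
        (ise p gμ ρ 1 h hx m x s σ₀ + ise p gμ ρ (limW p gμ p) h hx m x s σ₀) := by
  have hlo := D.lo_pos
  have hp := D.p_pos
  have he0 : 0 ≤ e := (abs_nonneg _).trans hqp
  have hpos : ∀ k, 0 < s k := fun k => hlo.trans_le (hs k)
  have hσp := hlo.trans_le hσ₀.1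
  have hT := T1_mem (m := m) (x := x) hh hhx hpos hq
  have hm' : (0 : ℝ) < m := by exact_mod_cast hm
  have hK0 : 0 < m * kap ρ h σ₀ := by positivity
  set K := m * kap ρ h σ₀ with hK
  have hKi : 0 < K⁻¹ := by positivity
  set w : ℕ → ℝ := fun k => 1 - T1 hx h q m x s k with hw
  set w₀ : ℕ → ℝ := fun k => limW p gμ p (s k, x k) with hw₀
  set G : ℝ → ℝ := fun t => K⁻¹ * sumA h hx m (fun k => |w k - w₀ k|) x s σ₀ t with hG
  set d := K⁻¹ * sumS h m w s σ₀ with hd_def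
  have hdp : |d - p| ≤ 2 * e := by
    have h1 : |d - avgS ρ (limW p gμ p) h m x s σ₀| ≤ e := by
      rw [avgS_eq, hd_def, ← mul_sub, ← sumS_sub, abs_mul, abs_of_pos hKi]
      exact (mul_le_mul_of_nonneg_left (abs_sumS_le hh) hKi.le).trans hg
    have := (abs_sub_le _ _ _).trans (add_le_add h1 hd)
    linarith
  have hd2 : p / 2 ≤ d := by
    have := (abs_le.1 hdp).1
    linarith
  have hd0 : 0 < d := by linarith
  have hqd : q / d ≤ 2 / p := by
    calc q / d ≤ 1 / (p / 2) := by gcongr; exact hq.2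
      _ = 2 / p := by field_simp
  have hqd0 : 0 ≤ q / d := div_nonneg hq.1 hd0.le
  have hqd1 : |q / d - 1| ≤ 6 * e / p := by
    rw [div_sub_one hd0.ne', abs_div, abs_of_pos hd0]
    have h1 : |q - d| ≤ 3 * e := by
      have := abs_sub_le q p d
      rw [abs_sub_comm p d] at this
      linarith
    calc |q - d| / d ≤ 3 * e / (p / 2) := by gcongr
      _ = 6 * e / p := by field_simp; ring
  have pt : ∀ t, (fHat hx h q m x s σ₀ t - fMix p gμ σ₀ t) ^ 2 ≤
      4 * lo⁻¹ * e * f0 σ₀ t + (144 * lo⁻¹ * e * f1 gμ σ₀ t + (32 * lo⁻¹ / p ^ 2 * G t +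
        (64 / p ^ 2 * (avgA ρ 1 h hx m x s σ₀ t - fMix p gμ σ₀ t) ^ 2 +
        16 / p ^ 2 * (avgA ρ (limW p gμ p) h hx m x s σ₀ t -
          fMix p gμ σ₀ t * limW p gμ p (σ₀, t)) ^ 2))) := by
    intro t
    have a1 := f0_nonneg hσp.le t
    have a2 := f0_le hlo hσ₀.1 t
    have a3 := f1_nonneg hσp.le t gμ
    have a4 := f1_le_of_le (G := gμ) hlo hσ₀.1 t
    have a6 := D.fMix_le hσ₀.1 t
    have hl0 : 0 ≤ lo⁻¹ := by positivity
    have hG0 : 0 ≤ G t := mul_nonneg hKi.le (sumA_nonneg hh hhx hpos fun k _ => abs_nonneg _)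
    have hGA : G t ≤ avgA ρ 1 h hx m x s σ₀ t := by
      rw [avgA_eq]
      refine mul_le_mul_of_nonneg_left (sumA_mono hh hhx hpos fun k _ => ?_) hKi.le
      have h1 := limW_mem p gμ p (s k, x k)
      have h2 := hT k
      simp only [Pi.one_apply, hw, hw₀]
      rw [abs_le]
      constructor <;> linarith [h1.1, h1.2, h2.1, h2.2]
    have hG2 := sq_le_of_le_of_le hG0 hGA a6 hl0
    set n := K⁻¹ * sumA h hx m w x s σ₀ t with hn
    set n₀ := avgA ρ (limW p gμ p) h hx m x s σ₀ t with hn₀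
    have hnn : |n - n₀| ≤ G t := by
      rw [hn₀, avgA_eq, hn, ← mul_sub, ← sumA_sub, abs_mul, abs_of_pos hKi]
      exact mul_le_mul_of_nonneg_left (abs_sumA_le hh hhx hpos) hKi.le
    rw [D.fMix_mul_limW_self hσ₀]
    have hf : fHat hx h q m x s σ₀ t - fMix p gμ σ₀ t = (p - q) * f0 σ₀ t + (q / d) * (n - n₀) +
        (q / d) * (n₀ - p * f1 gμ σ₀ t) + (q / d - 1) * (p * f1 gμ σ₀ t) := by
      have : f1Hat1 hx h q m x s σ₀ t = n / d := weightedKDE_eq_div hK0.ne'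
      rw [fHat, this, fMix]
      field_simp; ring
    rw [hf]
    set A := avgA ρ 1 h hx m x s σ₀ t
    set f := fMix p gμ σ₀ t
    set u := f0 σ₀ t
    set v := f1 gμ σ₀ t
    exact sq_error_le hp he1 hqp hqd0 hqd hqd1 a1 a2 a3 a4 hnn hG2
  have hmf : Measurable fun t => fMix p gμ σ₀ t := measurable_fMix.comp measurable_prodMk_left
  have hm1 : Measurable fun t => f1 gμ σ₀ t := (measurable_f1 gμ).comp measurable_prodMk_left
  have hmG : Measurable G := (measurable_sumA _ _ _ _ _ _ _).const_mul _
  have hmA : Measurable fun t => (avgA ρ 1 h hx m x s σ₀ t - fMix p gμ σ₀ t) ^ 2 :=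
    (((measurable_sumA _ _ _ _ _ _ _).const_mul _).sub hmf).pow_const 2
  have hGi : ∫⁻ t, ENNReal.ofReal (G t) ≤ ENNReal.ofReal e := by
    rw [hG, lintegral_ofReal_const_mul hKi.le, lintegral_sumA hh hhx hpos fun k => abs_nonneg _,
      ← ENNReal.ofReal_mul hKi.le]
    exact ENNReal.ofReal_le_ofReal hg
  calc _ ≤ _ := lintegral_mono fun t => ENNReal.ofReal_le_ofReal (pt t)
    _ ≤ ENNReal.ofReal (4 * lo⁻¹ * e) * 1 + (ENNReal.ofReal (144 * lo⁻¹ * e) * 1 +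
        (ENNReal.ofReal (32 * lo⁻¹ / p ^ 2) * ENNReal.ofReal e +
        (ENNReal.ofReal (64 / p ^ 2) * ise p gμ ρ 1 h hx m x s σ₀ +
        ENNReal.ofReal (16 / p ^ 2) * ise p gμ ρ (limW p gμ p) h hx m x s σ₀))) := by
        refine (lintegral_ofReal_comb_le (by positivity) (measurable_f0 σ₀)).trans
          (add_le_add (mul_le_mul_right (lintegral_f0 hσp).le _) ?_)
        refine (lintegral_ofReal_comb_le (by positivity) hm1).trans
          (add_le_add (mul_le_mul_right (lintegral_f1 hσp).le _) ?_)
        refine (lintegral_ofReal_comb_le (by positivity) hmG).trans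
          (add_le_add (mul_le_mul_right hGi _) ?_)
        refine (lintegral_ofReal_comb_le (by positivity) hmA).trans (add_le_add ?_ ?_)
        · simp [ise]
        · rw [lintegral_ofReal_const_mul (by positivity), ise]
    _ = ENNReal.ofReal ((148 * lo⁻¹ + 32 * lo⁻¹ / p ^ 2) * e) +
        (ENNReal.ofReal (64 / p ^ 2) * ise p gμ ρ 1 h hx m x s σ₀ +
        ENNReal.ofReal (16 / p ^ 2) * ise p gμ ρ (limW p gμ p) h hx m x s σ₀) := by
        rw [mul_one, mul_one, ← ENNReal.ofReal_mul (by positivity), ← add_assoc, ← add_assoc,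
          ← ENNReal.ofReal_add (by positivity) (by positivity),
          ← ENNReal.ofReal_add (by positivity) (by positivity)]
        congr 2; ring
    _ ≤ _ := by
        have hc1 : 0 ≤ 64 / p ^ 2 := by positivity
        have hc2 : 0 ≤ 148 * lo⁻¹ := by positivity
        have hc3 : 0 ≤ 32 * lo⁻¹ / p ^ 2 := by positivity
        have hc4 : 16 / p ^ 2 ≤ 64 / p ^ 2 := by gcongr; norm_num
        rw [mul_add]
        refine add_le_add (ENNReal.ofReal_le_ofReal (mul_le_mul_of_nonneg_right ?_ he0))
          (add_le_add (mul_le_mul_left (ENNReal.ofReal_le_ofReal ?_) _)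
            (mul_le_mul_left (ENNReal.ofReal_le_ofReal ?_) _)) <;> unfold iseC <;> linarith

end ise

/-! ### Convergence of the mean integrated squared error -/

section convergence

variable {Ω : Type*} [MeasurableSpace Ω] {P : Measure Ω} [IsProbabilityMeasure P] {p : ℝ}
  {gμ ρ : Measure ℝ} [IsProbabilityMeasure gμ] [IsProbabilityMeasure ρ] {lo hi M : ℝ}
  {σ X : ℕ → Ω → ℝ} {hx hσ : ℕ → ℝ} {pHat : ℕ → Ω → ℝ}

lemma lintegral_le_of_dichotomies {F I J : Ω → ENNReal} {a b c d g : ENNReal} {N₁ N₂ : Set Ω}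
    (hI : Measurable I) (hJ : Measurable J)
    (h1 : ∀ᵐ ω ∂P, ω ∉ N₁ → F ω ≤ a + b * (I ω + J ω))
    (h2 : ∀ᵐ ω ∂P, ω ∉ N₂ → F ω ≤ c + d * I ω) (h3 : ∀ᵐ ω ∂P, F ω ≤ g) :
    ∫⁻ ω, F ω ∂P ≤ a + (b * (∫⁻ ω, I ω ∂P + ∫⁻ ω, J ω ∂P) + d * ∫⁻ ω, I ω ∂P + c * P N₁ +
      g * P N₂) := by
  have hm1 := measurableSet_toMeasurable P N₁
  have hm2 := measurableSet_toMeasurable P N₂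
  have pt : ∀ᵐ ω ∂P, F ω ≤ a + (b * (I ω + J ω) + d * I ω +
      (toMeasurable P N₁).indicator (fun _ => c) ω +
      (toMeasurable P N₂).indicator (fun _ => g) ω) := by
    filter_upwards [h1, h2, h3] with ω k1 k2 k3
    by_cases c2 : ω ∈ N₂
    · rw [Set.indicator_of_mem (subset_toMeasurable P N₂ c2)]
      exact k3.trans (le_add_left le_add_self)
    · by_cases c1 : ω ∈ N₁
      · rw [Set.indicator_of_mem (subset_toMeasurable P N₁ c1)]
        refine (k2 c2).trans (le_add_left (le_add_right ?_))
        rw [add_comm c]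
        exact add_le_add le_add_self le_rfl
      · refine (k1 c1).trans (add_le_add le_rfl ?_)
        rw [add_assoc, add_assoc]
        exact le_add_right le_rfl
  refine (lintegral_mono_ae pt).trans (le_of_eq ?_)
  rw [lintegral_add_left measurable_const, lintegral_add_right _ (measurable_const.indicator hm2),
    lintegral_add_right _ (measurable_const.indicator hm1), lintegral_add_right _ (hI.const_mul d),
    lintegral_const_mul b (f := fun ω => I ω + J ω) (hI.add hJ), lintegral_add_left hI, lintegral_const_mul _ hI,
    lintegral_indicator_const hm1, lintegral_indicator_const hm2, measure_toMeasurable,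
    measure_toMeasurable]
  simp

/-- The mean integrated squared error vanishes at a scale that is not isolated. -/
lemma IIDData.tendsto_mise (D : IIDData P p gμ ρ lo hi M σ X) (B : BandwidthCondition hx hσ)
    (h0 : gμ {0} = 0) (hpHat_mem : ∀ m, ∀ᵐ ω ∂P, pHat m ω ∈ Set.Icc (0 : ℝ) 1)
    (hpHat : ∀ η : ℝ, 0 < η → Likely P 1 fun m ω => |pHat m ω - p| ≤ η) {σ₀ : ℝ}
    (hσ₀ : σ₀ ∈ Set.Icc lo hi) {θ : ℝ} (hθ : 0 < θ) (h₀ : ∀ᶠ m in atTop, θ ≤ kap ρ (hσ m) σ₀) :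
    Tendsto (fun m => mise P p gμ σ X (hx m) (hσ m) (pHat m) m σ₀) atTop (𝓝 0) := by
  have hlo := D.lo_pos
  have hp := D.p_pos
  have hpm : p ∈ Set.Icc (0 : ℝ) 1 := ⟨D.p_pos.le, D.p_le_one⟩
  obtain ⟨c, hc, hcL⟩ := D.exists_likely_le_sumS B h0 hσ₀ hθ h₀
  have hC : 0 < iseC lo p := by unfold iseC; positivity
  have hw := measurable_limW p gμ p
  have I1 := D.tendsto_lintegral_ise B measurable_one one_mem_Icc (by positivity)
    D.fMix_mul_one_lipschitz hθ hσ₀ h₀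
  have I2 := D.tendsto_lintegral_ise B hw (limW_mem p gμ p) (by positivity)
    (D.fMix_mul_limW_lipschitz hpm) hθ hσ₀ h₀
  rw [ENNReal.tendsto_nhds_zero]
  intro τ hτ
  obtain ⟨e, he0, he1, hep, heτ⟩ : ∃ e : ℝ, 0 < e ∧ e ≤ 1 ∧ 4 * e ≤ p ∧
      ENNReal.ofReal (iseC lo p * e) ≤ τ / 2 := by
    have ht : Tendsto (fun e : ℝ => ENNReal.ofReal (iseC lo p * e)) (𝓝[>] 0) (𝓝 0) := by
      have h1 : Tendsto (fun e : ℝ => iseC lo p * e) (𝓝 0) (𝓝 0) := by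
        simpa using (continuous_const_mul (iseC lo p)).tendsto 0
      have h2 := (ENNReal.continuous_ofReal.tendsto 0).comp 
        (h1.mono_left (nhdsWithin_le_nhds (s := Set.Ioi 0)))
      rwa [ENNReal.ofReal_zero] at h2
    have h2 := (ENNReal.tendsto_nhds_zero.1 ht) (τ / 2) (ENNReal.half_pos hτ.ne')
    have h3 : ∀ᶠ e : ℝ in 𝓝[>] 0, e < min 1 (p / 4) :=
      nhdsWithin_le_nhds (Iio_mem_nhds (by positivity))
    obtain ⟨e, k1, k2, k3⟩ := (h2.and (h3.and self_mem_nhdsWithin)).exists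
    refine ⟨e, k3, (k2.trans_le (min_le_left _ _)).le, ?_, k1⟩
    have := k2.trans_le (min_le_right _ _)
    linarith
  have L1 := D.likely_sumS_abs_fixed B eventually_one_le_natCast
    (D.consistentT_T1 B hpHat_mem hpHat) (D.ae_T1_mem B hpHat_mem) hθ he0 h₀
  have L2 := (D.likely_avgS_fixed B hw (limW_mem p gμ p) D.integral_limW_self hθ he0
    h₀).of_le eventually_one_le_natCast
  have LN := (hpHat e he0).and (L1.and L2)
  set N₁ : ℕ → Set Ω := fun m => {ω | ¬(|pHat m ω - p| ≤ e ∧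
    (m * kap ρ (hσ m) σ₀)⁻¹ * sumS (hσ m) m (fun k => |1 - T1 (hx m) (hσ m) (pHat m ω) m
      (fun j => X j ω) (fun j => σ j ω) k - limW p gμ p (σ k ω, X k ω)|) (fun j => σ j ω) σ₀ ≤ e ∧
    |avgS ρ (limW p gμ p) (hσ m) m (fun j => X j ω) (fun j => σ j ω) σ₀ - p| < e)} with hN₁
  set N₂ : ℕ → Set Ω := fun m => {ω | ¬∀ q ∈ Set.Icc (0 : ℝ) 1,
      q * c ≤ (m * kap ρ (hσ m) σ₀)⁻¹ * sumS (hσ m) m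
        (fun k => 1 - T1 (hx m) (hσ m) q m (fun j => X j ω) (fun j => σ j ω) k)
        (fun j => σ j ω) σ₀} with hN₂
  have hN1 : Tendsto (fun m => P (N₁ m)) atTop (𝓝 0) := by
    refine Tendsto.congr (fun m => ?_) LN
    simp only [Pi.one_apply, one_mul, hN₁]
  have hN2 : Tendsto (fun m : ℕ => (m : ENNReal) * P (N₂ m)) atTop (𝓝 0) := hcL
  set b := ENNReal.ofReal (iseC lo p)
  set C := ENNReal.ofReal (6 * lo⁻¹ + 8 * lo⁻¹ / c ^ 2)
  set d := ENNReal.ofReal (8 / c ^ 2)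
  set g := ENNReal.ofReal (10 * lo⁻¹)
  have lim : Tendsto (fun m : ℕ => b * (∫⁻ ω, ise p gμ ρ 1 (hσ m) (hx m) m (fun j => X j ω)
      (fun j => σ j ω) σ₀ ∂P + ∫⁻ ω, ise p gμ ρ (limW p gμ p) (hσ m) (hx m) m (fun j => X j ω)
      (fun j => σ j ω) σ₀ ∂P) + d * (∫⁻ ω, ise p gμ ρ 1 (hσ m) (hx m) m (fun j => X j ω)
      (fun j => σ j ω) σ₀ ∂P) + C * P (N₁ m) + g * (m * P (N₂ m))) atTop (𝓝 0) := by
    have t1 := ENNReal.Tendsto.const_mul (I1.add I2) (Or.inr (ENNReal.ofReal_ne_top (r := iseC lo p)))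
    have t2 := ENNReal.Tendsto.const_mul I1 (Or.inr (ENNReal.ofReal_ne_top (r := 8 / c ^ 2)))
    have t3 := ENNReal.Tendsto.const_mul hN1
      (Or.inr (ENNReal.ofReal_ne_top (r := 6 * lo⁻¹ + 8 * lo⁻¹ / c ^ 2)))
    have t4 := ENNReal.Tendsto.const_mul hN2 (Or.inr (ENNReal.ofReal_ne_top (r := 10 * lo⁻¹)))
    have := ((t1.add t2).add t3).add t4
    simpa only [add_zero, mul_zero] using this
  filter_upwards [(ENNReal.tendsto_nhds_zero.1 lim) (τ / 2) (ENNReal.half_pos hτ.ne'),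
    B.mul_hx_atTop.eventually_ge_atTop 1, B.hx_zero.eventually_lt_const one_pos,
    eventually_gt_atTop 0, h₀] with m hlim hmx hx1 hm hk
  have hh := B.hσ_pos m
  have hhx := B.hx_pos m
  have hk0 := hθ.trans_le hk
  have key := lintegral_le_of_dichotomies (P := P) (N₁ := N₁ m) (N₂ := N₂ m)
    (F := fun ω => ∫⁻ t : ℝ, ENNReal.ofReal ((fHat (hx m) (hσ m) (pHat m ω) m (fun j => X j ω)
      (fun j => σ j ω) σ₀ t - fMix p gμ σ₀ t) ^ 2))
    (a := ENNReal.ofReal (iseC lo p * e)) (b := b) (c := C) (d := d)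
    (g := ENNReal.ofReal (10 * (hx m * lo)⁻¹))
    (D.measurable_ise measurable_one (hσ m) (hx m) m σ₀)
    (D.measurable_ise hw (hσ m) (hx m) m σ₀)
    (by
      filter_upwards [D.ae_all_mem, hpHat_mem m] with ω hω hq hN
      obtain ⟨k1, k2, k3⟩ := not_not.1 hN
      exact D.lintegral_fHat_sub_le_of_accurate hh hhx (fun k => (hω k).1) hq hσ₀ hm hk0 he1 hep
        k1 k2 k3.le)
    (by
      filter_upwards [D.ae_all_mem, hpHat_mem m] with ω hω hq hN
      exact D.lintegral_fHat_sub_le_of_le_sumS hh hhx (fun k => (hω k).1) hq hσ₀ hm hk0 hc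
        (not_not.1 hN _ hq))
    (by
      filter_upwards [D.ae_all_mem, hpHat_mem m] with ω hω hq
      exact D.lintegral_fHat_sub_le hh hhx hx1.le (fun k => (hω k).1) hq hσ₀)
  have hgm : ENNReal.ofReal (10 * (hx m * lo)⁻¹) ≤ g * m := by
    rw [← ENNReal.ofReal_natCast, ← ENNReal.ofReal_mul (by positivity)]
    refine ENNReal.ofReal_le_ofReal ?_
    have : (hx m)⁻¹ ≤ m := by rwa [inv_le_iff_one_le_mul₀ hhx]
    rw [mul_inv]
    calc 10 * ((hx m)⁻¹ * lo⁻¹) ≤ 10 * (m * lo⁻¹) := by gcongr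
      _ = _ := by ring
  refine key.trans ?_
  rw [← ENNReal.add_halves τ]
  refine add_le_add heτ (le_trans (add_le_add le_rfl ?_) hlim)
  rw [← mul_assoc]
  exact mul_le_mul_left hgm _

end convergence

/-! ### Scales of positive lower density -/

section density

lemma eventually_le_kap {gσ : Measure ℝ} [IsProbabilityMeasure gσ] {σ₀ : ℝ} (hσ₀ : 0 < σ₀)
    (hd : PosLowerDensity gσ (σ₀ ^ 2)) {h : ℕ → ℝ} (hpos : ∀ m, 0 < h m)
    (hh : Tendsto h atTop (𝓝 0)) :
    ∃ θ : ℝ, 0 < θ ∧ ∀ᶠ m in atTop, θ ≤ kap (gσ.map Real.sqrt) (h m) σ₀ := by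
  obtain ⟨c, hc, hcr⟩ := hd
  have hC := massC_pos
  have hs : Measurable Real.sqrt := Real.continuous_sqrt.measurable
  have hprob : IsProbabilityMeasure (gσ.map Real.sqrt) :=
    Measure.isProbabilityMeasure_map hs.aemeasurable
  refine ⟨massC⁻¹ * (c * σ₀), by positivity, ?_⟩
  have ht : Tendsto (fun m => h m * σ₀) atTop (𝓝[>] 0) := by
    refine tendsto_nhdsWithin_iff.2 ⟨by simpa using hh.mul_const σ₀, Eventually.of_forall fun m => ?_⟩
    exact mul_pos (hpos m) hσ₀
  filter_upwards [ht.eventually hcr] with m hm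
  have hm0 := hpos m
  have h_int := integrable_phi_measure hm0 σ₀ (gσ.map Real.sqrt)
  set A := Metric.closedBall (σ₀ ^ 2) (h m * σ₀) with hA
  have hsub : ∀ v ∈ A, phi (h m) (h m) ≤ phi (h m) (σ₀ - √v) := by
    intro v hv
    refine phi_anti hm0.le ?_
    rw [abs_of_pos hm0]
    rw [hA, Metric.mem_closedBall, Real.dist_eq] at hv
    rcases le_total 0 v with h0 | h0
    · have e : v - σ₀ ^ 2 = (√v - σ₀) * (√v + σ₀) := by
        have := Real.sq_sqrt h0
        nlinarith
      have hv0 := Real.sqrt_nonneg v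
      rw [e, abs_mul, abs_of_pos (by linarith : 0 < √v + σ₀), abs_sub_comm] at hv
      refine le_of_mul_le_mul_right (le_trans ?_ hv) hσ₀
      exact mul_le_mul_of_nonneg_left (by linarith) (abs_nonneg _)
    · rw [Real.sqrt_eq_zero_of_nonpos h0, sub_zero, abs_of_pos hσ₀]
      have := (abs_le.1 hv).1
      have h2 : σ₀ * σ₀ ≤ h m * σ₀ := by nlinarith
      exact le_of_mul_le_mul_right h2 hσ₀
  have e : kap (gσ.map Real.sqrt) (h m) σ₀ = ∫ v, phi (h m) (σ₀ - √v) ∂gσ :=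
    integral_map hs.aemeasurable h_int.aestronglyMeasurable
  have h_int' : Integrable (fun v => phi (h m) (σ₀ - √v)) gσ :=
    (integrable_map_measure h_int.aestronglyMeasurable hs.aemeasurable).1 h_int
  rw [e]
  have hreal : c * (h m * σ₀) ≤ gσ.real A := by
    have := ENNReal.toReal_mono (measure_ne_top _ _) hm
    rwa [ENNReal.toReal_ofReal (by positivity)] at this
  calc massC⁻¹ * (c * σ₀) = phi (h m) (h m) * (c * (h m * σ₀)) := by
        rw [phi_self hm0]; field_simp
    _ ≤ phi (h m) (h m) * gσ.real A := mul_le_mul_of_nonneg_left hreal (phi_nonneg hm0.le _)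
    _ = ∫ v in A, phi (h m) (h m) ∂gσ := by
        rw [setIntegral_const, smul_eq_mul, mul_comm]
    _ ≤ ∫ v in A, phi (h m) (σ₀ - √v) ∂gσ :=
        setIntegral_mono_on (by simp) h_int'.integrableOn Metric.isClosed_closedBall.measurableSet hsub
    _ ≤ _ := setIntegral_le_integral h_int' (ae_of_all _ fun v => phi_nonneg hm0.le _)

/-- A finite measure on the line has positive lower density at almost all of its points. -/
lemma ae_posLowerDensity (ν : Measure ℝ) [IsFiniteMeasure ν] : ∀ᵐ v ∂ν, PosLowerDensity ν v := by
  filter_upwards [Besicovitch.ae_tendsto_rnDeriv (volume : Measure ℝ) ν,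
    Measure.rnDeriv_lt_top (volume : Measure ℝ) ν] with v hv hfin
  set K := ((volume : Measure ℝ).rnDeriv ν v).toReal + 1 with hK
  have hK0 : 0 < K := by positivity
  have hlt : (volume : Measure ℝ).rnDeriv ν v < ENNReal.ofReal K := by
    rw [hK, ENNReal.ofReal_add ENNReal.toReal_nonneg zero_le_one, ENNReal.ofReal_toReal hfin.ne,
      ENNReal.ofReal_one]
    exact ENNReal.lt_add_right hfin.ne one_ne_zero
  refine ⟨2 / K, by positivity, ?_⟩
  filter_upwards [hv.eventually_lt_const hlt, self_mem_nhdsWithin] with r hr hr0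
  have h1 := (ENNReal.div_le_iff_le_mul (Or.inr ENNReal.ofReal_ne_top)
    (Or.inl (measure_ne_top _ _))).1 hr.le
  rw [Real.volume_closedBall] at h1
  have e : ENNReal.ofReal (2 / K * r) = ENNReal.ofReal (2 * r) / ENNReal.ofReal K := by
    rw [← ENNReal.ofReal_div_of_pos hK0]
    congr 1; ring
  rw [e]
  exact ENNReal.div_le_of_le_mul' h1

end density

variable {Ω : Type*} [MeasurableSpace Ω] {P : Measure Ω} [IsProbabilityMeasure P] {p : ℝ}
  {gμ gσ : Measure ℝ} [IsProbabilityMeasure gμ] [IsProbabilityMeasure gσ] {μ σ X : ℕ → Ω → ℝ}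

/-- The scales can be taken in a compact interval that contains a prescribed point. -/
lemma Model.exists_iidData (hmodel : Model P p gμ gσ μ σ X) (hsupp : SupportCondition gμ gσ)
    {σ₀ : ℝ} (hσ₀ : 0 < σ₀) : ∃ lo hi M, σ₀ ∈ Set.Icc lo hi ∧
      IIDData P p gμ (gσ.map Real.sqrt) lo hi M σ X := by
  obtain ⟨M₁, M₂, M, hM₁, hsσ, hsμ⟩ := hsupp
  have hσae : ∀ᵐ v ∂gσ, v ∈ Set.Ioo M₁ M₂ := by
    filter_upwards [Measure.support_mem_ae (μ := gσ)] with v hv using hsσ hv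
  have hμae : ∀ᵐ u ∂gμ, |u| ≤ max M 0 := by
    filter_upwards [Measure.support_mem_ae (μ := gμ)] with u hu
    exact (abs_lt.2 (hsμ hu)).le.trans (le_max_left _ _)
  have hs := Real.sqrt_pos.2 hM₁
  refine ⟨min √M₁ σ₀, max √M₂ σ₀, max M 0, ⟨min_le_right _ _, le_max_right _ _⟩,
    hmodel.iidData (lt_min hs hσ₀) ((min_le_right _ _).trans (le_max_right _ _))
      (le_max_right _ _) hμae ?_⟩
  filter_upwards [hσae] with v hv
  have hv0 : 0 ≤ v := (hM₁.trans hv.1).le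
  have hlo : 0 ≤ min √M₁ σ₀ := (lt_min hs hσ₀).le
  constructor
  · calc min √M₁ σ₀ ^ 2 ≤ √M₁ ^ 2 := by gcongr; exact min_le_left _ _
      _ = M₁ := Real.sq_sqrt hM₁.le
      _ ≤ v := hv.1.le
  · calc v ≤ M₂ := hv.2.le
      _ = √M₂ ^ 2 := (Real.sq_sqrt (hv0.trans hv.2.le)).symm
      _ ≤ max √M₂ σ₀ ^ 2 := by gcongr; exact le_max_left _ _

end HART

theorem proposition1 {Ω : Type*} [MeasurableSpace Ω] (P : Measure Ω) [IsProbabilityMeasure P]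
    (p : ℝ) (gμ gσ : Measure ℝ) [IsProbabilityMeasure gμ] [IsProbabilityMeasure gσ]
    (μ σ X : ℕ → Ω → ℝ) (hmodel : HART.Model P p gμ gσ μ σ X)
    (hsupp : HART.SupportCondition gμ gσ)
    (hx hσ : ℕ → ℝ) (hband : HART.BandwidthCondition hx hσ)
    (pHat : ℕ → Ω → ℝ) (hpHat_meas : ∀ m, Measurable (pHat m))
    (hpHat_mem : ∀ m, ∀ᵐ ω ∂P, pHat m ω ∈ Set.Icc (0 : ℝ) 1)
    (hpHat : TendstoInMeasure P pHat atTop (fun _ => p)) :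
    -- the integrated mean squared error vanishes at every point of positive lower density
    (∀ σ₀ : ℝ, 0 < σ₀ → HART.PosLowerDensity gσ (σ₀ ^ 2) →
      Tendsto (fun m => HART.mise P p gμ σ X (hx m) (hσ m) (pHat m) m σ₀) atTop (𝓝 0)) ∧
    -- in particular at almost every point
    (∀ᵐ v ∂gσ,
      Tendsto (fun m => HART.mise P p gμ σ X (hx m) (hσ m) (pHat m) m √v) atTop (𝓝 0)) ∧
    -- convergence in probability of the plug-in statistics, for each `i`
    (∀ i : ℕ, TendstoInMeasure P
      (fun m ω => HART.THat (hx m) (hσ m) (pHat m ω) m (fun j => X j ω) (fun j => σ j ω) i)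
      atTop (fun ω => HART.oracleT p gμ (X i ω) (σ i ω))) ∧
    -- and uniformly over `i < m`
    (∀ ε : ℝ, 0 < ε → Tendsto (fun m => ⨆ i ∈ Finset.range m,
      P {ω | ε ≤ |HART.THat (hx m) (hσ m) (pHat m ω) m (fun j => X j ω) (fun j => σ j ω) i -
        HART.oracleT p gμ (X i ω) (σ i ω)|}) atTop (𝓝 0)) := by
  have hprob : IsProbabilityMeasure (gσ.map Real.sqrt) :=
    Measure.isProbabilityMeasure_map Real.continuous_sqrt.measurable.aemeasurable
  have hlik : ∀ η : ℝ, 0 < η → HART.Likely P 1 fun m ω => |pHat m ω - p| ≤ η :=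
    fun η hη => HART.likely_of_tendstoInMeasure hpHat hη
  have hmise : ∀ σ₀ : ℝ, 0 < σ₀ → HART.PosLowerDensity gσ (σ₀ ^ 2) →
      Tendsto (fun m => HART.mise P p gμ σ X (hx m) (hσ m) (pHat m) m σ₀) atTop (𝓝 0) := by
    intro σ₀ hσ₀ hd
    obtain ⟨lo, hi, M, hmem, D⟩ := hmodel.exists_iidData hsupp hσ₀
    obtain ⟨θ, hθ, h₀⟩ := HART.eventually_le_kap hσ₀ hd hband.hσ_pos hband.hσ_zero
    exact D.tendsto_mise hband hmodel.gμ_zero hpHat_mem hlik hmem hθ h₀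
  obtain ⟨lo, hi, M, -, D⟩ := hmodel.exists_iidData hsupp one_pos
  have hunif := fun (ε : ℝ) (hε : 0 < ε) => D.tendsto_iSup_measure hband
    (D.consistentT_THat hband hpHat_mem hlik) hε
  refine ⟨hmise, ?_, HART.tendstoInMeasure_of_tendsto_iSup hunif, hunif⟩
  obtain ⟨M₁, M₂, -, hM₁, hsσ, -⟩ := hsupp
  filter_upwards [HART.ae_posLowerDensity gσ, Measure.support_mem_ae (μ := gσ)] with v hv hvs
  have hv0 : 0 < v := hM₁.trans (hsσ hvs).1
  exact hmise √v (Real.sqrt_pos.2 hv0) (by rwa [Real.sq_sqrt hv0.le])
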